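/- All algebras are unital over $\mathbb{C}$. Let $A$ be a Hopf $*$-algebra (a Hopf algebra with bijective antipode $S$ and a $*$-algebra structure for which $\Delta$ is a $*$-homomorphism), and let $B$ be a left $A$-comodule $*$-algebra, i.e. a $*$-algebra with a left coaction $B\to A\otimes B$, $b\mapsto b_{(-1)}\otimes b_{(0)}$, that is a $*$-homomorphism. An $A$-covariant $*$-differential calculus on $B$ is a differential graded algebra $(\Omega^\bullet=\bigoplus_{k\ge 0}\Omega^k,\wedge,d)$ with $\Omega^0=B$, generated as an algebra by $B$ and $dB$, together with a left $A$-coaction on $\Omega^\bullet$ that extends the one of $B$, is an algebra map $\Omega^\bullet\to A\otimes\Omega^\bullet$, preserves each $\Omega^k$ and commutes with $d$, and a conjugate linear involution $*$ on $\Omega^\bullet$ that extends the one of $B$, preserves each $\Omega^k$, commutes with $d$, satisfies $(\omega\wedge\nu)^*=(-1)^{kl}\nu^*\wedge\omega^*$ for $\omega\in\Omega^k$, $\nu\in\Omega^l$, and is compatible with the coaction: the coaction sends $\omega^*$ to $\omega_{(-1)}^*\otimes\omega_{(0)}^*$. An $A$-covariant complex structure $(\Omega^{(\bullet,\bullet)},\wedge,\partial,\overline\partial)$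 for this calculus is an $\mathbb{N}_0^2$-algebra grading $\Omega^\bullet=\bigoplus_{(p,q)}\Omega^{(p,q)}$ by $A$-subcomodules such that $\Omega^{(0,0)}=B$, $\Omega^k=\bigoplus_{p+q=k}\Omega^{(p,q)}$, $(\Omega^{(p,q)})^*=\Omega^{(q,p)}$ and $d(\Omega^{(p,q)})\subseteq\Omega^{(p+1,q)}\oplus\Omega^{(p,q+1)}$ for all $p,q,k$, where $\partial$ and $\overline\partial$ are, on $\Omega^{(p,q)}$, the components of $d$ in $\Omega^{(p+1,q)}$ and $\Omega^{(p,q+1)}$ respectively. Let $\gamma:A\otimes A\to\mathbb{C}$ be a unitary $2$-cocycle, i.e. a convolution invertible linear map, with convolution inverse $\overline\gamma$, such that for all $g,h,k,a,b\in A$ $$\gamma(g_{(1)}\otimes h_{(1)})\,\gamma(g_{(2)}h_{(2)}\otimes k)=\gamma(h_{(1)}\otimes k_{(1)})\,\gamma(g\otimes h_{(2)}k_{(2)}),$$ $$\gamma(h\otimes 1)=\epsilon(h)=\gamma(1\otimes h),\qquad \overline{\gamma(a\otimes b)}=\overline\gamma(S(a)^*\otimes S(b)^*).$$ Put $U(k)=\gamma(k_{(1)}\otimes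 S(k_{(2)}))$, $\overline U(k)=\overline\gamma(S(k_{(1)})\otimes k_{(2)})$, $V=U\circ S^{-1}$, $\overline V=\overline U\circ S^{-1}$. Let $A_\gamma$ be the coalgebra $A$ with the same unit and with $$h\cdot_\gamma k=\gamma(h_{(1)}\otimes k_{(1)})h_{(2)}k_{(2)}\overline\gamma(h_{(3)}\otimes k_{(3)}),\quad S_\gamma(h)=U(h_{(1)})S(h_{(2)})\overline U(h_{(3)}),\quad h^{*_\gamma}=\overline V(h_{(1)}^*)\,h_{(2)}^*\,V(h_{(3)}^*).$$ Let $B_\gamma$ and $\Omega^\bullet_\gamma$ be the vector spaces $B$ and $\Omega^\bullet$ with the same units, coactions, grading and differential $d_\gamma=d$, and with the products and involutions $$x\cdot_\gamma y=\gamma(x_{(-1)}\otimes y_{(-1)})\,x_{(0)}y_{(0)},\qquad x^{*_\gamma}=\overline V(x_{(-1)}^*)\,x_{(0)}^*$$ (for $\Omega^\bullet$ the product is $\wedge$ and the twisted one is written $\wedge_\gamma$). Let $\Omega^{(p,q)}_\gamma=\Gamma(\Omega^{(p,q)})$ be the vector space $\Omega^{(p,q)}$ with the same coaction and the twisted actions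 $b\cdot_\gamma\omega=\gamma(b_{(-1)}\otimes\omega_{(-1)})\,b_{(0)}\omega_{(0)}$ and $\omega\cdot_\gamma b=\gamma(\omega_{(-1)}\otimes b_{(-1)})\,\omega_{(0)}b_{(0)}$ of $B_\gamma$, and let $\partial_\gamma=\Gamma(\partial)$, $\overline\partial_\gamma=\Gamma(\overline\partial)$ be the maps $\partial,\overline\partial$ regarded as maps between these spaces. **Proposition.** Let $(\Omega^{(\bullet,\bullet)},\wedge,\partial,\overline\partial)$ be an $A$-covariant complex structure for an $A$-covariant $*$-differential calculus $(\Omega^\bullet,\wedge,d)$ on $B$ and let $\gamma$ be a unitary $2$-cocycle on $A$. Then $A_\gamma$ is a Hopf $*$-algebra, $B_\gamma$ is a left $A_\gamma$-comodule $*$-algebra, $(\Omega^\bullet_\gamma,\wedge_\gamma,d_\gamma)$ is an $A_\gamma$-covariant $*$-differential calculus on $B_\gamma$, the $B_\gamma$-actions on $\Omega^{(p,q)}_\gamma$ are those given by $\wedge_\gamma$, and $(\Omega^{(\bullet,\bullet)}_\gamma,\wedge_\gamma,\partial_\gamma,\overline\partial_\gamma)$ is an $A_\gamma$-covariant complex structure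 for $(\Omega^\bullet_\gamma,\wedge_\gamma,d_\gamma)$. -/

import Mathlib

open scoped TensorProduct ComplexConjugate

noncomputable section

namespace CocycleTwist

/-! A cocycle twist keeps the underlying vector spaces, coproducts, coactions, gradings and
differentials, and changes only products, antipodes and involutions.  For this reason the
operations are recorded as data on a fixed complex vector space, and the laws they have to satisfy
are separate propositions, which are then used both for the original and for the twisted data. -/

section Algebras

variable {V W : Type*} [AddCommGroup V] [Module ℂ V] [AddCommGroup W] [Module ℂ W]

/-- A bilinear product and a unit candidate on a complex vector space. -/
structure AlgData (V : Type*) [AddCommGroup V] [Module ℂ V] where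
  mul : V →ₗ[ℂ] V →ₗ[ℂ] V
  one : V

/-- The data form an associative unital complex algebra. -/
structure AlgData.IsAlgebra (m : AlgData V) : Prop where
  mul_assoc : ∀ a b c, m.mul (m.mul a b) c = m.mul a (m.mul b c)
  one_mul : ∀ a, m.mul m.one a = a
  mul_one : ∀ a, m.mul a m.one = a

/-- The product as a linear map on the tensor square. -/
def AlgData.mulMap (m : AlgData V) : V ⊗[ℂ] V →ₗ[ℂ] V := TensorProduct.lift m.mul

/-- The tensor product algebra, `(a ⊗ b) (a' ⊗ b') = a a' ⊗ b b'`. -/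
def AlgData.tensor (m : AlgData V) (n : AlgData W) : AlgData (V ⊗[ℂ] W) where
  mul := TensorProduct.map₂ m.mul n.mul
  one := m.one ⊗ₜ n.one

/-- A product and a unit, together with a conjugate linear map `∗`. -/
structure StarAlgData (V : Type*) [AddCommGroup V] [Module ℂ V] extends AlgData V where
  star : V →ₗ⋆[ℂ] V

/-- The map `∗ ⊗ ∗`. -/
def StarAlgData.starTensor (m : StarAlgData V) (n : StarAlgData W) :
    V ⊗[ℂ] W →ₗ⋆[ℂ] V ⊗[ℂ] W :=
  TensorProduct.map m.star n.star

/-- The data form a complex (unital, associative) `∗`-algebra. -/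
structure StarAlgData.IsStarAlgebra (m : StarAlgData V) : Prop
    extends m.toAlgData.IsAlgebra where
  star_star : ∀ a, m.star (m.star a) = a
  star_mul : ∀ a b, m.star (m.mul a b) = m.mul (m.star b) (m.star a)

end Algebras

section Hopf

variable {A : Type*} [AddCommGroup A] [Module ℂ A] [Coalgebra ℂ A]

/-- Product, unit, involution and antipode on a complex coalgebra. -/
structure HopfStarData (A : Type*) [AddCommGroup A] [Module ℂ A] extends StarAlgData A where
  antipode : A →ₗ[ℂ] A

/-- The data, with the given coalgebra structure, form a Hopf `∗`-algebra with bijective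
antipode. -/
structure HopfStarData.IsHopfStarAlgebra (H : HopfStarData A) : Prop
    extends H.toStarAlgData.IsStarAlgebra where
  comul_one : Coalgebra.comul (R := ℂ) H.one = H.one ⊗ₜ[ℂ] H.one
  comul_mul : ∀ a b, Coalgebra.comul (R := ℂ) (H.mul a b) =
    (H.toAlgData.tensor H.toAlgData).mul (Coalgebra.comul a) (Coalgebra.comul b)
  counit_one : Coalgebra.counit (R := ℂ) H.one = 1
  counit_mul : ∀ a b, Coalgebra.counit (R := ℂ) (H.mul a b) =
    Coalgebra.counit a * Coalgebra.counit b
  antipode_left : ∀ a, H.mulMap (H.antipode.rTensor A (Coalgebra.comul a)) =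
    Coalgebra.counit (R := ℂ) a • H.one
  antipode_right : ∀ a, H.mulMap (H.antipode.lTensor A (Coalgebra.comul a)) =
    Coalgebra.counit (R := ℂ) a • H.one
  antipode_bijective : Function.Bijective H.antipode
  comul_star : ∀ a, Coalgebra.comul (R := ℂ) (H.star a) =
    H.starTensor H.toStarAlgData (Coalgebra.comul a)

/-- The inverse `S⁻¹` of the antipode (in the ring of endomorphisms). -/
def HopfStarData.antipodeInv (H : HopfStarData A) : A →ₗ[ℂ] A :=
  Ring.inverse (H.antipode : Module.End ℂ A)

end Hopf

section Comodules

variable {A M N : Type*} [AddCommGroup A] [Module ℂ A] [Coalgebra ℂ A]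
  [AddCommGroup M] [Module ℂ M] [AddCommGroup N] [Module ℂ N]

/-- `δ` is a left coaction of the coalgebra `A` on `M`. -/
structure IsCoaction (δ : M →ₗ[ℂ] A ⊗[ℂ] M) : Prop where
  coassoc : ∀ x, TensorProduct.assoc ℂ A A M
      ((Coalgebra.comul (R := ℂ) (A := A)).rTensor M (δ x)) = δ.lTensor A (δ x)
  counit : ∀ x, TensorProduct.lid ℂ M
      ((Coalgebra.counit (R := ℂ) (A := A)).rTensor M (δ x)) = x

/-- The coaction maps the subspace `P` into `A ⊗ P`. -/
def IsSubcomodule (δ : M →ₗ[ℂ] A ⊗[ℂ] M) (P : Submodule ℂ M) : Prop :=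
  ∀ x ∈ P, δ x ∈ LinearMap.range (P.subtype.lTensor A)

/-- `(M, δ)` is a left comodule algebra over the Hopf algebra `A`. -/
structure IsComoduleAlgebra (H : AlgData A) (m : AlgData M) (δ : M →ₗ[ℂ] A ⊗[ℂ] M) : Prop
    extends IsCoaction δ where
  coaction_one : δ m.one = H.one ⊗ₜ m.one
  coaction_mul : ∀ a b, δ (m.mul a b) = (H.tensor m).mul (δ a) (δ b)

/-- The diagonal coaction of `A ⊗ A` on `M ⊗ N`,
`m ⊗ n ↦ (m₍₋₁₎ ⊗ n₍₋₁₎) ⊗ (m₍₀₎ ⊗ n₍₀₎)`. -/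
def tensorCoaction (δ : M →ₗ[ℂ] A ⊗[ℂ] M) (δ' : N →ₗ[ℂ] A ⊗[ℂ] N) :
    M ⊗[ℂ] N →ₗ[ℂ] (A ⊗[ℂ] A) ⊗[ℂ] (M ⊗[ℂ] N) :=
  (TensorProduct.tensorTensorTensorComm ℂ A M A N).toLinearMap ∘ₗ TensorProduct.map δ δ'

/-- `c ⊗ m ↦ φ(c) m`. -/
def evalLeft {C : Type*} [AddCommGroup C] [Module ℂ C] (φ : C →ₗ[ℂ] ℂ) :
    C ⊗[ℂ] M →ₗ[ℂ] M :=
  (TensorProduct.lid ℂ M).toLinearMap ∘ₗ φ.rTensor M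

/-- `m ⊗ c ↦ φ(c) m`. -/
def evalRight {C : Type*} [AddCommGroup C] [Module ℂ C] (φ : C →ₗ[ℂ] ℂ) :
    M ⊗[ℂ] C →ₗ[ℂ] M :=
  (TensorProduct.rid ℂ M).toLinearMap ∘ₗ φ.lTensor M

/-- The map `c ↦ φ(c₍₁₎) c₍₂₎ ψ(c₍₃₎)` on a coalgebra. -/
def sandwich {C : Type*} [AddCommGroup C] [Module ℂ C] [Coalgebra ℂ C] (φ ψ : C →ₗ[ℂ] ℂ) :
    C →ₗ[ℂ] C :=
  (evalRight ψ ∘ₗ Coalgebra.comul) ∘ₗ (evalLeft φ ∘ₗ Coalgebra.comul)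

/-- The twist `x ⊗ y ↦ γ(x₍₋₁₎ ⊗ y₍₋₁₎) f(x₍₀₎ ⊗ y₍₀₎)` of a map `f` on `M ⊗ N`. -/
def twistMap {P : Type*} [AddCommGroup P] [Module ℂ P] (γ : A ⊗[ℂ] A →ₗ[ℂ] ℂ)
    (δ : M →ₗ[ℂ] A ⊗[ℂ] M) (δ' : N →ₗ[ℂ] A ⊗[ℂ] N) (f : M ⊗[ℂ] N →ₗ[ℂ] P) :
    M ⊗[ℂ] N →ₗ[ℂ] P :=
  f ∘ₗ evalLeft γ ∘ₗ tensorCoaction δ δ'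

end Comodules

section Cocycles

variable {A : Type*} [AddCommGroup A] [Module ℂ A] [Coalgebra ℂ A]

/-- The convolution product `(φ ∗ ψ)(c) = φ(c₍₁₎) ψ(c₍₂₎)` of linear functionals. -/
def conv {C : Type*} [AddCommGroup C] [Module ℂ C] [Coalgebra ℂ C] (φ ψ : C →ₗ[ℂ] ℂ) :
    C →ₗ[ℂ] ℂ :=
  (WithConv.toConv φ * WithConv.toConv ψ).ofConv

/-- The convolution inverse `γ̄` (meaningful if `γ` is convolution invertible). -/
def convInv {C : Type*} [AddCommGroup C] [Module ℂ C] [Coalgebra ℂ C] (γ : C →ₗ[ℂ] ℂ) :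
    C →ₗ[ℂ] ℂ :=
  (Ring.inverse (WithConv.toConv γ)).ofConv

namespace HopfStarData

variable (H : HopfStarData A) (γ : A ⊗[ℂ] A →ₗ[ℂ] ℂ)

/-- `γ` is a unital `2`-cocycle.  The cocycle identity reads
`γ(g₍₁₎ ⊗ h₍₁₎) γ(g₍₂₎h₍₂₎ ⊗ k) = γ(h₍₁₎ ⊗ k₍₁₎) γ(g ⊗ h₍₂₎k₍₂₎)`. -/
structure IsTwoCocycle : Prop where
  isUnit : IsUnit (WithConv.toConv γ)
  cocycle : ∀ g h k : A,
    conv γ (γ ∘ₗ (TensorProduct.mk ℂ A A).flip k ∘ₗ H.mulMap) (g ⊗ₜ h) =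
      conv γ (γ ∘ₗ TensorProduct.mk ℂ A A g ∘ₗ H.mulMap) (h ⊗ₜ k)
  map_one_right : ∀ h : A, γ (h ⊗ₜ H.one) = Coalgebra.counit h
  map_one_left : ∀ h : A, γ (H.one ⊗ₜ h) = Coalgebra.counit h

/-- `γ` is a unitary (unital) `2`-cocycle. -/
structure IsUnitaryTwoCocycle : Prop extends H.IsTwoCocycle γ where
  unitary : ∀ a b : A, conj (γ (a ⊗ₜ b)) =
    convInv γ (H.star (H.antipode a) ⊗ₜ H.star (H.antipode b))

/-- `U(k) = γ(k₍₁₎ ⊗ S(k₍₂₎))`. -/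
def U : A →ₗ[ℂ] ℂ := γ ∘ₗ H.antipode.lTensor A ∘ₗ Coalgebra.comul

/-- `Ū(k) = γ̄(S(k₍₁₎) ⊗ k₍₂₎)`. -/
def Ubar : A →ₗ[ℂ] ℂ := convInv γ ∘ₗ H.antipode.rTensor A ∘ₗ Coalgebra.comul

/-- `V(k) = U(S⁻¹(k))`. -/
def V : A →ₗ[ℂ] ℂ := H.U γ ∘ₗ H.antipodeInv

/-- `V̄(k) = Ū(S⁻¹(k))`. -/
def Vbar : A →ₗ[ℂ] ℂ := H.Ubar γ ∘ₗ H.antipodeInv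

/-- The twist `A_γ` of a Hopf `∗`-algebra (on the same coalgebra):
`h ·_γ k = γ(h₍₁₎ ⊗ k₍₁₎) h₍₂₎k₍₂₎ γ̄(h₍₃₎ ⊗ k₍₃₎)`,
`S_γ(h) = U(h₍₁₎) S(h₍₂₎) Ū(h₍₃₎)` and
`h^{∗_γ} = V̄((h∗)₍₁₎) (h∗)₍₂₎ V((h∗)₍₃₎)`. -/
def twist : HopfStarData A where
  mul := TensorProduct.curry (H.mulMap ∘ₗ sandwich γ (convInv γ))
  one := H.one
  star := (sandwich (H.Vbar γ) (H.V γ)).comp H.star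
  antipode := H.antipode ∘ₗ sandwich (H.U γ) (H.Ubar γ)

end HopfStarData

/-- The twist `M_γ` of a left comodule `∗`-algebra:
`a ·_γ b = γ(a₍₋₁₎ ⊗ b₍₋₁₎) a₍₀₎b₍₀₎` and `b^{∗_γ} = V̄(b₍₋₁₎∗) b₍₀₎∗`. -/
def StarAlgData.twist {M : Type*} [AddCommGroup M] [Module ℂ M] (m : StarAlgData M)
    (H : HopfStarData A) (γ : A ⊗[ℂ] A →ₗ[ℂ] ℂ) (δ : M →ₗ[ℂ] A ⊗[ℂ] M) : StarAlgData M where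
  mul := TensorProduct.curry (twistMap γ δ δ m.mulMap)
  one := m.one
  star := (evalLeft (H.Vbar γ)).comp ((H.toStarAlgData.starTensor m).comp δ)

end Cocycles

section Calculi

variable {A B Ω : Type*} [AddCommGroup A] [Module ℂ A] [Coalgebra ℂ A]
  [AddCommGroup B] [Module ℂ B] [AddCommGroup Ω] [Module ℂ Ω]

/-- The data of a differential calculus with involution and coaction: the algebra `B`, the algebra
of forms `Ω = ⨁ₖ Ωᵏ`, the identification `incl` of `B` with `Ω⁰`, and the differential. -/
structure CalculusData (A B Ω : Type*) [AddCommGroup A] [Module ℂ A]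
    [AddCommGroup B] [Module ℂ B] [AddCommGroup Ω] [Module ℂ Ω] where
  base : StarAlgData B
  baseCoaction : B →ₗ[ℂ] A ⊗[ℂ] B
  forms : StarAlgData Ω
  coaction : Ω →ₗ[ℂ] A ⊗[ℂ] Ω
  incl : B →ₗ[ℂ] Ω
  grade : ℕ → Submodule ℂ Ω
  d : Ω →ₗ[ℂ] Ω

namespace CalculusData

variable (H : HopfStarData A) (X : CalculusData A B Ω)

/-- `B` is a left comodule `∗`-algebra over `A`. -/
structure IsComoduleStarBase : Prop
    extends X.base.IsStarAlgebra,
      IsComoduleAlgebra H.toAlgData X.base.toAlgData X.baseCoaction where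
  coaction_star : ∀ b, X.baseCoaction (X.base.star b) =
    H.starTensor X.base (X.baseCoaction b)

/-- `(Ω, ∧, d)` is a differential calculus over the algebra `B`: a differential graded algebra
with `Ω⁰ = B`, generated as an algebra by `B` and `dB`. -/
structure IsCalculus : Prop extends X.forms.toAlgData.IsAlgebra where
  internal : DirectSum.IsInternal X.grade
  one_mem : X.forms.one ∈ X.grade 0
  mul_mem : ∀ k l, ∀ ω ∈ X.grade k, ∀ η ∈ X.grade l, X.forms.mul ω η ∈ X.grade (k + l)
  incl_injective : Function.Injective X.incl
  range_incl : LinearMap.range X.incl = X.grade 0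
  incl_one : X.incl X.base.one = X.forms.one
  incl_mul : ∀ a b, X.incl (X.base.mul a b) = X.forms.mul (X.incl a) (X.incl b)
  d_mem : ∀ k, ∀ ω ∈ X.grade k, X.d ω ∈ X.grade (k + 1)
  d_d : ∀ ω, X.d (X.d ω) = 0
  leibniz : ∀ k, ∀ ω ∈ X.grade k, ∀ η,
    X.d (X.forms.mul ω η) = X.forms.mul (X.d ω) η + (-1 : ℂ) ^ k • X.forms.mul ω (X.d η)
  generated : ∀ W : Submodule ℂ Ω, X.forms.one ∈ W →
    (∀ ω ∈ W, ∀ η ∈ W, X.forms.mul ω η ∈ W) →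
    (∀ b, X.incl b ∈ W) → (∀ b, X.d (X.incl b) ∈ W) → W = ⊤

/-- `(Ω, ∧, d)` is an `A`-covariant `∗`-differential calculus over the left comodule `∗`-algebra
`B`. -/
structure IsCovariantStarCalculus : Prop extends X.IsCalculus where
  base_isComoduleStar : X.IsComoduleStarBase H
  isComoduleAlgebra : IsComoduleAlgebra H.toAlgData X.forms.toAlgData X.coaction
  coaction_incl : ∀ b, X.coaction (X.incl b) = X.incl.lTensor A (X.baseCoaction b)
  grade_subcomodule : ∀ k, IsSubcomodule X.coaction (X.grade k)
  coaction_d : ∀ ω, X.coaction (X.d ω) = X.d.lTensor A (X.coaction ω)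
  star_star : ∀ ω, X.forms.star (X.forms.star ω) = ω
  star_incl : ∀ b, X.forms.star (X.incl b) = X.incl (X.base.star b)
  star_mem : ∀ k, ∀ ω ∈ X.grade k, X.forms.star ω ∈ X.grade k
  star_d : ∀ ω, X.forms.star (X.d ω) = X.d (X.forms.star ω)
  star_mul : ∀ k l, ∀ ω ∈ X.grade k, ∀ η ∈ X.grade l,
    X.forms.star (X.forms.mul ω η) =
      (-1 : ℂ) ^ (k * l) • X.forms.mul (X.forms.star η) (X.forms.star ω)
  coaction_star : ∀ ω, X.coaction (X.forms.star ω) =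
    H.starTensor X.forms (X.coaction ω)

/-- The left action `b ⊗ ω ↦ b ω` of `B` on forms. -/
def leftAction : B ⊗[ℂ] Ω →ₗ[ℂ] Ω := X.forms.mulMap ∘ₗ X.incl.rTensor Ω

/-- The right action `ω ⊗ b ↦ ω b` of `B` on forms. -/
def rightAction : Ω ⊗[ℂ] B →ₗ[ℂ] Ω := X.forms.mulMap ∘ₗ X.incl.lTensor Ω

/-- The twisted calculus `(Ω_γ, ∧_γ, d_γ)` over `B_γ`. -/
def twist (γ : A ⊗[ℂ] A →ₗ[ℂ] ℂ) : CalculusData A B Ω where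
  base := X.base.twist H γ X.baseCoaction
  baseCoaction := X.baseCoaction
  forms := X.forms.twist H γ X.coaction
  coaction := X.coaction
  incl := X.incl
  grade := X.grade
  d := X.d

end CalculusData

/-- The projection onto the `i`-th summand of a direct sum decomposition. -/
def gradeProj {ι : Type*} [DecidableEq ι] (N : ι → Submodule ℂ Ω) (i : ι) : Ω →ₗ[ℂ] Ω :=
  open Classical in
  if h : DirectSum.IsInternal N then
    (N i).subtype ∘ₗ DirectSum.component ℂ ι (fun j => N j) i ∘ₗ
      (LinearEquiv.ofBijective (DirectSum.coeLinearMap N)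
        (show Function.Bijective (DirectSum.coeLinearMap N) from h)).symm.toLinearMap
  else 0

/-- The data of a calculus with subspaces `Ω^(p,q)` and maps `∂` and `∂̄`. -/
structure ComplexData (A B Ω : Type*) [AddCommGroup A] [Module ℂ A]
    [AddCommGroup B] [Module ℂ B] [AddCommGroup Ω] [Module ℂ Ω]
    extends CalculusData A B Ω where
  bigrade : ℕ × ℕ → Submodule ℂ Ω
  del : Ω →ₗ[ℂ] Ω
  delbar : Ω →ₗ[ℂ] Ω

namespace ComplexData

variable (H : HopfStarData A) (X : ComplexData A B Ω)

/-- `(Ω^(•,•), ∧, ∂, ∂̄)` is an `A`-covariant complex structure for the `A`-covariant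
`∗`-differential calculus `(Ω, ∧, d)`. -/
structure IsCovariantComplexStructure : Prop
    extends X.toCalculusData.IsCovariantStarCalculus H where
  bigrade_internal : DirectSum.IsInternal X.bigrade
  bigrade_one_mem : X.forms.one ∈ X.bigrade (0, 0)
  bigrade_mul_mem : ∀ p q, ∀ ω ∈ X.bigrade p, ∀ η ∈ X.bigrade q,
    X.forms.mul ω η ∈ X.bigrade (p + q)
  grade_eq : ∀ k, X.grade k = ⨆ (p : ℕ × ℕ) (_ : p.1 + p.2 = k), X.bigrade p
  bigrade_zero : X.bigrade (0, 0) = X.grade 0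
  star_bigrade : ∀ p q,
    X.forms.star '' (X.bigrade (p, q) : Set Ω) = (X.bigrade (q, p) : Set Ω)
  d_bigrade : ∀ p q, ∀ ω ∈ X.bigrade (p, q),
    X.d ω ∈ X.bigrade (p + 1, q) ⊔ X.bigrade (p, q + 1)
  del_eq : ∀ p q, ∀ ω ∈ X.bigrade (p, q), X.del ω = gradeProj X.bigrade (p + 1, q) (X.d ω)
  delbar_eq : ∀ p q, ∀ ω ∈ X.bigrade (p, q),
    X.delbar ω = gradeProj X.bigrade (p, q + 1) (X.d ω)
  bigrade_subcomodule : ∀ p q, IsSubcomodule X.coaction (X.bigrade (p, q))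

/-- The twisted data: the subspaces `Ω^(p,q)_γ = Γ(Ω^(p,q))` and the maps `∂_γ = Γ(∂)` and
`∂̄_γ = Γ(∂̄)` are the given ones, as `Γ` does not change vector spaces and linear maps. -/
def twist (γ : A ⊗[ℂ] A →ₗ[ℂ] ℂ) : ComplexData A B Ω where
  toCalculusData := X.toCalculusData.twist H γ
  bigrade := X.bigrade
  del := X.del
  delbar := X.delbar

end ComplexData

end Calculi

section Mathlib

/-- The data of a Hopf algebra with involution in the sense of Mathlib. -/
def HopfStarData.ofHopfAlgebra (A : Type*) [Ring A] [HopfAlgebra ℂ A] [StarRing A]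
    [StarModule ℂ A] : HopfStarData A where
  mul := LinearMap.mul ℂ A
  one := 1
  star := (starLinearEquiv ℂ (A := A)).toLinearMap
  antipode := HopfAlgebra.antipode ℂ

theorem mul_tensor_eq {A : Type*} [Ring A] [Algebra ℂ A] (x y : A ⊗[ℂ] A) :
    x * y = TensorProduct.map₂ (LinearMap.mul ℂ A) (LinearMap.mul ℂ A) x y := by
  induction x with
  | zero => simp
  | add x x' hx hx' => simp [add_mul, hx, hx']
  | tmul a b =>
    induction y with
    | zero => simp
    | add y y' hy hy' => simp [mul_add, hy, hy']
    | tmul c d => simp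

/-- Hopf `∗`-algebras in Mathlib's sense satisfy the laws above. -/
theorem HopfStarData.ofHopfAlgebra_isHopfStarAlgebra (A : Type*) [Ring A] [HopfAlgebra ℂ A]
    [StarRing A] [StarModule ℂ A]
    (hS : Function.Bijective (HopfAlgebra.antipode ℂ (A := A)))
    (hstar : ∀ a : A, Coalgebra.comul (R := ℂ) (star a) =
      TensorProduct.map (starLinearEquiv ℂ (A := A)).toLinearMap
        (starLinearEquiv ℂ (A := A)).toLinearMap (Coalgebra.comul a)) :
    (HopfStarData.ofHopfAlgebra A).IsHopfStarAlgebra where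
  mul_assoc := mul_assoc
  one_mul := one_mul
  mul_one := mul_one
  star_star := star_star
  star_mul := star_mul
  comul_one := Bialgebra.comul_one
  comul_mul a b := by
    rw [show (HopfStarData.ofHopfAlgebra A).mul a b = a * b from rfl, Bialgebra.comul_mul,
      mul_tensor_eq]
    rfl
  counit_one := Bialgebra.counit_one
  counit_mul a b := Bialgebra.counit_mul a b
  antipode_left a := by
    have h := LinearMap.congr_fun (HopfAlgebra.mul_antipode_rTensor_comul (R := ℂ) (A := A)) a
    exact h.trans (Algebra.algebraMap_eq_smul_one _)
  antipode_right a := by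
    have h := LinearMap.congr_fun (HopfAlgebra.mul_antipode_lTensor_comul (R := ℂ) (A := A)) a
    exact h.trans (Algebra.algebraMap_eq_smul_one _)
  antipode_bijective := hS
  comul_star := hstar

/-- The ring structure carried by data satisfying the laws of an algebra. -/
@[reducible] def AlgData.IsAlgebra.toRing {V : Type*} [i : AddCommGroup V] [Module ℂ V]
    {m : AlgData V} (h : m.IsAlgebra) : Ring V :=
  { i with
    mul := fun a b => m.mul a b
    one := m.one
    left_distrib := fun a b c => (m.mul a).map_add b c
    right_distrib := fun a b c => m.mul.map_add₂ a b c
    zero_mul := fun a => m.mul.map_zero₂ a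
    mul_zero := fun a => (m.mul a).map_zero
    mul_assoc := h.mul_assoc
    one_mul := h.one_mul
    mul_one := h.mul_one
    zsmul := i.zsmul
    zsmul_zero' := i.zsmul_zero'
    zsmul_succ' := i.zsmul_succ'
    zsmul_neg' := i.zsmul_neg'
    neg_add_cancel := i.neg_add_cancel }

/-- The algebra structure carried by data satisfying the laws of an algebra. -/
@[reducible] def AlgData.IsAlgebra.toAlgebra {V : Type*} [AddCommGroup V] [j : Module ℂ V]
    {m : AlgData V} (h : m.IsAlgebra) : @Algebra ℂ V _ h.toRing.toSemiring :=
  letI := h.toRing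
  letI : Module ℂ V := j
  Algebra.ofModule (fun r x y => m.mul.map_smul₂ r x y) (fun r x y => (m.mul x).map_smul r y)

/-- The laws above give a Hopf algebra in Mathlib's sense. -/
@[reducible] def HopfStarData.IsHopfStarAlgebra.toHopfAlgebra {A : Type*} [AddCommGroup A]
    [Module ℂ A] [c : Coalgebra ℂ A] {H : HopfStarData A} (h : H.IsHopfStarAlgebra) :
    @HopfAlgebra ℂ A _ h.toIsAlgebra.toRing.toSemiring :=
  letI := h.toIsAlgebra.toRing
  letI := h.toIsAlgebra.toAlgebra
  letI _C : @Coalgebra ℂ A _ _ _ := c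
  letI : Bialgebra ℂ A := Bialgebra.mk' ℂ A h.counit_one (fun {a b} => h.counit_mul a b)
    h.comul_one (fun {a b} => (h.comul_mul a b).trans (mul_tensor_eq _ _).symm)
  { antipode := H.antipode
    mul_antipode_rTensor_comul := LinearMap.ext fun a =>
      (h.antipode_left a)
    mul_antipode_lTensor_comul := LinearMap.ext fun a =>
      (h.antipode_right a) }

end Mathlib

end CocycleTwist

end

open scoped TensorProduct
open CocycleTwist

/-! A functional φ on `A` acts on every left comodule by x ↦ φ(x₍₋₁₎) x₍₀₎ (`lact`), and a
functional on A ⊗ A acts in the same way on M ⊗ N. These operators compose by reversed convolution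
(`IsCoaction.lact_lact`) and are natural in equivariant maps (`lact_comp_of_equivariant`). Every
twisted operation is the old one composed with such operators: the product of a comodule algebra is
preceded by the action of γ, the involution is followed by that of V̄, and on `A` itself there are
also operators from the right, given by γ̄ and V. Each twisted axiom thus splits into the old axiom
and an identity in the convolution algebra of A, A ⊗ A or A ⊗ A ⊗ A.

Associativity needs the cocycle identity and its inverse (`IsCocyclePair.inv_cocycle`). The antipode
laws need that U and Ū are mutually inverse. For the involution one needs V̄ * V = ε and
γ̄(S⁻¹(b₍₁₎) ⊗ S⁻¹(a₍₁₎)) V̄(a₍₂₎b₍₂₎) = V̄(a₍₁₎) V̄(b₍₁₎) γ(a₍₂₎ ⊗ b₍₂₎), where unitarity and ∗S =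
S⁻¹∗ identify the first factor with the conjugate of γ(b∗ ⊗ a∗).

The source of these identities is the inverse cocycle identity. At S(a₍₁₎) ⊗ a₍₂₎ ⊗ b it gives
γ̄(S(a₍₁₎) ⊗ a₍₂₎b) = Ū(a₍₁₎) γ(a₍₂₎ ⊗ b), hence Ū * U = ε; at S(b₍₁₎) ⊗ S(a₍₁₎) ⊗ a₍₂₎b₍₂₎ it gives
the multiplicativity law of Ū (`inv_comp_antiSwap_conv`). The versions for S⁻¹, and U * Ū = ε,
follow by passing to the opposite product, whose antipode is S⁻¹ and whose cocycle is γ composed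
with the swap.

For forms, the subspaces Ω^k and Ω^(p,q) are subcomodules, hence stable under all operators, and d
is colinear, hence commutes with them; ∂ and ∂̄ depend only on d and the bigrading. Generation by B
and dB needs a separate argument, `exists_subalgebra_le`. -/

open scoped TensorProduct ComplexConjugate

noncomputable section

namespace CocycleTwist

/-! ### Functionals acting on comodules and coalgebras -/

section Actions

variable {C D E M N P : Type*}
  [AddCommGroup C] [Module ℂ C] [AddCommGroup D] [Module ℂ D]
  [AddCommGroup M] [Module ℂ M] [AddCommGroup N] [Module ℂ N] [AddCommGroup P] [Module ℂ P]

/-- Linear maps which agree on pure tensors agree. -/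
theorem eq_of_tmul {f g : C ⊗[ℂ] D →ₗ[ℂ] M} (h : ∀ c d, f (c ⊗ₜ d) = g (c ⊗ₜ d))
    (t : C ⊗[ℂ] D) : f t = g t :=
  LinearMap.congr_fun (TensorProduct.ext' h) t

@[simp] theorem evalLeft_tmul (φ : C →ₗ[ℂ] ℂ) (c : C) (x : M) :
    evalLeft φ (c ⊗ₜ[ℂ] x) = φ c • x := by simp [evalLeft]

@[simp] theorem evalRight_tmul (φ : C →ₗ[ℂ] ℂ) (c : C) (x : M) :
    evalRight φ (x ⊗ₜ[ℂ] c) = φ c • x := by simp [evalRight]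

/-- The operator `x ↦ φ(x₍₋₁₎) x₍₀₎`. -/
def lact (δ : M →ₗ[ℂ] C ⊗[ℂ] M) (φ : C →ₗ[ℂ] ℂ) : M →ₗ[ℂ] M := evalLeft φ ∘ₗ δ

/-- The functional `φ ⊗ ψ` on a tensor product. -/
def tfun (φ : C →ₗ[ℂ] ℂ) (ψ : D →ₗ[ℂ] ℂ) : C ⊗[ℂ] D →ₗ[ℂ] ℂ :=
  LinearMap.mul' ℂ ℂ ∘ₗ TensorProduct.map φ ψ

@[simp] theorem tfun_tmul (φ : C →ₗ[ℂ] ℂ) (ψ : D →ₗ[ℂ] ℂ) (c : C) (d : D) :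
    tfun φ ψ (c ⊗ₜ d) = φ c * ψ d := by simp [tfun]

/-- The diagonal coaction of a tensor product of two coalgebras. -/
def tcoact (δ : M →ₗ[ℂ] C ⊗[ℂ] M) (δ' : N →ₗ[ℂ] D ⊗[ℂ] N) :
    M ⊗[ℂ] N →ₗ[ℂ] (C ⊗[ℂ] D) ⊗[ℂ] (M ⊗[ℂ] N) :=
  (TensorProduct.tensorTensorTensorComm ℂ C M D N).toLinearMap ∘ₗ TensorProduct.map δ δ'

theorem tcoact_tmul (δ : M →ₗ[ℂ] C ⊗[ℂ] M) (δ' : N →ₗ[ℂ] D ⊗[ℂ] N) (x : M) (y : N) :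
    tcoact δ δ' (x ⊗ₜ y) =
      TensorProduct.tensorTensorTensorComm ℂ C M D N (δ x ⊗ₜ δ' y) := rfl

theorem evalLeft_tfun_tensorComm (φ : C →ₗ[ℂ] ℂ) (ψ : D →ₗ[ℂ] ℂ) (s : C ⊗[ℂ] M)
    (t : D ⊗[ℂ] N) :
    evalLeft (tfun φ ψ) (TensorProduct.tensorTensorTensorComm ℂ C M D N (s ⊗ₜ t)) =
      evalLeft φ s ⊗ₜ evalLeft ψ t := by
  induction s with
  | zero => simp
  | add s s' hs hs' => simp only [TensorProduct.add_tmul, map_add, hs, hs']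
  | tmul c x =>
    induction t with
    | zero => simp
    | add t t' ht ht' => simp only [TensorProduct.tmul_add, map_add, ht, ht']
    | tmul d y => simp [← TensorProduct.smul_tmul', smul_smul, mul_comm]

theorem evalRight_tfun_tensorComm (φ : C →ₗ[ℂ] ℂ) (ψ : D →ₗ[ℂ] ℂ) (s : M ⊗[ℂ] C)
    (t : N ⊗[ℂ] D) :
    evalRight (tfun φ ψ) (TensorProduct.tensorTensorTensorComm ℂ M C N D (s ⊗ₜ t)) =
      evalRight φ s ⊗ₜ evalRight ψ t := by
  induction s with
  | zero => simp
  | add s s' hs hs' => simp only [TensorProduct.add_tmul, map_add, hs, hs']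
  | tmul c x =>
    induction t with
    | zero => simp
    | add t t' ht ht' => simp only [TensorProduct.tmul_add, map_add, ht, ht']
    | tmul d y => simp [← TensorProduct.smul_tmul', smul_smul, mul_comm]

/-- With a counit as one of the functionals this describes an operator acting on only some of the
tensor factors. -/
theorem lact_tcoact_tfun (δ : M →ₗ[ℂ] C ⊗[ℂ] M) (δ' : N →ₗ[ℂ] D ⊗[ℂ] N)
    (φ : C →ₗ[ℂ] ℂ) (ψ : D →ₗ[ℂ] ℂ) :
    lact (tcoact δ δ') (tfun φ ψ) = TensorProduct.map (lact δ φ) (lact δ' ψ) :=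
  TensorProduct.ext' fun x y => evalLeft_tfun_tensorComm φ ψ (δ x) (δ' y)

/-- Operators of functionals are natural. -/
theorem lact_comp_of_equivariant {δ : M →ₗ[ℂ] C ⊗[ℂ] M} {δ' : N →ₗ[ℂ] D ⊗[ℂ] N}
    {g : C →ₗ[ℂ] D} {f : M →ₗ[ℂ] N} (h : δ' ∘ₗ f = TensorProduct.map g f ∘ₗ δ)
    (φ : D →ₗ[ℂ] ℂ) : lact δ' φ ∘ₗ f = f ∘ₗ lact δ (φ ∘ₗ g) := by
  have h1 : evalLeft φ ∘ₗ TensorProduct.map g f = f ∘ₗ evalLeft (φ ∘ₗ g) :=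
    TensorProduct.ext' fun c x => by simp
  rw [lact, LinearMap.comp_assoc, h, ← LinearMap.comp_assoc, h1]; rfl

variable [Coalgebra ℂ C] [Coalgebra ℂ D]

/-- The operator `c ↦ c₍₁₎ φ(c₍₂₎)`. -/
def ract (φ : C →ₗ[ℂ] ℂ) : C →ₗ[ℂ] C := evalRight φ ∘ₗ Coalgebra.comul

/-- The operator `c ↦ φ(c₍₁₎) c₍₂₎`. -/
abbrev clact (φ : C →ₗ[ℂ] ℂ) : C →ₗ[ℂ] C := lact Coalgebra.comul φ

theorem sandwich_eq (φ ψ : C →ₗ[ℂ] ℂ) : sandwich φ ψ = ract ψ ∘ₗ clact φ := rfl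

/-- Definitional, so every result on `tcoact` applies to a tensor product of coalgebras coacting on
itself. -/
theorem comul_tensor :
    Coalgebra.comul (R := ℂ) (A := C ⊗[ℂ] D) = tcoact Coalgebra.comul Coalgebra.comul := rfl

theorem counit_tensor :
    Coalgebra.counit (R := ℂ) (A := C ⊗[ℂ] D) = tfun Coalgebra.counit Coalgebra.counit :=
  TensorProduct.ext' fun x y => by simp [mul_comm]

theorem conv_apply (φ ψ : C →ₗ[ℂ] ℂ) (c : C) :
    conv φ ψ c = tfun φ ψ (Coalgebra.comul c) := rfl

/-- Together with `conv_eq_ract` this trades convolution for operators: one functional moves the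
argument and the other evaluates the result. -/
theorem conv_eq_clact (φ ψ : C →ₗ[ℂ] ℂ) : conv φ ψ = ψ ∘ₗ clact φ :=
  LinearMap.ext fun c => eq_of_tmul (f := tfun φ ψ) (g := ψ ∘ₗ evalLeft φ)
    (fun a b => by simp) _

theorem conv_eq_ract (φ ψ : C →ₗ[ℂ] ℂ) : conv φ ψ = φ ∘ₗ ract ψ :=
  LinearMap.ext fun c => eq_of_tmul (f := tfun φ ψ) (g := φ ∘ₗ evalRight ψ)
    (fun a b => by simp [mul_comm]) _

theorem conv_assoc (φ ψ χ : C →ₗ[ℂ] ℂ) : conv (conv φ ψ) χ = conv φ (conv ψ χ) :=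
  WithConv.toConv_injective (mul_assoc _ _ _)

@[simp] theorem counit_conv (φ : C →ₗ[ℂ] ℂ) : conv Coalgebra.counit φ = φ :=
  WithConv.toConv_injective (one_mul _)

@[simp] theorem conv_counit (φ : C →ₗ[ℂ] ℂ) : conv φ Coalgebra.counit = φ :=
  WithConv.toConv_injective (mul_one _)

theorem conv_tfun (φ φ' : C →ₗ[ℂ] ℂ) (ψ ψ' : D →ₗ[ℂ] ℂ) :
    conv (tfun φ ψ) (tfun φ' ψ') = tfun (conv φ φ') (conv ψ ψ') := by
  rw [conv_eq_clact, clact, comul_tensor, lact_tcoact_tfun]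
  refine TensorProduct.ext' fun x y => ?_
  simp [conv_eq_clact]

theorem conv_comp_of_equivariant {g : C →ₗ[ℂ] D}
    (h : Coalgebra.comul ∘ₗ g = TensorProduct.map g g ∘ₗ Coalgebra.comul)
    (φ ψ : D →ₗ[ℂ] ℂ) : conv φ ψ ∘ₗ g = conv (φ ∘ₗ g) (ψ ∘ₗ g) := by
  rw [conv_eq_clact, conv_eq_clact, LinearMap.comp_assoc, lact_comp_of_equivariant h,
    LinearMap.comp_assoc]

theorem ract_comp_of_equivariant {g : C →ₗ[ℂ] D}
    (h : Coalgebra.comul ∘ₗ g = TensorProduct.map g g ∘ₗ Coalgebra.comul)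
    (φ : D →ₗ[ℂ] ℂ) : ract φ ∘ₗ g = g ∘ₗ ract (φ ∘ₗ g) := by
  have h1 : evalRight φ ∘ₗ TensorProduct.map g g = g ∘ₗ evalRight (φ ∘ₗ g) :=
    TensorProduct.ext' fun c x => by simp
  rw [ract, LinearMap.comp_assoc, h, ← LinearMap.comp_assoc, h1]; rfl

theorem ract_tfun (φ : C →ₗ[ℂ] ℂ) (ψ : D →ₗ[ℂ] ℂ) :
    ract (tfun φ ψ) = TensorProduct.map (ract φ) (ract ψ) :=
  TensorProduct.ext' fun x y =>
    evalRight_tfun_tensorComm φ ψ (Coalgebra.comul x) (Coalgebra.comul y)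

theorem isCoaction_comul : IsCoaction (Coalgebra.comul (R := ℂ) (A := C)) where
  coassoc x := Coalgebra.coassoc_apply x
  counit x := by simp

namespace IsCoaction

variable {δ : M →ₗ[ℂ] C ⊗[ℂ] M} {δ' : N →ₗ[ℂ] D ⊗[ℂ] N}

/-- Applying a functional in the first tensor factor of `(Δ ⊗ 1) δ = (1 ⊗ δ) δ`. -/
theorem comp_lact (hδ : IsCoaction δ) (φ : C →ₗ[ℂ] ℂ) :
    δ ∘ₗ lact δ φ = (clact φ).rTensor M ∘ₗ δ := by
  refine LinearMap.ext fun x => ?_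
  have h := congrArg (evalLeft φ) (hδ.coassoc x)
  have h1 : ∀ t : C ⊗[ℂ] M, evalLeft φ (δ.lTensor C t) = δ (evalLeft φ t) :=
    eq_of_tmul (f := evalLeft φ ∘ₗ δ.lTensor C) (g := δ ∘ₗ evalLeft φ) fun c y => by simp
  have h2 : ∀ (c : C ⊗[ℂ] C) (y : M), evalLeft φ (TensorProduct.assoc ℂ C C M (c ⊗ₜ y)) =
      evalLeft φ c ⊗ₜ[ℂ] y := fun c y =>
    eq_of_tmul (f := evalLeft φ ∘ₗ (TensorProduct.assoc ℂ C C M).toLinearMap ∘ₗ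
      (TensorProduct.mk ℂ _ M).flip y) (g := (TensorProduct.mk ℂ C M).flip y ∘ₗ evalLeft φ)
      (fun a b => by simp [TensorProduct.smul_tmul']) c
  rw [h1] at h
  rw [LinearMap.comp_apply, LinearMap.comp_apply, lact, LinearMap.comp_apply, ← h]
  exact eq_of_tmul (f := evalLeft φ ∘ₗ (TensorProduct.assoc ℂ C C M).toLinearMap ∘ₗ
    (Coalgebra.comul (R := ℂ) (A := C)).rTensor M) (g := (clact φ).rTensor M)
    (fun c y => by simp [h2, lact]) _

/-- Applying a functional in the middle of `(Δ ⊗ 1) δ = (1 ⊗ δ) δ`. -/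
theorem rTensor_ract (hδ : IsCoaction δ) (φ : C →ₗ[ℂ] ℂ) :
    (ract φ).rTensor M ∘ₗ δ = (lact δ φ).lTensor C ∘ₗ δ := by
  refine LinearMap.ext fun x => ?_
  have h := congrArg ((evalLeft φ).lTensor C) (hδ.coassoc x)
  have h2 : ∀ (c : C ⊗[ℂ] C) (y : M), (evalLeft φ).lTensor C
      (TensorProduct.assoc ℂ C C M (c ⊗ₜ y)) = evalRight φ c ⊗ₜ[ℂ] y := fun c y =>
    eq_of_tmul (f := (evalLeft φ).lTensor C ∘ₗ (TensorProduct.assoc ℂ C C M).toLinearMap ∘ₗ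
      (TensorProduct.mk ℂ _ M).flip y) (g := (TensorProduct.mk ℂ C M).flip y ∘ₗ evalRight φ)
      (fun a b => by simp) c
  rw [← LinearMap.lTensor_comp_apply] at h
  refine Eq.trans ?_ h
  exact eq_of_tmul (f := (ract φ).rTensor M) (g := (evalLeft φ).lTensor C ∘ₗ
    (TensorProduct.assoc ℂ C C M).toLinearMap ∘ₗ (Coalgebra.comul (R := ℂ) (A := C)).rTensor M)
    (fun c y => by simp [h2, ract]) _

/-- The order reverses because the operator applied first reads the leftmost leg of the iterated
coaction. -/
theorem lact_lact (hδ : IsCoaction δ) (φ ψ : C →ₗ[ℂ] ℂ) :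
    lact δ φ ∘ₗ lact δ ψ = lact δ (conv ψ φ) := by
  rw [lact, LinearMap.comp_assoc, hδ.comp_lact, ← LinearMap.comp_assoc, lact]
  congr 1
  exact TensorProduct.ext' fun c x => by simp [conv_eq_clact]

theorem lact_counit (hδ : IsCoaction δ) : lact δ Coalgebra.counit = LinearMap.id :=
  LinearMap.ext fun x => hδ.counit x

theorem tcoact (hδ : IsCoaction δ) (hδ' : IsCoaction δ') : IsCoaction (tcoact δ δ') where
  coassoc z := by
    -- `F` interleaves the two iterated coactions, so that the coassociativity laws of both factors
    -- can be used at once.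
    let F : (C ⊗[ℂ] (C ⊗[ℂ] M)) ⊗[ℂ] (D ⊗[ℂ] (D ⊗[ℂ] N)) →ₗ[ℂ]
        (C ⊗[ℂ] D) ⊗[ℂ] ((C ⊗[ℂ] D) ⊗[ℂ] (M ⊗[ℂ] N)) :=
      (TensorProduct.tensorTensorTensorComm ℂ C M D N).toLinearMap.lTensor (C ⊗[ℂ] D) ∘ₗ
      (TensorProduct.tensorTensorTensorComm ℂ C (C ⊗[ℂ] M) D (D ⊗[ℂ] N)).toLinearMap
    induction z with
    | zero => simp
    | add z z' hz hz' => simp only [map_add, hz, hz']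
    | tmul x y =>
      have h : F ((TensorProduct.assoc ℂ C C M ((Coalgebra.comul (R := ℂ)).rTensor M (δ x))) ⊗ₜ
          (TensorProduct.assoc ℂ D D N ((Coalgebra.comul (R := ℂ)).rTensor N (δ' y)))) =
          F (δ.lTensor C (δ x) ⊗ₜ δ'.lTensor D (δ' y)) := by
        rw [hδ.coassoc, hδ'.coassoc]
      refine Eq.trans ?_ (h.trans ?_) <;> rw [tcoact_tmul]
      · generalize δ x = s
        generalize δ' y = t
        induction s with
        | zero => simp
        | add s s' hs hs' => simp only [TensorProduct.add_tmul, map_add, hs, hs']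
        | tmul c x =>
          induction t with
          | zero => simp
          | add t t' ht ht' => simp only [TensorProduct.tmul_add, map_add, ht, ht']
          | tmul d y =>
            simp only [TensorProduct.tensorTensorTensorComm_tmul, LinearMap.rTensor_tmul,
              TensorProduct.comul_tmul]
            generalize Coalgebra.comul (R := ℂ) c = s
            generalize Coalgebra.comul (R := ℂ) d = t
            induction s with
            | zero => simp
            | add s s' hs hs' => simp only [TensorProduct.add_tmul, map_add, hs, hs']
            | tmul c' c'' =>
              induction t with
              | zero => simp
              | add t t' ht ht' =>
                simp only [TensorProduct.tmul_add, TensorProduct.add_tmul, map_add, ht, ht']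
              | tmul d' d'' => simp [F]
      · generalize δ x = s
        generalize δ' y = t
        induction s with
        | zero => simp
        | add s s' hs hs' => simp only [TensorProduct.add_tmul, map_add, hs, hs']
        | tmul c x =>
          induction t with
          | zero => simp
          | add t t' ht ht' => simp only [TensorProduct.tmul_add, map_add, ht, ht']
          | tmul d y => simp [F, tcoact_tmul]
  counit z := by
    change lact (CocycleTwist.tcoact δ δ') Coalgebra.counit z = z
    rw [counit_tensor, lact_tcoact_tfun, hδ.lact_counit, hδ'.lact_counit,
      TensorProduct.map_id]
    rfl

end IsCoaction

theorem clact_clact (φ ψ : C →ₗ[ℂ] ℂ) : clact φ ∘ₗ clact ψ = clact (conv ψ φ) :=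
  isCoaction_comul.lact_lact φ ψ

theorem clact_counit : clact (Coalgebra.counit (R := ℂ) (A := C)) = LinearMap.id :=
  isCoaction_comul.lact_counit

theorem comul_comp_clact (φ : C →ₗ[ℂ] ℂ) :
    Coalgebra.comul ∘ₗ clact φ = (clact φ).rTensor C ∘ₗ Coalgebra.comul :=
  isCoaction_comul.comp_lact φ

theorem rTensor_ract_comul (φ : C →ₗ[ℂ] ℂ) :
    (ract φ).rTensor C ∘ₗ Coalgebra.comul = (clact φ).lTensor C ∘ₗ Coalgebra.comul :=
  isCoaction_comul.rTensor_ract φ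

theorem comul_comp_ract (φ : C →ₗ[ℂ] ℂ) :
    Coalgebra.comul ∘ₗ ract φ = (ract φ).lTensor C ∘ₗ Coalgebra.comul := by
  refine LinearMap.ext fun x => ?_
  have h := congrArg ((TensorProduct.rid ℂ _) ∘ φ.lTensor (C ⊗[ℂ] C))
    (Coalgebra.coassoc_symm_apply (R := ℂ) x)
  refine Eq.trans ?_ (h.symm.trans ?_)
  · exact eq_of_tmul (f := Coalgebra.comul ∘ₗ evalRight φ) (g :=
      (TensorProduct.rid ℂ _).toLinearMap ∘ₗ φ.lTensor (C ⊗[ℂ] C) ∘ₗ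
      (Coalgebra.comul (R := ℂ) (A := C)).rTensor C) (fun c y => by simp) _
  · refine eq_of_tmul (g := (ract φ).lTensor C) (f :=
      (TensorProduct.rid ℂ _).toLinearMap ∘ₗ φ.lTensor (C ⊗[ℂ] C) ∘ₗ
      (TensorProduct.assoc ℂ C C C).symm.toLinearMap ∘ₗ
      (Coalgebra.comul (R := ℂ) (A := C)).lTensor C) (fun c y => ?_) _
    simp only [LinearMap.comp_apply, LinearMap.lTensor_tmul, ract]
    exact eq_of_tmul (f := (TensorProduct.rid ℂ _).toLinearMap ∘ₗ φ.lTensor (C ⊗[ℂ] C) ∘ₗ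
      (TensorProduct.assoc ℂ C C C).symm.toLinearMap ∘ₗ TensorProduct.mk ℂ C _ c)
      (g := TensorProduct.mk ℂ C C c ∘ₗ evalRight φ) (fun a b => by simp) _

theorem ract_ract (φ ψ : C →ₗ[ℂ] ℂ) : ract φ ∘ₗ ract ψ = ract (conv φ ψ) := by
  rw [ract, LinearMap.comp_assoc, comul_comp_ract, ← LinearMap.comp_assoc, ract]
  congr 1
  exact TensorProduct.ext' fun c x => by simp [conv_eq_ract, ract]

theorem ract_counit : ract (Coalgebra.counit (R := ℂ) (A := C)) = LinearMap.id :=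
  LinearMap.ext fun x => by simp [ract, evalRight]

/-- The two operators read opposite ends of the iterated coproduct. -/
theorem clact_comp_ract (φ ψ : C →ₗ[ℂ] ℂ) : clact φ ∘ₗ ract ψ = ract ψ ∘ₗ clact φ := by
  rw [clact, lact, LinearMap.comp_assoc, comul_comp_ract, ← LinearMap.comp_assoc,
    ← LinearMap.comp_assoc]
  congr 1
  exact TensorProduct.ext' fun c x => by simp

end Actions

/-! ### The antipode reverses the coproduct -/

section HopfAntipode

variable {A : Type*} [Ring A] [HopfAlgebra ℂ A]
open HopfAlgebra Coalgebra

/-- The map `a ⊗ t ↦ (S(a) ⊗ 1) t`. -/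
def antipodeTmulOneMul : A ⊗[ℂ] (A ⊗[ℂ] A) →ₗ[ℂ] A ⊗[ℂ] A :=
  LinearMap.mul' ℂ (A ⊗[ℂ] A) ∘ₗ TensorProduct.map
    ((TensorProduct.mk ℂ A A).flip 1 ∘ₗ antipode ℂ) LinearMap.id

@[simp] theorem antipodeTmulOneMul_tmul (a : A) (t : A ⊗[ℂ] A) :
    antipodeTmulOneMul (a ⊗ₜ t) = (antipode ℂ a ⊗ₜ 1) * t := rfl

/-- The map `a ⊗ t ↦ (1 ⊗ S(a)) t`. -/
def oneTmulAntipodeMul : A ⊗[ℂ] (A ⊗[ℂ] A) →ₗ[ℂ] A ⊗[ℂ] A :=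
  LinearMap.mul' ℂ (A ⊗[ℂ] A) ∘ₗ TensorProduct.map
    (TensorProduct.mk ℂ A A 1 ∘ₗ antipode ℂ) LinearMap.id

@[simp] theorem oneTmulAntipodeMul_tmul (a : A) (t : A ⊗[ℂ] A) :
    oneTmulAntipodeMul (a ⊗ₜ t) = (1 ⊗ₜ antipode ℂ a) * t := rfl

/-- By coassociativity the left side is S(y₍₁₎)y₍₂₎ ⊗ y₍₃₎, where the antipode law applies to the
first factor. -/
theorem antipodeTmulOneMul_lTensor_comul (y : A) :
    antipodeTmulOneMul (comul.lTensor A (comul (R := ℂ) y)) = 1 ⊗ₜ y := by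
  have h2 : ∀ t : A ⊗[ℂ] A, antipodeTmulOneMul
      (TensorProduct.assoc ℂ A A A ((comul (R := ℂ)).rTensor A t)) =
      ((LinearMap.mul' ℂ A ∘ₗ (antipode ℂ).rTensor A ∘ₗ comul).rTensor A) t := by
    refine eq_of_tmul (f := antipodeTmulOneMul ∘ₗ
      (TensorProduct.assoc ℂ A A A).toLinearMap ∘ₗ (comul (R := ℂ)).rTensor A) fun c d => ?_
    exact eq_of_tmul (f := antipodeTmulOneMul ∘ₗ
      (TensorProduct.assoc ℂ A A A).toLinearMap ∘ₗ (TensorProduct.mk ℂ _ _).flip d)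
      (g := (TensorProduct.mk ℂ _ _).flip d ∘ₗ LinearMap.mul' ℂ A ∘ₗ (antipode ℂ).rTensor A)
      (fun a b => by simp) _
  rw [← coassoc_apply, h2, mul_antipode_rTensor_comul, LinearMap.rTensor_comp_apply,
    rTensor_counit_comul]
  simp

/-- The antipode reverses the coproduct. -/
theorem map_antipode_comm_comul (a : A) : TensorProduct.map (antipode ℂ) (antipode ℂ)
    (TensorProduct.comm ℂ A A (comul a)) = comul (R := ℂ) (antipode ℂ a) := by
  let F : A ⊗[ℂ] (A ⊗[ℂ] A) →ₗ[ℂ] A ⊗[ℂ] A :=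
    oneTmulAntipodeMul ∘ₗ (antipodeTmulOneMul ∘ₗ comul.lTensor A).lTensor A
  have hF : ∀ a b c : A, F (a ⊗ₜ (b ⊗ₜ c)) =
      (1 ⊗ₜ antipode ℂ a) * ((antipode ℂ b ⊗ₜ 1) * comul c) := fun _ _ _ => rfl
  -- For convolution of maps A → A ⊗ A, Δ ∘ S is a right inverse of Δ. It therefore suffices that S
  -- ⊗ S after the flipped coproduct is a left inverse; both products are expressed through `F` and
  -- collapse from the inside.
  have key : WithConv.toConv (TensorProduct.map (antipode ℂ) (antipode ℂ) ∘ₗ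
      (TensorProduct.comm ℂ A A).toLinearMap ∘ₗ comul) *
      WithConv.toConv (comul (R := ℂ) (A := A)) = 1 := by
    refine WithConv.ext (LinearMap.ext fun a => ?_)
    refine Eq.trans ?_ ((congrArg F (coassoc_apply (R := ℂ) a)).trans ?_)
    · refine eq_of_tmul (f := LinearMap.mul' ℂ (A ⊗[ℂ] A) ∘ₗ TensorProduct.map
        (TensorProduct.map (antipode ℂ) (antipode ℂ) ∘ₗ
          (TensorProduct.comm ℂ A A).toLinearMap ∘ₗ comul) comul)
        (g := F ∘ₗ (TensorProduct.assoc ℂ A A A).toLinearMap ∘ₗ (comul (R := ℂ)).rTensor A)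
        (fun u w => ?_) _
      simp only [LinearMap.comp_apply, LinearMap.rTensor_tmul, TensorProduct.map_tmul]
      generalize comul (R := ℂ) u = t
      refine eq_of_tmul (f := LinearMap.mul' ℂ (A ⊗[ℂ] A) ∘ₗ
        (TensorProduct.mk ℂ _ _).flip (comul w) ∘ₗ
        TensorProduct.map (antipode ℂ) (antipode ℂ) ∘ₗ (TensorProduct.comm ℂ A A).toLinearMap)
        (g := F ∘ₗ (TensorProduct.assoc ℂ A A A).toLinearMap ∘ₗ
          (TensorProduct.mk ℂ _ _).flip w) (fun a b => ?_) t
      simp [hF, ← mul_assoc]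
    · have h3 : ∀ t : A ⊗[ℂ] A, F (comul.lTensor A t) =
          TensorProduct.mk ℂ A A 1 (LinearMap.mul' ℂ A ((antipode ℂ).rTensor A t)) := by
        refine eq_of_tmul (f := F ∘ₗ comul.lTensor A) (g := TensorProduct.mk ℂ A A 1 ∘ₗ
          (LinearMap.mul' ℂ A ∘ₗ (antipode ℂ).rTensor A)) fun u v => ?_
        simp only [F, LinearMap.comp_apply, LinearMap.lTensor_tmul,
          antipodeTmulOneMul_lTensor_comul]
        simp
      rw [h3, mul_antipode_rTensor_comul_apply]
      change _ = algebraMap ℂ (A ⊗[ℂ] A) (counit a)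
      simp [Algebra.algebraMap_eq_smul_one, Algebra.TensorProduct.one_def]
  have := left_inv_eq_right_inv key LinearMap.comul_right_inv
  exact LinearMap.congr_fun (WithConv.toConv_injective this) a

end HopfAntipode

/-! ### Equivariance of the structural maps of tensor products -/

section Equivariance

variable {C C' D D' E M M' N N' P : Type*}
  [AddCommGroup C] [Module ℂ C] [AddCommGroup D] [Module ℂ D] [AddCommGroup E] [Module ℂ E]
  [AddCommGroup C'] [Module ℂ C'] [AddCommGroup D'] [Module ℂ D']
  [AddCommGroup M] [Module ℂ M] [AddCommGroup N] [Module ℂ N] [AddCommGroup P] [Module ℂ P]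
  [AddCommGroup M'] [Module ℂ M'] [AddCommGroup N'] [Module ℂ N']

/-- The swap is equivariant. -/
theorem tcoact_comp_comm (δ : M →ₗ[ℂ] C ⊗[ℂ] M) (δ' : N →ₗ[ℂ] D ⊗[ℂ] N) :
    tcoact δ' δ ∘ₗ (TensorProduct.comm ℂ M N).toLinearMap =
      TensorProduct.map (TensorProduct.comm ℂ C D).toLinearMap
        (TensorProduct.comm ℂ M N).toLinearMap ∘ₗ tcoact δ δ' := by
  refine TensorProduct.ext' fun x y => ?_
  simp only [LinearMap.comp_apply, LinearEquiv.coe_coe, TensorProduct.comm_tmul, tcoact_tmul]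
  refine eq_of_tmul (f := (TensorProduct.tensorTensorTensorComm ℂ D N C M).toLinearMap ∘ₗ
    (TensorProduct.mk ℂ _ _).flip (δ x)) (g := TensorProduct.map
      (TensorProduct.comm ℂ C D).toLinearMap (TensorProduct.comm ℂ M N).toLinearMap ∘ₗ
      (TensorProduct.tensorTensorTensorComm ℂ C M D N).toLinearMap ∘ₗ
        TensorProduct.mk ℂ _ _ (δ x)) (fun d y => ?_) (δ' y)
  exact eq_of_tmul (f := (TensorProduct.tensorTensorTensorComm ℂ D N C M).toLinearMap ∘ₗ
    TensorProduct.mk ℂ _ _ (d ⊗ₜ y)) (g := TensorProduct.map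
      (TensorProduct.comm ℂ C D).toLinearMap (TensorProduct.comm ℂ M N).toLinearMap ∘ₗ
      (TensorProduct.tensorTensorTensorComm ℂ C M D N).toLinearMap ∘ₗ
        (TensorProduct.mk ℂ _ _).flip (d ⊗ₜ y)) (fun c x => by simp) (δ x)

/-- The associator is equivariant. -/
theorem tcoact_comp_assoc (δ : M →ₗ[ℂ] C ⊗[ℂ] M) (δ' : N →ₗ[ℂ] D ⊗[ℂ] N)
    (δ'' : P →ₗ[ℂ] E ⊗[ℂ] P) :
    tcoact δ (tcoact δ' δ'') ∘ₗ (TensorProduct.assoc ℂ M N P).toLinearMap =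
      TensorProduct.map (TensorProduct.assoc ℂ C D E).toLinearMap
        (TensorProduct.assoc ℂ M N P).toLinearMap ∘ₗ tcoact (tcoact δ δ') δ'' := by
  refine TensorProduct.ext_threefold fun x y z => ?_
  simp only [LinearMap.comp_apply, LinearEquiv.coe_coe, TensorProduct.assoc_tmul, tcoact_tmul]
  generalize δ x = s
  generalize δ' y = t
  generalize δ'' z = u
  induction s with
  | zero => simp
  | add s s' hs hs' => simp only [TensorProduct.add_tmul, map_add, hs, hs']
  | tmul c x =>
    induction t with
    | zero => simp
    | add t t' ht ht' =>
      simp only [TensorProduct.add_tmul, TensorProduct.tmul_add, map_add, ht, ht']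
    | tmul d y =>
      induction u with
      | zero => simp
      | add u u' hu hu' => simp only [TensorProduct.tmul_add, map_add, hu, hu']
      | tmul e z => simp

/-- Tensor products of equivariant maps are equivariant. -/
theorem tcoact_comp_map {δ : M →ₗ[ℂ] C ⊗[ℂ] M} {δ' : N →ₗ[ℂ] D ⊗[ℂ] N}
    {δ₁ : M' →ₗ[ℂ] C' ⊗[ℂ] M'} {δ₁' : N' →ₗ[ℂ] D' ⊗[ℂ] N'}
    {g : C →ₗ[ℂ] C'} {g' : D →ₗ[ℂ] D'} {f : M →ₗ[ℂ] M'} {f' : N →ₗ[ℂ] N'}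
    (h : δ₁ ∘ₗ f = TensorProduct.map g f ∘ₗ δ) (h' : δ₁' ∘ₗ f' = TensorProduct.map g' f' ∘ₗ δ') :
    tcoact δ₁ δ₁' ∘ₗ TensorProduct.map f f' =
      TensorProduct.map (TensorProduct.map g g') (TensorProduct.map f f') ∘ₗ tcoact δ δ' := by
  rw [tcoact, LinearMap.comp_assoc, ← TensorProduct.map_comp, h, h', TensorProduct.map_comp,
    ← LinearMap.comp_assoc, tcoact, ← LinearMap.comp_assoc]
  congr 1
  exact TensorProduct.ext_fourfold' fun c x d y => by simp

theorem tcoact_comp_rTensor {δ : M →ₗ[ℂ] C ⊗[ℂ] M} (δ' : N →ₗ[ℂ] D ⊗[ℂ] N)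
    {δ₁ : M' →ₗ[ℂ] C' ⊗[ℂ] M'} {g : C →ₗ[ℂ] C'} {f : M →ₗ[ℂ] M'}
    (h : δ₁ ∘ₗ f = TensorProduct.map g f ∘ₗ δ) :
    tcoact δ₁ δ' ∘ₗ f.rTensor N =
      TensorProduct.map (g.rTensor D) (f.rTensor N) ∘ₗ tcoact δ δ' :=
  tcoact_comp_map h (by simp)

theorem tcoact_comp_lTensor {δ : M →ₗ[ℂ] C ⊗[ℂ] M} (δ' : N →ₗ[ℂ] D ⊗[ℂ] N)
    {δ₁ : M' →ₗ[ℂ] C' ⊗[ℂ] M'} {g : C →ₗ[ℂ] C'} {f : M →ₗ[ℂ] M'}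
    (h : δ₁ ∘ₗ f = TensorProduct.map g f ∘ₗ δ) :
    tcoact δ' δ₁ ∘ₗ f.lTensor N =
      TensorProduct.map (g.lTensor D) (f.lTensor N) ∘ₗ tcoact δ' δ :=
  tcoact_comp_map (by simp) h

end Equivariance

/-! ### Hopf algebra laws and the opposite Hopf algebra -/

section HopfLaws

variable {A : Type*} [AddCommGroup A] [Module ℂ A] [Coalgebra ℂ A]

/-- The laws of a Hopf algebra for a product `m`, a unit `e` and an antipode `S`, with those
consequences which say that `S` reverses products and coproducts. -/
structure IsHopf (m : A ⊗[ℂ] A →ₗ[ℂ] A) (e : A) (S : A →ₗ[ℂ] A) : Prop where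
  mul_assoc : ∀ a b c, m (m (a ⊗ₜ b) ⊗ₜ c) = m (a ⊗ₜ m (b ⊗ₜ c))
  one_mul : ∀ a, m (e ⊗ₜ a) = a
  mul_one : ∀ a, m (a ⊗ₜ e) = a
  comul_mul : Coalgebra.comul ∘ₗ m = TensorProduct.map m m ∘ₗ Coalgebra.comul
  counit_mul : Coalgebra.counit ∘ₗ m = Coalgebra.counit (R := ℂ)
  comul_one : Coalgebra.comul (R := ℂ) e = e ⊗ₜ e
  counit_one : Coalgebra.counit (R := ℂ) e = 1
  antipode_left : ∀ a, m (S.rTensor A (Coalgebra.comul a)) = Coalgebra.counit (R := ℂ) a • e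
  antipode_right : ∀ a, m (S.lTensor A (Coalgebra.comul a)) = Coalgebra.counit (R := ℂ) a • e
  antipode_one : S e = e
  antipode_mul : ∀ a b, S (m (a ⊗ₜ b)) = m (S b ⊗ₜ S a)
  comul_antipode : Coalgebra.comul ∘ₗ S =
    TensorProduct.map S S ∘ₗ (TensorProduct.comm ℂ A A).toLinearMap ∘ₗ Coalgebra.comul
  counit_antipode : Coalgebra.counit ∘ₗ S = Coalgebra.counit (R := ℂ)

theorem AlgData.mulMap_tmul {V : Type*} [AddCommGroup V] [Module ℂ V] (m : AlgData V) (a b : V) :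
    m.mulMap (a ⊗ₜ b) = m.mul a b := rfl

theorem AlgData.tensor_mul_eq {V W : Type*} [AddCommGroup V] [Module ℂ V] [AddCommGroup W]
    [Module ℂ W] (m : AlgData V) (n : AlgData W) (s t : V ⊗[ℂ] W) :
    (m.tensor n).mul s t = TensorProduct.map m.mulMap n.mulMap
      (TensorProduct.tensorTensorTensorComm ℂ V W V W (s ⊗ₜ t)) := by
  have h : TensorProduct.lift (m.tensor n).mul = TensorProduct.map m.mulMap n.mulMap ∘ₗ
      (TensorProduct.tensorTensorTensorComm ℂ V W V W).toLinearMap :=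
    TensorProduct.ext_fourfold' fun a b c d => by
      simp [AlgData.tensor, AlgData.mulMap, TensorProduct.map₂_apply_tmul]
  exact LinearMap.congr_fun h (s ⊗ₜ t)

/-- The laws of the antipode beyond its two defining ones are consequences of the axioms; they are
transported from the Hopf algebra `toHopfAlgebra`. -/
theorem HopfStarData.IsHopfStarAlgebra.isHopf {H : HopfStarData A} (h : H.IsHopfStarAlgebra) :
    IsHopf H.mulMap H.one H.antipode where
  mul_assoc := h.mul_assoc
  one_mul := h.one_mul
  mul_one := h.mul_one
  comul_mul := TensorProduct.ext' fun a b => (h.comul_mul a b).trans (AlgData.tensor_mul_eq ..)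
  counit_mul := TensorProduct.ext' fun a b => by
    rw [LinearMap.comp_apply, AlgData.mulMap_tmul, h.counit_mul, TensorProduct.counit_tmul,
      smul_eq_mul, mul_comm]
  comul_one := h.comul_one
  counit_one := h.counit_one
  antipode_left := h.antipode_left
  antipode_right := h.antipode_right
  antipode_one := @HopfAlgebra.antipode_one ℂ A _ h.toIsAlgebra.toRing.toSemiring h.toHopfAlgebra
  antipode_mul a b := @HopfAlgebra.antipode_mul_antidistrib ℂ A _
    h.toIsAlgebra.toRing.toSemiring h.toHopfAlgebra a b
  comul_antipode := LinearMap.ext fun a =>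
    (@map_antipode_comm_comul A h.toIsAlgebra.toRing h.toHopfAlgebra a).symm
  counit_antipode := LinearMap.ext fun a =>
    @HopfAlgebra.counit_antipode ℂ A _ h.toIsAlgebra.toRing.toSemiring h.toHopfAlgebra a

namespace IsHopf

variable {m : A ⊗[ℂ] A →ₗ[ℂ] A} {e : A} {S T : A →ₗ[ℂ] A}

/-- The Hopf algebra with the opposite product. -/
theorem op (h : IsHopf m e S) (hST : ∀ a, S (T a) = a) (hTS : ∀ a, T (S a) = a) :
    IsHopf (m ∘ₗ (TensorProduct.comm ℂ A A).toLinearMap) e T := by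
  -- The product laws for `T` are tested after applying the injective map `S`, which reverses
  -- products and turns each antipode law into the law for `S` on the other side.
  have inj : Function.Injective S := Function.LeftInverse.injective hTS
  have hT : (TensorProduct.map S S) ∘ₗ TensorProduct.map T T = LinearMap.id :=
    TensorProduct.ext' fun a b => by simp [hST]
  have hT' : (TensorProduct.map T T) ∘ₗ TensorProduct.map S S = LinearMap.id :=
    TensorProduct.ext' fun a b => by simp [hTS]
  refine
  { mul_assoc := fun a b c => by simp [h.mul_assoc]
    one_mul := fun a => by simp [h.mul_one]
    mul_one := fun a => by simp [h.one_mul]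
    comul_mul := ?_
    counit_mul := ?_
    comul_one := h.comul_one
    counit_one := h.counit_one
    antipode_left := fun a => inj ?_
    antipode_right := fun a => inj ?_
    antipode_one := inj (by rw [hST, h.antipode_one])
    antipode_mul := fun a b => inj ?_
    comul_antipode := ?_
    counit_antipode := ?_ }
  · rw [← LinearMap.comp_assoc, h.comul_mul, LinearMap.comp_assoc, comul_tensor,
      tcoact_comp_comm, ← LinearMap.comp_assoc, ← TensorProduct.map_comp]
  · rw [← LinearMap.comp_assoc, h.counit_mul]
    exact TensorProduct.ext' fun a b => by simp [mul_comm]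
  · rw [map_smul, h.antipode_one, ← h.antipode_right]
    exact eq_of_tmul (f := S ∘ₗ (m ∘ₗ (TensorProduct.comm ℂ A A).toLinearMap) ∘ₗ T.rTensor A)
      (g := m ∘ₗ S.lTensor A) (fun a b => by simp [h.antipode_mul, hST]) _
  · rw [map_smul, h.antipode_one, ← h.antipode_left]
    exact eq_of_tmul (f := S ∘ₗ (m ∘ₗ (TensorProduct.comm ℂ A A).toLinearMap) ∘ₗ T.lTensor A)
      (g := m ∘ₗ S.rTensor A) (fun a b => by simp [h.antipode_mul, hST]) _
  · simp [h.antipode_mul, hST]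
  · refine LinearMap.ext fun a => ?_
    have h1 := LinearMap.congr_fun h.comul_antipode (T a)
    simp only [LinearMap.comp_apply, hST] at h1
    simp only [LinearMap.comp_apply, h1]
    have h2 : ∀ t : A ⊗[ℂ] A, TensorProduct.map T T ((TensorProduct.comm ℂ A A)
        (TensorProduct.map S S ((TensorProduct.comm ℂ A A) t))) = t :=
      eq_of_tmul (f := TensorProduct.map T T ∘ₗ (TensorProduct.comm ℂ A A).toLinearMap ∘ₗ
        TensorProduct.map S S ∘ₗ (TensorProduct.comm ℂ A A).toLinearMap) (g := LinearMap.id)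
        fun a b => by simp [hTS]
    exact (h2 _).symm
  · refine LinearMap.ext fun a => ?_
    have h1 := LinearMap.congr_fun h.counit_antipode (T a)
    simpa [hST] using h1.symm

theorem conv_comp_antipode (h : IsHopf m e S) (φ ψ : A →ₗ[ℂ] ℂ) :
    conv φ ψ ∘ₗ S = conv (ψ ∘ₗ S) (φ ∘ₗ S) := by
  refine LinearMap.ext fun a => ?_
  have h1 := LinearMap.congr_fun h.comul_antipode a
  simp only [LinearMap.comp_apply, conv_apply] at h1 ⊢
  rw [h1]
  exact eq_of_tmul (f := tfun φ ψ ∘ₗ TensorProduct.map S S ∘ₗ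
    (TensorProduct.comm ℂ A A).toLinearMap) (g := tfun (ψ ∘ₗ S) (φ ∘ₗ S))
    (fun a b => by simp [mul_comm]) _

/-- The coproduct of `S(a₍₁₎) ⊗ a₍₂₎`. -/
theorem comul_antipode_rTensor_comul (h : IsHopf m e S) (a : A) :
    Coalgebra.comul (S.rTensor A (Coalgebra.comul (R := ℂ) a)) =
      TensorProduct.leftComm ℂ A (A ⊗[ℂ] A) A (TensorProduct.map S
        ((S.rTensor A ∘ₗ Coalgebra.comul).rTensor A ∘ₗ Coalgebra.comul)
          (Coalgebra.comul (R := ℂ) a)) := by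
  -- `G` sends a₍₁₎ ⊗ a₍₂₎ ⊗ a₍₃₎ ⊗ a₍₄₎ to (S(a₍₂₎) ⊗ a₍₃₎) ⊗ (S(a₍₁₎) ⊗ a₍₄₎): the pairs are
  -- nested because `S` reverses coproducts.
  let G : A ⊗[ℂ] (A ⊗[ℂ] (A ⊗[ℂ] A)) →ₗ[ℂ] (A ⊗[ℂ] A) ⊗[ℂ] (A ⊗[ℂ] A) :=
    (TensorProduct.leftComm ℂ A (A ⊗[ℂ] A) A).toLinearMap ∘ₗ TensorProduct.map S
      ((S.rTensor A).rTensor A ∘ₗ (TensorProduct.assoc ℂ A A A).symm.toLinearMap)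
  have h1 := congrArg (fun t => G (((Coalgebra.comul (R := ℂ) (A := A)).lTensor A).lTensor A t))
    (Coalgebra.coassoc_apply (R := ℂ) a)
  refine Eq.trans ?_ (h1.trans ?_)
  · refine eq_of_tmul (f := Coalgebra.comul ∘ₗ S.rTensor A) (g := G ∘ₗ
      ((Coalgebra.comul (R := ℂ) (A := A)).lTensor A).lTensor A ∘ₗ
      (TensorProduct.assoc ℂ A A A).toLinearMap ∘ₗ (Coalgebra.comul (R := ℂ)).rTensor A)
      (fun c d => ?_) _
    have h2 := LinearMap.congr_fun h.comul_antipode c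
    simp only [LinearMap.comp_apply, LinearMap.rTensor_tmul, TensorProduct.comul_tmul,
      LinearEquiv.coe_coe] at h2 ⊢
    rw [h2]
    generalize Coalgebra.comul (R := ℂ) c = s
    induction s with
    | zero => simp
    | add s s' hs hs' => simp only [TensorProduct.add_tmul, map_add, hs, hs']
    | tmul c c' =>
      simp only [TensorProduct.assoc_tmul, LinearMap.lTensor_tmul]
      generalize Coalgebra.comul (R := ℂ) d = t
      induction t with
      | zero => simp
      | add t t' ht ht' => simp only [TensorProduct.tmul_add, map_add, ht, ht']
      | tmul d d' => simp [G]
  · refine eq_of_tmul (f := G ∘ₗ ((Coalgebra.comul (R := ℂ) (A := A)).lTensor A).lTensor A ∘ₗ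
      (Coalgebra.comul (R := ℂ)).lTensor A) (g :=
      (TensorProduct.leftComm ℂ A (A ⊗[ℂ] A) A).toLinearMap ∘ₗ TensorProduct.map S
        ((S.rTensor A ∘ₗ Coalgebra.comul).rTensor A ∘ₗ Coalgebra.comul)) (fun c d => ?_) _
    simp only [LinearMap.comp_apply, LinearMap.lTensor_tmul, TensorProduct.map_tmul, G,
      Coalgebra.coassoc_symm_apply, LinearEquiv.coe_coe, LinearMap.rTensor_comp_apply]

/-- The coproduct of `a₍₁₎ ⊗ S(a₍₂₎)`. -/
theorem comul_antipode_lTensor_comul (h : IsHopf m e S) (a : A) :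
    Coalgebra.comul (S.lTensor A (Coalgebra.comul (R := ℂ) a)) =
      TensorProduct.rightComm ℂ A (A ⊗[ℂ] A) A (TensorProduct.map
        ((S.lTensor A ∘ₗ Coalgebra.comul).lTensor A ∘ₗ Coalgebra.comul) S
          (Coalgebra.comul (R := ℂ) a)) := by
  -- Here the nesting is (a₍₁₎ ⊗ S(a₍₄₎)) ⊗ (a₍₂₎ ⊗ S(a₍₃₎)), with the inner pair on the right.
  let G : ((A ⊗[ℂ] A) ⊗[ℂ] A) ⊗[ℂ] A →ₗ[ℂ] (A ⊗[ℂ] A) ⊗[ℂ] (A ⊗[ℂ] A) :=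
    (TensorProduct.rightComm ℂ A (A ⊗[ℂ] A) A).toLinearMap ∘ₗ TensorProduct.map
      ((S.lTensor A).lTensor A ∘ₗ (TensorProduct.assoc ℂ A A A).toLinearMap) S
  have h1 := congrArg (fun t => G (((Coalgebra.comul (R := ℂ) (A := A)).rTensor A).rTensor A t))
    (Coalgebra.coassoc_symm_apply (R := ℂ) a)
  refine Eq.trans ?_ (h1.trans ?_)
  · refine eq_of_tmul (f := Coalgebra.comul ∘ₗ S.lTensor A) (g := G ∘ₗ
      ((Coalgebra.comul (R := ℂ) (A := A)).rTensor A).rTensor A ∘ₗ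
      (TensorProduct.assoc ℂ A A A).symm.toLinearMap ∘ₗ (Coalgebra.comul (R := ℂ)).lTensor A)
      (fun c d => ?_) _
    have h2 := LinearMap.congr_fun h.comul_antipode d
    simp only [LinearMap.comp_apply, LinearMap.lTensor_tmul, TensorProduct.comul_tmul,
      LinearEquiv.coe_coe] at h2 ⊢
    rw [h2]
    generalize Coalgebra.comul (R := ℂ) d = s
    induction s with
    | zero => simp
    | add s s' hs hs' => simp only [TensorProduct.tmul_add, map_add, hs, hs']
    | tmul d d' =>
      simp only [TensorProduct.assoc_symm_tmul, LinearMap.rTensor_tmul]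
      generalize Coalgebra.comul (R := ℂ) c = t
      induction t with
      | zero => simp
      | add t t' ht ht' => simp only [TensorProduct.add_tmul, map_add, ht, ht']
      | tmul c c' => simp [G]
  · refine eq_of_tmul (f := G ∘ₗ ((Coalgebra.comul (R := ℂ) (A := A)).rTensor A).rTensor A ∘ₗ
      (Coalgebra.comul (R := ℂ)).rTensor A) (g :=
      (TensorProduct.rightComm ℂ A (A ⊗[ℂ] A) A).toLinearMap ∘ₗ TensorProduct.map
        ((S.lTensor A ∘ₗ Coalgebra.comul).lTensor A ∘ₗ Coalgebra.comul) S) (fun c d => ?_) _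
    simp only [LinearMap.comp_apply, LinearMap.rTensor_tmul, TensorProduct.map_tmul, G,
      Coalgebra.coassoc_apply, LinearEquiv.coe_coe, LinearMap.lTensor_comp_apply]

end IsHopf

end HopfLaws

/-! ### Functionals on a tensor product with one factor held fixed -/

section Currying

variable {C D : Type*} [AddCommGroup C] [Module ℂ C] [AddCommGroup D] [Module ℂ D]
  [Coalgebra ℂ C] [Coalgebra ℂ D]

theorem Repr.clact_eq {ι : Type*} {c : C} (r : Coalgebra.Repr ℂ c ι) (φ : C →ₗ[ℂ] ℂ) :
    clact φ c = ∑ i ∈ r.index, φ (r.left i) • r.right i := by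
  rw [clact, lact, LinearMap.comp_apply, ← r.eq, map_sum]
  simp

theorem clact_tmul_right (F : C ⊗[ℂ] D →ₗ[ℂ] ℂ) (z : C) {ι : Type*} {k : D}
    (r : Coalgebra.Repr ℂ k ι) : clact F (z ⊗ₜ k) =
      ∑ i ∈ r.index, clact (F ∘ₗ (TensorProduct.mk ℂ C D).flip (r.left i)) z ⊗ₜ r.right i := by
  rw [clact, lact, LinearMap.comp_apply, comul_tensor, tcoact_tmul, ← r.eq,
    TensorProduct.tmul_sum, map_sum, map_sum]
  refine Finset.sum_congr rfl fun i _ => ?_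
  exact eq_of_tmul (f := evalLeft F ∘ₗ
    (TensorProduct.tensorTensorTensorComm ℂ C C D D).toLinearMap ∘ₗ
      (TensorProduct.mk ℂ _ _).flip (r.left i ⊗ₜ r.right i))
    (g := (TensorProduct.mk ℂ C D).flip (r.right i) ∘ₗ
      evalLeft (F ∘ₗ (TensorProduct.mk ℂ C D).flip (r.left i)))
    (fun a b => by simp [TensorProduct.smul_tmul']) _

theorem clact_tmul_left (F : C ⊗[ℂ] D →ₗ[ℂ] ℂ) (z : D) {ι : Type*} {k : C}
    (r : Coalgebra.Repr ℂ k ι) : clact F (k ⊗ₜ z) =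
      ∑ i ∈ r.index, r.right i ⊗ₜ clact (F ∘ₗ TensorProduct.mk ℂ C D (r.left i)) z := by
  rw [clact, lact, LinearMap.comp_apply, comul_tensor, tcoact_tmul, ← r.eq,
    TensorProduct.sum_tmul, map_sum, map_sum]
  refine Finset.sum_congr rfl fun i _ => ?_
  exact eq_of_tmul (f := evalLeft F ∘ₗ
    (TensorProduct.tensorTensorTensorComm ℂ C C D D).toLinearMap ∘ₗ
      TensorProduct.mk ℂ _ _ (r.left i ⊗ₜ r.right i))
    (g := TensorProduct.mk ℂ C D (r.right i) ∘ₗ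
      evalLeft (F ∘ₗ TensorProduct.mk ℂ C D (r.left i)))
    (fun a b => by simp) _

/-- The counit absorbs the coproduct of `s`, leaving F(s ⊗ w₍₁₎) ψ(w₍₂₎). -/
theorem conv_tfun_counit_tmul (F : C ⊗[ℂ] D →ₗ[ℂ] ℂ) (ψ : D →ₗ[ℂ] ℂ) (s : C) (w : D) :
    conv F (tfun Coalgebra.counit ψ) (s ⊗ₜ w) =
      ψ (clact (F ∘ₗ TensorProduct.mk ℂ C D s) w) := by
  let r := Coalgebra.Repr.arbitrary ℂ s
  rw [conv_eq_clact, LinearMap.comp_apply, clact_tmul_left F w r, map_sum]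
  have h : s = ∑ i ∈ r.index, Coalgebra.counit (R := ℂ) (r.right i) • r.left i := by
    have := LinearMap.congr_fun (ract_counit (C := C)) s
    rw [ract, LinearMap.comp_apply, ← r.eq, map_sum] at this
    simpa using this.symm
  have h2 : evalLeft (F ∘ₗ TensorProduct.mk ℂ C D s) (Coalgebra.comul w) =
      ∑ i ∈ r.index, Coalgebra.counit (R := ℂ) (r.right i) •
        evalLeft (F ∘ₗ TensorProduct.mk ℂ C D (r.left i)) (Coalgebra.comul w) := by
    refine (eq_of_tmul (f := evalLeft (F ∘ₗ TensorProduct.mk ℂ C D s)) (g :=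
      ∑ i ∈ r.index, Coalgebra.counit (R := ℂ) (r.right i) •
        evalLeft (F ∘ₗ TensorProduct.mk ℂ C D (r.left i))) (fun a b => ?_) _).trans ?_
    · conv_lhs => rw [h]
      simp [Finset.sum_smul, mul_smul]
    · simp
  rw [clact, lact, LinearMap.comp_apply, h2, map_sum]
  simp [clact, lact]

/-- Both sides are h₍₁₎ ⊗ (h₍₂₎ ⊗ k₍₁₎) φ(h₍₃₎ ⊗ k₍₂₎); only coassociativity in the first factor is
involved. -/
theorem lTensor_ract_assoc_comul (φ : C ⊗[ℂ] D →ₗ[ℂ] ℂ) (h : C) (k : D) :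
    (ract φ).lTensor C (TensorProduct.assoc ℂ C C D (Coalgebra.comul (R := ℂ) h ⊗ₜ k)) =
      TensorProduct.assoc ℂ C C D ((Coalgebra.comul (R := ℂ)).rTensor D (ract φ (h ⊗ₜ k))) := by
  let r := Coalgebra.Repr.arbitrary ℂ k
  let G : D → D → C ⊗[ℂ] (C ⊗[ℂ] C) →ₗ[ℂ] C ⊗[ℂ] (C ⊗[ℂ] D) := fun c d =>
    ((TensorProduct.mk ℂ C D).flip c ∘ₗ
      evalRight (φ ∘ₗ (TensorProduct.mk ℂ C D).flip d)).lTensor C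
  have hG := congrArg (fun t => ∑ i ∈ r.index, G (r.left i) (r.right i) t)
    (Coalgebra.coassoc_apply (R := ℂ) h).symm
  have hr : ∀ v : C, ract φ (v ⊗ₜ k) = ∑ i ∈ r.index, (evalRight (φ ∘ₗ
      (TensorProduct.mk ℂ C D).flip (r.right i)) (Coalgebra.comul v)) ⊗ₜ r.left i := fun v => by
    rw [ract, LinearMap.comp_apply, comul_tensor, tcoact_tmul, ← r.eq,
      TensorProduct.tmul_sum, map_sum, map_sum]
    refine Finset.sum_congr rfl fun i _ => ?_
    exact eq_of_tmul (f := evalRight φ ∘ₗ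
      (TensorProduct.tensorTensorTensorComm ℂ C C D D).toLinearMap ∘ₗ
        (TensorProduct.mk ℂ _ _).flip (r.left i ⊗ₜ r.right i))
      (g := (TensorProduct.mk ℂ C D).flip (r.left i) ∘ₗ
        evalRight (φ ∘ₗ (TensorProduct.mk ℂ C D).flip (r.right i)))
      (fun a b => by simp [TensorProduct.smul_tmul']) _
  refine Eq.trans ?_ (hG.trans ?_)
  · refine (eq_of_tmul (f := (ract φ).lTensor C ∘ₗ (TensorProduct.assoc ℂ C C D).toLinearMap ∘ₗ
      (TensorProduct.mk ℂ _ D).flip k) (g := ∑ i ∈ r.index, G (r.left i) (r.right i) ∘ₗ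
        (Coalgebra.comul (R := ℂ)).lTensor C) (fun a b => ?_) _).trans (by simp)
    simp [G, hr, TensorProduct.tmul_sum]
  · rw [hr, map_sum, map_sum]
    refine Finset.sum_congr rfl fun i _ => ?_
    refine eq_of_tmul (f := G (r.left i) (r.right i) ∘ₗ
      (TensorProduct.assoc ℂ C C C).toLinearMap ∘ₗ (Coalgebra.comul (R := ℂ)).rTensor C)
      (g := (TensorProduct.assoc ℂ C C D).toLinearMap ∘ₗ (Coalgebra.comul (R := ℂ)).rTensor D ∘ₗ
        (TensorProduct.mk ℂ C D).flip (r.left i) ∘ₗ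
        evalRight (φ ∘ₗ (TensorProduct.mk ℂ C D).flip (r.right i))) (fun a b => ?_) _
    simp only [LinearMap.comp_apply, LinearMap.rTensor_tmul]
    exact (eq_of_tmul (f := G (r.left i) (r.right i) ∘ₗ
      (TensorProduct.assoc ℂ C C C).toLinearMap ∘ₗ (TensorProduct.mk ℂ _ C).flip b)
      (g := φ (b ⊗ₜ r.right i) • (TensorProduct.assoc ℂ C C D).toLinearMap ∘ₗ
        (TensorProduct.mk ℂ _ D).flip (r.left i)) (fun x y => by simp [G]) _).trans
      (by simp)

end Currying

/-! ### Operators on S(a₍₁₎) ⊗ a₍₂₎ and a₍₁₎ ⊗ S(a₍₂₎) -/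

section HopfOperators

variable {A W : Type*} [AddCommGroup A] [Module ℂ A] [Coalgebra ℂ A] [AddCommGroup W] [Module ℂ W]
  {m : A ⊗[ℂ] A →ₗ[ℂ] A} {e : A} {S : A →ₗ[ℂ] A}

/-- The map `a ↦ S(a₍₁₎) ⊗ a₍₂₎`. -/
def antiComul (S : A →ₗ[ℂ] A) : A →ₗ[ℂ] A ⊗[ℂ] A := S.rTensor A ∘ₗ Coalgebra.comul

/-- The map `a ↦ a₍₁₎ ⊗ S(a₍₂₎)`. -/
def comulAnti (S : A →ₗ[ℂ] A) : A →ₗ[ℂ] A ⊗[ℂ] A := S.lTensor A ∘ₗ Coalgebra.comul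

theorem clact_smul_counit (c : ℂ) (a : A) :
    clact (c • Coalgebra.counit (R := ℂ) (A := A)) a = c • a := by
  have h := LinearMap.congr_fun (clact_counit (C := A)) a
  have h1 : evalLeft (M := A) (c • Coalgebra.counit (R := ℂ) (A := A)) =
    c • evalLeft (Coalgebra.counit (R := ℂ) (A := A)) := TensorProduct.ext' fun a b => by
      simp [mul_smul]
  rw [clact, lact, h1, LinearMap.smul_comp, LinearMap.smul_apply]
  exact congrArg (c • ·) h

namespace IsHopf

/-- In (S(a₍₂₎) ⊗ a₍₃₎) ⊗ (S(a₍₁₎) ⊗ a₍₄₎) the functional reads the inner pair, which is again a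
value of `antiComul S`. The functional on A ⊗ A thereby becomes one on `A`. -/
theorem clact_antiComul (h : IsHopf m e S) (F : A ⊗[ℂ] A →ₗ[ℂ] ℂ) (a : A) :
    clact F (antiComul S a) = (clact (F ∘ₗ antiComul S)).lTensor A (antiComul S a) := by
  rw [antiComul, clact, lact, LinearMap.comp_apply, LinearMap.comp_apply,
    h.comul_antipode_rTensor_comul]
  refine eq_of_tmul (f := evalLeft F ∘ₗ (TensorProduct.leftComm ℂ A (A ⊗[ℂ] A) A).toLinearMap ∘ₗ
    TensorProduct.map S ((antiComul S).rTensor A ∘ₗ Coalgebra.comul))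
    (g := (clact (F ∘ₗ antiComul S)).lTensor A ∘ₗ S.rTensor A) (fun c d => ?_) _
  simp only [LinearMap.comp_apply, TensorProduct.map_tmul, LinearMap.rTensor_tmul,
    LinearMap.lTensor_tmul, clact, lact]
  exact eq_of_tmul (f := evalLeft F ∘ₗ
    (TensorProduct.leftComm ℂ A (A ⊗[ℂ] A) A).toLinearMap ∘ₗ TensorProduct.mk ℂ A _ (S c) ∘ₗ
      (antiComul S).rTensor A) (g := TensorProduct.mk ℂ A A (S c) ∘ₗ evalLeft (F ∘ₗ antiComul S))
    (fun x y => by simp) _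

theorem ract_comulAnti (h : IsHopf m e S) (F : A ⊗[ℂ] A →ₗ[ℂ] ℂ) (a : A) :
    ract F (comulAnti S a) = (ract (F ∘ₗ comulAnti S)).rTensor A (comulAnti S a) := by
  rw [comulAnti, ract, LinearMap.comp_apply, LinearMap.comp_apply,
    h.comul_antipode_lTensor_comul]
  refine eq_of_tmul (f := evalRight F ∘ₗ
    (TensorProduct.rightComm ℂ A (A ⊗[ℂ] A) A).toLinearMap ∘ₗ
    TensorProduct.map ((comulAnti S).lTensor A ∘ₗ Coalgebra.comul) S)
    (g := (ract (F ∘ₗ comulAnti S)).rTensor A ∘ₗ S.lTensor A) (fun c d => ?_) _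
  simp only [LinearMap.comp_apply, TensorProduct.map_tmul, LinearMap.rTensor_tmul,
    LinearMap.lTensor_tmul, ract]
  exact eq_of_tmul (f := evalRight F ∘ₗ
    (TensorProduct.rightComm ℂ A (A ⊗[ℂ] A) A).toLinearMap ∘ₗ (TensorProduct.mk ℂ _ A).flip (S d) ∘ₗ
      (comulAnti S).lTensor A)
    (g := (TensorProduct.mk ℂ A A).flip (S d) ∘ₗ evalRight (F ∘ₗ comulAnti S))
    (fun x y => by simp [TensorProduct.smul_tmul']) _

/-- Now `F` reads the outer pair, while `G` collapses the inner pair to a counit, so the outer legs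
become adjacent. The case of interest is `G = m`. -/
theorem apply_ract_antiComul (h : IsHopf m e S) (F : A ⊗[ℂ] A →ₗ[ℂ] ℂ) {G : A ⊗[ℂ] A →ₗ[ℂ] W}
    {w : W} (hG : ∀ a, G (antiComul S a) = Coalgebra.counit (R := ℂ) a • w) (a : A) :
    G (ract F (antiComul S a)) = F (antiComul S a) • w := by
  rw [antiComul, ract, LinearMap.comp_apply, LinearMap.comp_apply,
    h.comul_antipode_rTensor_comul]
  refine eq_of_tmul (f := G ∘ₗ evalRight F ∘ₗ
    (TensorProduct.leftComm ℂ A (A ⊗[ℂ] A) A).toLinearMap ∘ₗ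
    TensorProduct.map S ((antiComul S).rTensor A ∘ₗ Coalgebra.comul))
    (g := LinearMap.toSpanSingleton ℂ W w ∘ₗ F ∘ₗ S.rTensor A) (fun c d => ?_) _
  have hd := congrArg (LinearMap.toSpanSingleton ℂ W w ∘ₗ F ∘ₗ TensorProduct.mk ℂ A A (S c))
    (LinearMap.congr_fun (clact_counit (C := A)) d)
  refine Eq.trans ?_ hd
  simp only [LinearMap.comp_apply, TensorProduct.map_tmul, clact, lact]
  exact eq_of_tmul (f := G ∘ₗ evalRight F ∘ₗ
    (TensorProduct.leftComm ℂ A (A ⊗[ℂ] A) A).toLinearMap ∘ₗ TensorProduct.mk ℂ A _ (S c) ∘ₗ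
      (antiComul S).rTensor A)
    (g := LinearMap.toSpanSingleton ℂ W w ∘ₗ F ∘ₗ TensorProduct.mk ℂ A A (S c) ∘ₗ
      evalLeft Coalgebra.counit) (fun x y => by simp [hG, smul_smul, mul_comm]) _

theorem apply_clact_comulAnti (h : IsHopf m e S) (F : A ⊗[ℂ] A →ₗ[ℂ] ℂ) {G : A ⊗[ℂ] A →ₗ[ℂ] W}
    {w : W} (hG : ∀ a, G (comulAnti S a) = Coalgebra.counit (R := ℂ) a • w) (a : A) :
    G (clact F (comulAnti S a)) = F (comulAnti S a) • w := by
  rw [comulAnti, clact, lact, LinearMap.comp_apply, LinearMap.comp_apply,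
    h.comul_antipode_lTensor_comul]
  refine eq_of_tmul (f := G ∘ₗ evalLeft F ∘ₗ
    (TensorProduct.rightComm ℂ A (A ⊗[ℂ] A) A).toLinearMap ∘ₗ
    TensorProduct.map ((comulAnti S).lTensor A ∘ₗ Coalgebra.comul) S)
    (g := LinearMap.toSpanSingleton ℂ W w ∘ₗ F ∘ₗ S.lTensor A) (fun c d => ?_) _
  have hd := congrArg (LinearMap.toSpanSingleton ℂ W w ∘ₗ F ∘ₗ
    (TensorProduct.mk ℂ A A).flip (S d)) (LinearMap.congr_fun (ract_counit (C := A)) c)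
  refine Eq.trans ?_ hd
  simp only [LinearMap.comp_apply, TensorProduct.map_tmul, ract]
  exact eq_of_tmul (f := G ∘ₗ evalLeft F ∘ₗ
    (TensorProduct.rightComm ℂ A (A ⊗[ℂ] A) A).toLinearMap ∘ₗ
      (TensorProduct.mk ℂ _ A).flip (S d) ∘ₗ (comulAnti S).lTensor A)
    (g := LinearMap.toSpanSingleton ℂ W w ∘ₗ F ∘ₗ (TensorProduct.mk ℂ A A).flip (S d) ∘ₗ
      evalRight Coalgebra.counit) (fun x y => by simp [hG, smul_smul, mul_comm]) _

/-- A functional that collapses the inner pair acts on the additional factor alone. -/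
theorem clact_antiComul_tmul (h : IsHopf m e S) (F : (A ⊗[ℂ] A) ⊗[ℂ] A →ₗ[ℂ] ℂ)
    (F₀ : A →ₗ[ℂ] ℂ)
    (hF : ∀ a k, F (antiComul S a ⊗ₜ k) = Coalgebra.counit (R := ℂ) a * F₀ k) (a k : A) :
    clact F (antiComul S a ⊗ₜ k) = antiComul S a ⊗ₜ clact F₀ k := by
  let r := Coalgebra.Repr.arbitrary ℂ k
  rw [clact_tmul_right F _ r, Repr.clact_eq r, TensorProduct.tmul_sum]
  refine Finset.sum_congr rfl fun i _ => ?_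
  have h1 : (F ∘ₗ (TensorProduct.mk ℂ (A ⊗[ℂ] A) A).flip (r.left i)) ∘ₗ antiComul S =
      F₀ (r.left i) • Coalgebra.counit := LinearMap.ext fun a => by simp [hF, mul_comm]
  have h2 : clact (F₀ (r.left i) • Coalgebra.counit (R := ℂ) (A := A)) =
      F₀ (r.left i) • LinearMap.id := LinearMap.ext fun a => clact_smul_counit _ a
  rw [h.clact_antiComul, h1, h2, LinearMap.lTensor_smul]
  simp [TensorProduct.smul_tmul]

/-- The map `a ⊗ b ↦ S(a₍₁₎) ⊗ a₍₂₎ b`. -/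
def _root_.CocycleTwist.antiComulMul (m : A ⊗[ℂ] A →ₗ[ℂ] A) (S : A →ₗ[ℂ] A) :
    A ⊗[ℂ] A →ₗ[ℂ] A ⊗[ℂ] A :=
  m.lTensor A ∘ₗ (TensorProduct.assoc ℂ A A A).toLinearMap ∘ₗ (antiComul S).rTensor A

theorem comul_rTensor (h : IsHopf m e S) :
    Coalgebra.comul ∘ₗ m.rTensor A =
      TensorProduct.map (m.rTensor A) (m.rTensor A) ∘ₗ Coalgebra.comul :=
  tcoact_comp_rTensor _ h.comul_mul

theorem comul_lTensor (h : IsHopf m e S) :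
    Coalgebra.comul ∘ₗ m.lTensor A =
      TensorProduct.map (m.lTensor A) (m.lTensor A) ∘ₗ Coalgebra.comul :=
  tcoact_comp_lTensor _ h.comul_mul

theorem _root_.CocycleTwist.comul_assoc :
    Coalgebra.comul ∘ₗ (TensorProduct.assoc ℂ A A A).toLinearMap =
      TensorProduct.map (TensorProduct.assoc ℂ A A A).toLinearMap
        (TensorProduct.assoc ℂ A A A).toLinearMap ∘ₗ Coalgebra.comul :=
  tcoact_comp_assoc _ _ _

theorem mul_lTensor_assoc (h : IsHopf m e S) (t : A ⊗[ℂ] A) (k : A) :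
    m (m.lTensor A (TensorProduct.assoc ℂ A A A (t ⊗ₜ k))) = m (m t ⊗ₜ k) :=
  eq_of_tmul (f := m ∘ₗ m.lTensor A ∘ₗ (TensorProduct.assoc ℂ A A A).toLinearMap ∘ₗ
    (TensorProduct.mk ℂ _ A).flip k) (g := m ∘ₗ (TensorProduct.mk ℂ A A).flip k ∘ₗ m)
    (fun a b => by simp [h.mul_assoc]) t

theorem mul_antiComul (h : IsHopf m e S) (a : A) :
    m (antiComul S a) = Coalgebra.counit (R := ℂ) a • e := h.antipode_left a

theorem mul_comulAnti (h : IsHopf m e S) (a : A) :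
    m (comulAnti S a) = Coalgebra.counit (R := ℂ) a • e := h.antipode_right a

/-- The argument of φ is S(a₍₂₎)a₍₃₎b₍₁₎, which collapses to b₍₁₎. -/
theorem clact_comp_mul_antiComulMul (h : IsHopf m e S) (φ : A →ₗ[ℂ] ℂ) (a b : A) :
    clact (φ ∘ₗ m) (antiComulMul m S (a ⊗ₜ b)) = antiComulMul m S (a ⊗ₜ clact φ b) := by
  have h1 := LinearMap.congr_fun (lact_comp_of_equivariant h.comul_lTensor (φ ∘ₗ m))
  have h2 := LinearMap.congr_fun (lact_comp_of_equivariant comul_assoc ((φ ∘ₗ m) ∘ₗ m.lTensor A))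
  simp only [LinearMap.comp_apply] at h1 h2
  simp only [antiComulMul, LinearMap.comp_apply, LinearMap.rTensor_tmul]
  rw [h1, h2, h.clact_antiComul_tmul _ φ]
  intro a k
  simp [h.mul_lTensor_assoc, h.mul_antiComul, ← TensorProduct.smul_tmul', h.one_mul]

end IsHopf

end HopfOperators

/-! ### Cocycles, their inverses, and the functionals U and Ū -/

section Pairs

variable {A : Type*} [AddCommGroup A] [Module ℂ A] [Coalgebra ℂ A]
  {m : A ⊗[ℂ] A →ₗ[ℂ] A} {e : A} {S T : A →ₗ[ℂ] A} {γ γ' : A ⊗[ℂ] A →ₗ[ℂ] ℂ}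

/-- A unital `2`-cocycle `γ` with convolution inverse `γ'`. -/
structure IsCocyclePair (m : A ⊗[ℂ] A →ₗ[ℂ] A) (e : A) (γ γ' : A ⊗[ℂ] A →ₗ[ℂ] ℂ) : Prop where
  conv_inv : conv γ γ' = Coalgebra.counit
  inv_conv : conv γ' γ = Coalgebra.counit
  cocycle : conv (tfun γ Coalgebra.counit) (γ ∘ₗ m.rTensor A) =
    conv (tfun Coalgebra.counit γ) (γ ∘ₗ m.lTensor A) ∘ₗ
      (TensorProduct.assoc ℂ A A A).toLinearMap
  one_left : ∀ a, γ (e ⊗ₜ a) = Coalgebra.counit a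
  one_right : ∀ a, γ (a ⊗ₜ e) = Coalgebra.counit a

theorem conv_left_cancel {C : Type*} [AddCommGroup C] [Module ℂ C] [Coalgebra ℂ C]
    {φ φ' ψ χ : C →ₗ[ℂ] ℂ} (h : conv φ' φ = Coalgebra.counit) (h' : conv φ ψ = χ) :
    ψ = conv φ' χ := by
  rw [← h', ← conv_assoc, h, counit_conv]

theorem conv_right_cancel {C : Type*} [AddCommGroup C] [Module ℂ C] [Coalgebra ℂ C]
    {φ φ' ψ χ : C →ₗ[ℂ] ℂ} (h : conv φ φ' = Coalgebra.counit) (h' : conv ψ φ = χ) :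
    ψ = conv χ φ' := by
  rw [← h', conv_assoc, h, conv_counit]

theorem conv_inverse_eq {C : Type*} [AddCommGroup C] [Module ℂ C] [Coalgebra ℂ C]
    {φ ψ ψ' : C →ₗ[ℂ] ℂ} (h : conv ψ φ = Coalgebra.counit)
    (h' : conv φ ψ' = Coalgebra.counit) : ψ = ψ' := by
  rw [conv_left_cancel h h', conv_counit]

theorem conv_conv_inverse {C : Type*} [AddCommGroup C] [Module ℂ C] [Coalgebra ℂ C]
    {φ φ' ψ ψ' : C →ₗ[ℂ] ℂ} (h : conv φ φ' = Coalgebra.counit)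
    (h' : conv ψ ψ' = Coalgebra.counit) : conv (conv φ ψ) (conv ψ' φ') = Coalgebra.counit := by
  rw [conv_assoc, ← conv_assoc ψ, h', counit_conv, h]

/-- Pullback along a coalgebra map is a unital homomorphism of convolution algebras. -/
theorem conv_comp_inverse {C D : Type*} [AddCommGroup C] [Module ℂ C] [Coalgebra ℂ C]
    [AddCommGroup D] [Module ℂ D] [Coalgebra ℂ D] {g : C →ₗ[ℂ] D}
    (hg : Coalgebra.comul ∘ₗ g = TensorProduct.map g g ∘ₗ Coalgebra.comul)
    (hg' : Coalgebra.counit ∘ₗ g = Coalgebra.counit (R := ℂ))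
    {φ φ' : D →ₗ[ℂ] ℂ} (h : conv φ φ' = Coalgebra.counit) :
    conv (φ ∘ₗ g) (φ' ∘ₗ g) = Coalgebra.counit := by
  rw [← conv_comp_of_equivariant hg, h, hg']

theorem comul_comm : Coalgebra.comul ∘ₗ (TensorProduct.comm ℂ A A).toLinearMap =
    TensorProduct.map (TensorProduct.comm ℂ A A).toLinearMap
      (TensorProduct.comm ℂ A A).toLinearMap ∘ₗ Coalgebra.comul :=
  tcoact_comp_comm _ _

theorem counit_comm : Coalgebra.counit ∘ₗ (TensorProduct.comm ℂ A A).toLinearMap =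
    Coalgebra.counit (R := ℂ) :=
  TensorProduct.ext' fun a b => by simp [mul_comm]

/-- `U(a) = γ(a₍₁₎ ⊗ S(a₍₂₎))`. -/
def cU (S : A →ₗ[ℂ] A) (γ : A ⊗[ℂ] A →ₗ[ℂ] ℂ) : A →ₗ[ℂ] ℂ := γ ∘ₗ comulAnti S

/-- `Ū(a) = γ'(S(a₍₁₎) ⊗ a₍₂₎)`. -/
def cUbar (S : A →ₗ[ℂ] A) (γ' : A ⊗[ℂ] A →ₗ[ℂ] ℂ) : A →ₗ[ℂ] ℂ := γ' ∘ₗ antiComul S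

theorem counit_rTensor (h : IsHopf m e S) :
    Coalgebra.counit ∘ₗ m.rTensor A = Coalgebra.counit (R := ℂ) :=
  TensorProduct.ext' fun a b => by
    have := LinearMap.congr_fun h.counit_mul a
    simp only [LinearMap.comp_apply] at this
    simp [this]

theorem counit_lTensor (h : IsHopf m e S) :
    Coalgebra.counit ∘ₗ m.lTensor A = Coalgebra.counit (R := ℂ) :=
  TensorProduct.ext' fun b a => by
    have := LinearMap.congr_fun h.counit_mul a
    simp only [LinearMap.comp_apply] at this
    simp [this]

namespace IsCocyclePair

/-- Along the coalgebra map a ↦ e ⊗ a the cocycle pulls back to the counit, so its inverse does too.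
-/
theorem inv_one_left (hγ : IsCocyclePair m e γ γ') (h : IsHopf m e S) (a : A) :
    γ' (e ⊗ₜ a) = Coalgebra.counit a := by
  let g : A →ₗ[ℂ] A ⊗[ℂ] A := TensorProduct.mk ℂ A A e
  have hg : Coalgebra.comul ∘ₗ g = TensorProduct.map g g ∘ₗ Coalgebra.comul := by
    refine LinearMap.ext fun a => ?_
    simp only [LinearMap.comp_apply, comul_tensor, g, TensorProduct.mk_apply, tcoact_tmul,
      h.comul_one]
    exact eq_of_tmul (f := (TensorProduct.tensorTensorTensorComm ℂ A A A A).toLinearMap ∘ₗ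
      TensorProduct.mk ℂ _ _ (e ⊗ₜ e)) (g := TensorProduct.map g g) (fun a b => by simp [g]) _
  have hg' : Coalgebra.counit ∘ₗ g = Coalgebra.counit (R := ℂ) :=
    LinearMap.ext fun a => by simp [g, h.counit_one]
  have h1 : γ ∘ₗ g = Coalgebra.counit := LinearMap.ext hγ.one_left
  have h2 := conv_comp_inverse hg hg' hγ.conv_inv
  rw [h1, counit_conv] at h2
  exact LinearMap.congr_fun h2 a

theorem inv_one_right (hγ : IsCocyclePair m e γ γ') (h : IsHopf m e S) (a : A) :
    γ' (a ⊗ₜ e) = Coalgebra.counit a := by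
  let g : A →ₗ[ℂ] A ⊗[ℂ] A := (TensorProduct.mk ℂ A A).flip e
  have hg : Coalgebra.comul ∘ₗ g = TensorProduct.map g g ∘ₗ Coalgebra.comul := by
    refine LinearMap.ext fun a => ?_
    simp only [LinearMap.comp_apply, comul_tensor, g, TensorProduct.mk_apply, tcoact_tmul,
      h.comul_one, LinearMap.flip_apply]
    exact eq_of_tmul (f := (TensorProduct.tensorTensorTensorComm ℂ A A A A).toLinearMap ∘ₗ
      (TensorProduct.mk ℂ _ _).flip (e ⊗ₜ e)) (g := TensorProduct.map g g)
      (fun a b => by simp [g]) _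
  have hg' : Coalgebra.counit ∘ₗ g = Coalgebra.counit (R := ℂ) :=
    LinearMap.ext fun a => by simp [g, h.counit_one]
  have h1 : γ ∘ₗ g = Coalgebra.counit := LinearMap.ext hγ.one_right
  have h2 := conv_comp_inverse hg hg' hγ.conv_inv
  rw [h1, counit_conv] at h2
  exact LinearMap.congr_fun h2 a

theorem conv_tfun_counit {C D : Type*} [AddCommGroup C] [Module ℂ C] [Coalgebra ℂ C]
    [AddCommGroup D] [Module ℂ D] [Coalgebra ℂ D] {φ φ' : C →ₗ[ℂ] ℂ}
    (h : conv φ φ' = Coalgebra.counit) :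
    conv (tfun φ (Coalgebra.counit (R := ℂ) (A := D))) (tfun φ' Coalgebra.counit) =
      Coalgebra.counit := by
  rw [conv_tfun, h, counit_conv, counit_tensor]

theorem conv_counit_tfun {C D : Type*} [AddCommGroup C] [Module ℂ C] [Coalgebra ℂ C]
    [AddCommGroup D] [Module ℂ D] [Coalgebra ℂ D] {φ φ' : C →ₗ[ℂ] ℂ}
    (h : conv φ φ' = Coalgebra.counit) :
    conv (tfun (Coalgebra.counit (R := ℂ) (A := D)) φ) (tfun Coalgebra.counit φ') =
      Coalgebra.counit := by
  rw [conv_tfun, h, counit_conv, counit_tensor]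

/-- The inverse of the cocycle identity. -/
theorem inv_cocycle (hγ : IsCocyclePair m e γ γ') (h : IsHopf m e S) :
    conv (γ' ∘ₗ m.rTensor A) (tfun γ' Coalgebra.counit) =
      conv (γ' ∘ₗ m.lTensor A) (tfun Coalgebra.counit γ') ∘ₗ
        (TensorProduct.assoc ℂ A A A).toLinearMap := by
  -- Both sides are inverses of the common value of the two sides of the cocycle identity.
  refine conv_inverse_eq (φ := conv (tfun γ Coalgebra.counit) (γ ∘ₗ m.rTensor A)) ?_ ?_
  · exact conv_conv_inverse (conv_comp_inverse h.comul_rTensor (counit_rTensor h) hγ.inv_conv)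
      (conv_tfun_counit hγ.inv_conv)
  · rw [hγ.cocycle]
    refine conv_comp_inverse comul_assoc ?_ (conv_conv_inverse
      (conv_counit_tfun hγ.conv_inv)
      (conv_comp_inverse h.comul_lTensor (counit_lTensor h) hγ.conv_inv))
    exact TensorProduct.ext_threefold fun a b c => by simp [mul_assoc]

/-- The opposite cocycle on the opposite Hopf algebra. -/
theorem op (hγ : IsCocyclePair m e γ γ') :
    IsCocyclePair (m ∘ₗ (TensorProduct.comm ℂ A A).toLinearMap) e
      (γ ∘ₗ (TensorProduct.comm ℂ A A).toLinearMap)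
      (γ' ∘ₗ (TensorProduct.comm ℂ A A).toLinearMap) where
  conv_inv := conv_comp_inverse comul_comm counit_comm hγ.conv_inv
  inv_conv := conv_comp_inverse comul_comm counit_comm hγ.inv_conv
  one_left a := by simp [hγ.one_right]
  one_right a := by simp [hγ.one_left]
  cocycle := by
    let σ := (TensorProduct.comm ℂ A A).toLinearMap
    -- `ρ` and `ρ'` reverse the order of three factors. Pullback along this reversal exchanges the
    -- two sides of the cocycle identity.
    let ρ : (A ⊗[ℂ] A) ⊗[ℂ] A →ₗ[ℂ] A ⊗[ℂ] (A ⊗[ℂ] A) :=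
      σ.lTensor A ∘ₗ (TensorProduct.comm ℂ (A ⊗[ℂ] A) A).toLinearMap
    let ρ' : A ⊗[ℂ] (A ⊗[ℂ] A) →ₗ[ℂ] (A ⊗[ℂ] A) ⊗[ℂ] A :=
      σ.rTensor A ∘ₗ (TensorProduct.comm ℂ A (A ⊗[ℂ] A)).toLinearMap
    have hρ : Coalgebra.comul ∘ₗ ρ = TensorProduct.map ρ ρ ∘ₗ Coalgebra.comul := by
      have h1 := tcoact_comp_lTensor (Coalgebra.comul (R := ℂ) (A := A)) (comul_comm (A := A))
      have h2 := tcoact_comp_comm (Coalgebra.comul (R := ℂ) (A := A ⊗[ℂ] A))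
        (Coalgebra.comul (R := ℂ) (A := A))
      rw [comul_tensor, comul_tensor (C := A ⊗[ℂ] A), ← LinearMap.comp_assoc, h1,
        LinearMap.comp_assoc, h2, ← LinearMap.comp_assoc, ← TensorProduct.map_comp]
    have hρ' : Coalgebra.comul ∘ₗ ρ' = TensorProduct.map ρ' ρ' ∘ₗ Coalgebra.comul := by
      have h1 := tcoact_comp_rTensor (Coalgebra.comul (R := ℂ) (A := A)) (comul_comm (A := A))
      have h2 := tcoact_comp_comm (Coalgebra.comul (R := ℂ) (A := A))
        (Coalgebra.comul (R := ℂ) (A := A ⊗[ℂ] A))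
      rw [comul_tensor, comul_tensor (D := A ⊗[ℂ] A), ← LinearMap.comp_assoc, h1,
        LinearMap.comp_assoc, h2, ← LinearMap.comp_assoc, ← TensorProduct.map_comp]
    have e1 : tfun (γ ∘ₗ σ) Coalgebra.counit = tfun (Coalgebra.counit (R := ℂ)) γ ∘ₗ ρ :=
      TensorProduct.ext_threefold fun a b c => by simp [ρ, σ, mul_comm]
    have e2 : (γ ∘ₗ σ) ∘ₗ (m ∘ₗ σ).rTensor A = (γ ∘ₗ m.lTensor A) ∘ₗ ρ :=
      TensorProduct.ext_threefold fun a b c => by simp [ρ, σ]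
    have e3 : tfun Coalgebra.counit (γ ∘ₗ σ) = tfun γ (Coalgebra.counit (R := ℂ)) ∘ₗ ρ' :=
      TensorProduct.ext_threefold' fun a b c => by simp [ρ', σ, mul_comm]
    have e4 : (γ ∘ₗ σ) ∘ₗ (m ∘ₗ σ).lTensor A = (γ ∘ₗ m.rTensor A) ∘ₗ ρ' :=
      TensorProduct.ext_threefold' fun a b c => by simp [ρ', σ]
    rw [e1, e2, e3, e4, ← conv_comp_of_equivariant hρ, ← conv_comp_of_equivariant hρ',
      hγ.cocycle]
    refine TensorProduct.ext_threefold fun a b c => ?_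
    simp [ρ, ρ', σ]

/-- `γ'(S(a₍₁₎) ⊗ a₍₂₎ b) = Ū(a₍₁₎) γ(a₍₂₎ ⊗ b)`. -/
theorem inv_comp_antiComulMul (hγ : IsCocyclePair m e γ γ') (h : IsHopf m e S) :
    γ' ∘ₗ antiComulMul m S = conv (tfun (cUbar S γ') Coalgebra.counit) γ := by
  refine conv_right_cancel hγ.inv_conv (TensorProduct.ext' fun a b => ?_)
  -- At S(a₍₁₎) ⊗ a₍₂₎ ⊗ b the left side of the inverse cocycle identity collapses to Ū(a) ε(b); the
  -- right side is the functional sought, convolved with γ'.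
  have h1 := LinearMap.congr_fun (hγ.inv_cocycle h) (antiComul S a ⊗ₜ b)
  rw [conv_eq_clact, LinearMap.comp_apply, h.clact_antiComul_tmul _ Coalgebra.counit (fun a k => by
    simp [h.mul_antiComul, ← TensorProduct.smul_tmul', hγ.inv_one_left h]), clact_counit,
    LinearMap.comp_apply, conv_eq_ract, LinearMap.comp_apply, ract_tfun, ract_counit] at h1
  rw [conv_eq_ract]
  refine Eq.trans ?_ (h1.symm.trans (by simp [cUbar]))
  have h2 := congrArg (S.rTensor (A ⊗[ℂ] A)) (lTensor_ract_assoc_comul γ' a b)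
  have h3 : ∀ (t : A ⊗[ℂ] A) (b : A), TensorProduct.assoc ℂ A A A (S.rTensor A t ⊗ₜ b) =
      S.rTensor (A ⊗[ℂ] A) (TensorProduct.assoc ℂ A A A (t ⊗ₜ b)) := fun t b =>
    eq_of_tmul (f := (TensorProduct.assoc ℂ A A A).toLinearMap ∘ₗ
      (TensorProduct.mk ℂ _ A).flip b ∘ₗ S.rTensor A) (g := S.rTensor (A ⊗[ℂ] A) ∘ₗ
      (TensorProduct.assoc ℂ A A A).toLinearMap ∘ₗ (TensorProduct.mk ℂ _ A).flip b)
      (fun x y => by simp) t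
  simp only [LinearEquiv.coe_coe, antiComulMul, LinearMap.comp_apply, antiComul, h3]
  congr 2
  have h4 : ∀ t : A ⊗[ℂ] A, TensorProduct.assoc ℂ A A A
      ((S.rTensor A ∘ₗ Coalgebra.comul).rTensor A t) = S.rTensor (A ⊗[ℂ] A)
        (TensorProduct.assoc ℂ A A A ((Coalgebra.comul (R := ℂ)).rTensor A t)) :=
    eq_of_tmul (f := (TensorProduct.assoc ℂ A A A).toLinearMap ∘ₗ
      (S.rTensor A ∘ₗ Coalgebra.comul).rTensor A) (g := S.rTensor (A ⊗[ℂ] A) ∘ₗ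
      (TensorProduct.assoc ℂ A A A).toLinearMap ∘ₗ (Coalgebra.comul (R := ℂ)).rTensor A)
      fun x y => by simp [h3]
  rw [h4]
  refine h2.symm.trans ?_
  rw [← LinearMap.comp_apply, ← LinearMap.comp_apply, LinearMap.rTensor_comp_lTensor,
    LinearMap.map_comp_rTensor, LinearMap.id_comp]

/-- `Ū` is a left convolution inverse of `U`. -/
theorem cUbar_conv_cU (hγ : IsCocyclePair m e γ γ') (h : IsHopf m e S) :
    conv (cUbar S γ') (cU S γ) = Coalgebra.counit := by
  -- The identity `inv_comp_antiComulMul` is used with S(a₍₃₎) for b: γ'(S(a₍₁₎) ⊗ a₍₂₎S(a₍₃₎)) is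
  -- ε(a), and its other form is Ū * U.
  have h1 : (γ' ∘ₗ antiComulMul m S) ∘ₗ comulAnti S = Coalgebra.counit := by
    refine LinearMap.ext fun a => ?_
    have h2 := congrArg (fun t => γ' (TensorProduct.map S (m ∘ₗ S.lTensor A) t))
      (Coalgebra.coassoc_apply (R := ℂ) a)
    refine Eq.trans ?_ (h2.trans ?_)
    · refine eq_of_tmul (f := (γ' ∘ₗ antiComulMul m S) ∘ₗ S.lTensor A) (g := γ' ∘ₗ
        TensorProduct.map S (m ∘ₗ S.lTensor A) ∘ₗ (TensorProduct.assoc ℂ A A A).toLinearMap ∘ₗ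
          (Coalgebra.comul (R := ℂ)).rTensor A) (fun x y => ?_) _
      simp only [LinearMap.comp_apply, LinearMap.lTensor_tmul, LinearMap.rTensor_tmul,
        antiComulMul, antiComul]
      exact eq_of_tmul (f := γ' ∘ₗ m.lTensor A ∘ₗ (TensorProduct.assoc ℂ A A A).toLinearMap ∘ₗ
        (TensorProduct.mk ℂ _ A).flip (S y) ∘ₗ S.rTensor A) (g := γ' ∘ₗ
        TensorProduct.map S (m ∘ₗ S.lTensor A) ∘ₗ (TensorProduct.assoc ℂ A A A).toLinearMap ∘ₗ
        (TensorProduct.mk ℂ _ A).flip y) (fun x y => by simp) _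
    · refine (eq_of_tmul (f := γ' ∘ₗ TensorProduct.map S (m ∘ₗ S.lTensor A) ∘ₗ
        (Coalgebra.comul (R := ℂ)).lTensor A) (g := Coalgebra.counit ∘ₗ
          evalRight (Coalgebra.counit (R := ℂ) (A := A))) (fun x y => ?_) _).trans
          (congrArg _ (LinearMap.congr_fun (ract_counit (C := A)) a))
      have h3 := LinearMap.congr_fun h.counit_antipode x
      simp only [LinearMap.comp_apply] at h3
      simp [h.antipode_right, hγ.inv_one_right h, h3]
  rw [hγ.inv_comp_antiComulMul h] at h1
  rw [← h1, conv_eq_clact, conv_eq_clact, clact, clact, comul_tensor, lact_tcoact_tfun]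
  refine LinearMap.ext fun a => ?_
  have h5 := LinearMap.congr_fun (comul_comp_clact (cUbar S γ')) a
  simp only [LinearMap.comp_apply, cU, comulAnti] at h5 ⊢
  rw [h5]
  exact eq_of_tmul (f := γ ∘ₗ S.lTensor A ∘ₗ (clact (cUbar S γ')).rTensor A) (g := γ ∘ₗ
    TensorProduct.map (lact Coalgebra.comul (cUbar S γ')) (lact Coalgebra.comul Coalgebra.counit)
    ∘ₗ S.lTensor A) (fun x y => by
      have h6 := LinearMap.congr_fun (clact_counit (C := A)) (S y)
      simp only [clact, LinearMap.id_apply] at h6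
      simp [h6]) _

end IsCocyclePair

end Pairs

/-! ### Multiplicativity of Ū and V̄ up to the cocycle -/

section Multiplicativity

variable {A : Type*} [AddCommGroup A] [Module ℂ A]
  {m : A ⊗[ℂ] A →ₗ[ℂ] A} {e : A} {S T : A →ₗ[ℂ] A} {γ γ' : A ⊗[ℂ] A →ₗ[ℂ] ℂ}

/-- The map `a ⊗ b ↦ S(b) ⊗ S(a)`. -/
def antiSwap (S : A →ₗ[ℂ] A) : A ⊗[ℂ] A →ₗ[ℂ] A ⊗[ℂ] A :=
  TensorProduct.map S S ∘ₗ (TensorProduct.comm ℂ A A).toLinearMap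

@[simp] theorem antiSwap_tmul (a b : A) : antiSwap S (a ⊗ₜ b) = S b ⊗ₜ S a := rfl

variable [Coalgebra ℂ A]

theorem conv_comp_comm (φ ψ : A ⊗[ℂ] A →ₗ[ℂ] ℂ) :
    conv φ ψ ∘ₗ (TensorProduct.comm ℂ A A).toLinearMap =
      conv (φ ∘ₗ (TensorProduct.comm ℂ A A).toLinearMap)
        (ψ ∘ₗ (TensorProduct.comm ℂ A A).toLinearMap) :=
  conv_comp_of_equivariant comul_comm φ ψ

/-- Since `antiSwap S` reverses the coproduct of A ⊗ A, right operators become left ones. -/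
theorem IsHopf.ract_antiSwap (h : IsHopf m e S) (φ : A ⊗[ℂ] A →ₗ[ℂ] ℂ) :
    ract φ ∘ₗ antiSwap S = antiSwap S ∘ₗ clact (φ ∘ₗ antiSwap S) := by
  refine TensorProduct.ext' fun a b => ?_
  have ha := LinearMap.congr_fun h.comul_antipode a
  have hb := LinearMap.congr_fun h.comul_antipode b
  simp only [LinearMap.comp_apply, LinearEquiv.coe_coe] at ha hb
  simp only [LinearMap.comp_apply, antiSwap_tmul, ract, clact, lact, comul_tensor, tcoact_tmul,
    ha, hb]
  generalize Coalgebra.comul (R := ℂ) a = s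
  generalize Coalgebra.comul (R := ℂ) b = t
  induction s with
  | zero => simp
  | add s s' hs hs' => simp only [TensorProduct.add_tmul, TensorProduct.tmul_add, map_add, hs, hs']
  | tmul a a' =>
    induction t with
    | zero => simp
    | add t t' ht ht' =>
      simp only [TensorProduct.add_tmul, TensorProduct.tmul_add, map_add, ht, ht']
    | tmul b b' => simp

namespace IsCocyclePair

/-- This evaluates the left side of the inverse cocycle identity at S(b₍₁₎) ⊗ S(a₍₁₎) ⊗ a₍₂₎b₍₂₎,
where S(b)S(a) = S(ab) produces Ū of a product. -/
theorem inv_comp_antiSwap_conv_aux (h : IsHopf m e S) :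
    conv (γ' ∘ₗ m.rTensor A) (tfun γ' Coalgebra.counit) ∘ₗ
        TensorProduct.map (antiSwap S) m ∘ₗ Coalgebra.comul =
      conv (γ' ∘ₗ antiSwap S) (cUbar S γ' ∘ₗ m) := by
  have h1 : conv (γ' ∘ₗ m.rTensor A) (tfun γ' Coalgebra.counit) ∘ₗ
      TensorProduct.map (antiSwap S) m = γ' ∘ₗ S.rTensor A ∘ₗ TensorProduct.map m m ∘ₗ
        (clact (γ' ∘ₗ antiSwap S)).rTensor (A ⊗[ℂ] A) := by
    rw [conv_eq_ract, ract_tfun, ract_counit]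
    refine TensorProduct.ext' fun s t => ?_
    have h2 := LinearMap.congr_fun (h.ract_antiSwap γ') s
    have h3 : ∀ s, m (antiSwap S s) = S (m s) :=
      eq_of_tmul (f := m ∘ₗ antiSwap S) (g := S ∘ₗ m) fun a b => by simp [h.antipode_mul]
    simp only [LinearMap.comp_apply] at h2
    simp [h2, h3]
  rw [← LinearMap.comp_assoc, h1, LinearMap.comp_assoc, LinearMap.comp_assoc,
    LinearMap.comp_assoc, ← comul_comp_clact, conv_eq_clact]
  change γ' ∘ₗ S.rTensor A ∘ₗ (TensorProduct.map m m ∘ₗ Coalgebra.comul) ∘ₗ _ = _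
  rw [← h.comul_mul]
  rfl

/-- The regrouping S(b₍₁₎) ⊗ (S(a₍₁₎) ⊗ a₍₂₎b₍₂₎) prepares the right side of the same identity for
`clact_comp_mul_antiComulMul`. -/
theorem assoc_map_antiSwap_mul_comul (a b : A) :
    TensorProduct.assoc ℂ A A A
      (TensorProduct.map (antiSwap S) m (Coalgebra.comul (R := ℂ) (a ⊗ₜ[ℂ] b))) =
    TensorProduct.map S (antiComulMul m S ∘ₗ TensorProduct.mk ℂ A A a)
      (Coalgebra.comul (R := ℂ) b) := by
  rw [comul_tensor, tcoact_tmul]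
  refine eq_of_tmul (f := (TensorProduct.assoc ℂ A A A).toLinearMap ∘ₗ
    TensorProduct.map (antiSwap S) m ∘ₗ
      (TensorProduct.tensorTensorTensorComm ℂ A A A A).toLinearMap ∘ₗ
      TensorProduct.mk ℂ _ _ (Coalgebra.comul (R := ℂ) a))
    (g := TensorProduct.map S (antiComulMul m S ∘ₗ TensorProduct.mk ℂ A A a))
    (fun c d => ?_) _
  simp only [LinearMap.comp_apply, TensorProduct.map_tmul, TensorProduct.mk_apply, antiComulMul,
    antiComul, LinearMap.rTensor_tmul]
  exact eq_of_tmul (f := (TensorProduct.assoc ℂ A A A).toLinearMap ∘ₗ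
    TensorProduct.map (antiSwap S) m ∘ₗ
      (TensorProduct.tensorTensorTensorComm ℂ A A A A).toLinearMap ∘ₗ
      (TensorProduct.mk ℂ _ _).flip (c ⊗ₜ d))
    (g := TensorProduct.mk ℂ _ _ (S c) ∘ₗ m.lTensor A ∘ₗ
      (TensorProduct.assoc ℂ A A A).toLinearMap ∘ₗ (TensorProduct.mk ℂ _ _).flip d ∘ₗ
      S.rTensor A) (fun x y => by simp) _

/-- `γ'(S(b₍₁₎) ⊗ S(a₍₁₎)) Ū(a₍₂₎b₍₂₎) = Ū(a₍₁₎) Ū(b₍₁₎) γ(a₍₂₎ ⊗ b₍₂₎)`. -/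
theorem inv_comp_antiSwap_conv (hγ : IsCocyclePair m e γ γ') (h : IsHopf m e S) :
    conv (γ' ∘ₗ antiSwap S) (cUbar S γ' ∘ₗ m) = conv (tfun (cUbar S γ') (cUbar S γ')) γ := by
  rw [← inv_comp_antiSwap_conv_aux h, hγ.inv_cocycle h]
  refine TensorProduct.ext' fun a b => ?_
  simp only [LinearMap.comp_apply, LinearEquiv.coe_coe, assoc_map_antiSwap_mul_comul]
  -- The inner S(a₍₂₎)a₍₃₎ cancels, so the first γ' only meets S(b₍₁₎) ⊗ b₍₂₎ and contributes
  -- Ū(b₍₁₎).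
  have h1 : ∀ t : A ⊗[ℂ] A, conv (γ' ∘ₗ m.lTensor A) (tfun Coalgebra.counit γ')
      (TensorProduct.map S (antiComulMul m S ∘ₗ TensorProduct.mk ℂ A A a) t) =
      (γ' ∘ₗ antiComulMul m S) (a ⊗ₜ evalLeft (γ' ∘ₗ S.rTensor A)
        ((TensorProduct.assoc ℂ A A A).symm ((Coalgebra.comul (R := ℂ)).lTensor A t))) := by
    refine eq_of_tmul (f := conv (γ' ∘ₗ m.lTensor A) (tfun Coalgebra.counit γ') ∘ₗ
      TensorProduct.map S (antiComulMul m S ∘ₗ TensorProduct.mk ℂ A A a))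
      (g := (γ' ∘ₗ antiComulMul m S) ∘ₗ TensorProduct.mk ℂ A A a ∘ₗ
        evalLeft (γ' ∘ₗ S.rTensor A) ∘ₗ (TensorProduct.assoc ℂ A A A).symm.toLinearMap ∘ₗ
        (Coalgebra.comul (R := ℂ)).lTensor A) fun c d => ?_
    have h2 : (γ' ∘ₗ m.lTensor A) ∘ₗ TensorProduct.mk ℂ A (A ⊗[ℂ] A) (S c) =
      (γ' ∘ₗ TensorProduct.mk ℂ A A (S c)) ∘ₗ m := rfl
    simp only [LinearMap.comp_apply, TensorProduct.map_tmul, conv_tfun_counit_tmul, h2,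
      LinearMap.lTensor_tmul, TensorProduct.mk_apply, h.clact_comp_mul_antiComulMul]
    congr 3
    exact eq_of_tmul (f := evalLeft (γ' ∘ₗ TensorProduct.mk ℂ A A (S c))) (g :=
      evalLeft (γ' ∘ₗ S.rTensor A) ∘ₗ (TensorProduct.assoc ℂ A A A).symm.toLinearMap ∘ₗ
      TensorProduct.mk ℂ A _ c) (fun x y => by simp) _
  rw [h1, Coalgebra.coassoc_symm_apply]
  have h3 : ∀ t : A ⊗[ℂ] A, evalLeft (γ' ∘ₗ S.rTensor A)
      ((Coalgebra.comul (R := ℂ)).rTensor A t) = evalLeft (cUbar S γ') t :=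
    eq_of_tmul (f := evalLeft (γ' ∘ₗ S.rTensor A) ∘ₗ (Coalgebra.comul (R := ℂ)).rTensor A)
      fun x y => by simp [cUbar, antiComul]
  rw [h3, hγ.inv_comp_antiComulMul h]
  have h4 : tfun (cUbar S γ') (cUbar S γ') =
      conv (tfun Coalgebra.counit (cUbar S γ')) (tfun (cUbar S γ') Coalgebra.counit) := by
    rw [conv_tfun, conv_counit, counit_conv]
  rw [h4, conv_assoc, conv_eq_clact (tfun Coalgebra.counit (cUbar S γ')), clact, comul_tensor,
    lact_tcoact_tfun, LinearMap.comp_apply, TensorProduct.map_tmul]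
  change _ = conv _ γ (clact Coalgebra.counit a ⊗ₜ clact (cUbar S γ') b)
  rw [clact_counit]
  rfl

end IsCocyclePair

/-- The functionals `V = U ∘ T` and `V̄ = Ū ∘ T` for an inverse `T` of the antipode. -/
theorem cU_comp_inverse (h : IsHopf m e S) (hST : ∀ a, S (T a) = a) (hTS : ∀ a, T (S a) = a)
    (γ : A ⊗[ℂ] A →ₗ[ℂ] ℂ) :
    cU S γ ∘ₗ T = cU T (γ ∘ₗ (TensorProduct.comm ℂ A A).toLinearMap) := by
  refine LinearMap.ext fun a => ?_
  have h1 := LinearMap.congr_fun (h.op hST hTS).comul_antipode a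
  simp only [LinearMap.comp_apply] at h1
  simp only [LinearMap.comp_apply, cU, comulAnti, h1]
  exact eq_of_tmul (f := γ ∘ₗ S.lTensor A ∘ₗ TensorProduct.map T T ∘ₗ
    (TensorProduct.comm ℂ A A).toLinearMap) (g := γ ∘ₗ
      (TensorProduct.comm ℂ A A).toLinearMap ∘ₗ T.lTensor A) (fun x y => by simp [hST]) _

/-- With `cU_comp_inverse` this exhibits V and V̄ as the functionals U and Ū of the opposite Hopf
algebra, so that results on U and Ū transfer. -/
theorem cUbar_comp_inverse (h : IsHopf m e S) (hST : ∀ a, S (T a) = a) (hTS : ∀ a, T (S a) = a)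
    (γ' : A ⊗[ℂ] A →ₗ[ℂ] ℂ) :
    cUbar S γ' ∘ₗ T = cUbar T (γ' ∘ₗ (TensorProduct.comm ℂ A A).toLinearMap) := by
  refine LinearMap.ext fun a => ?_
  have h1 := LinearMap.congr_fun (h.op hST hTS).comul_antipode a
  simp only [LinearMap.comp_apply] at h1
  simp only [LinearMap.comp_apply, cUbar, antiComul, h1]
  exact eq_of_tmul (f := γ' ∘ₗ S.rTensor A ∘ₗ TensorProduct.map T T ∘ₗ
    (TensorProduct.comm ℂ A A).toLinearMap) (g := γ' ∘ₗ
      (TensorProduct.comm ℂ A A).toLinearMap ∘ₗ T.rTensor A) (fun x y => by simp [hST]) _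

namespace IsCocyclePair

/-- `Ū` is a right convolution inverse of `U`. -/
theorem cU_conv_cUbar (hγ : IsCocyclePair m e γ γ') (h : IsHopf m e S)
    (hST : ∀ a, S (T a) = a) (hTS : ∀ a, T (S a) = a) :
    conv (cU S γ) (cUbar S γ') = Coalgebra.counit := by
  -- The left inverse for the opposite Hopf algebra is V̄ * V = ε; composing with `S` reverses
  -- convolution and gives U * Ū = ε.
  have h1 := hγ.op.cUbar_conv_cU (h.op hST hTS)
  rw [← cU_comp_inverse h hST hTS, ← cUbar_comp_inverse h hST hTS] at h1
  have h2 := congrArg (· ∘ₗ S) h1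
  have hid : T ∘ₗ S = LinearMap.id := LinearMap.ext hTS
  simpa only [h.conv_comp_antipode, LinearMap.comp_assoc, hid, LinearMap.comp_id,
    h.counit_antipode] using h2

/-- `γ'(T(b₍₁₎) ⊗ T(a₍₁₎)) V̄(a₍₂₎b₍₂₎) = V̄(a₍₁₎) V̄(b₍₁₎) γ(a₍₂₎ ⊗ b₍₂₎)` for
`V̄ = Ū ∘ T`, where `T` is the inverse of `S`. -/
theorem inv_comp_map_conv (hγ : IsCocyclePair m e γ γ') (h : IsHopf m e S)
    (hST : ∀ a, S (T a) = a) (hTS : ∀ a, T (S a) = a) :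
    conv (γ' ∘ₗ TensorProduct.map T T ∘ₗ (TensorProduct.comm ℂ A A).toLinearMap)
        ((cUbar S γ' ∘ₗ T) ∘ₗ m) =
      conv (tfun (cUbar S γ' ∘ₗ T) (cUbar S γ' ∘ₗ T)) γ := by
  have h1 := congrArg (· ∘ₗ (TensorProduct.comm ℂ A A).toLinearMap)
    (hγ.op.inv_comp_antiSwap_conv (h.op hST hTS))
  simp only [conv_comp_comm] at h1
  rw [← cUbar_comp_inverse h hST hTS] at h1
  convert h1 using 2 <;> refine TensorProduct.ext' fun a b => ?_ <;> simp [mul_comm]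

end IsCocyclePair

end Multiplicativity

/-! ### Conjugate linear maps and conjugated functionals -/

section Star

variable {C D M N : Type*} [AddCommGroup C] [Module ℂ C] [AddCommGroup D] [Module ℂ D]
  [AddCommGroup M] [Module ℂ M] [AddCommGroup N] [Module ℂ N]

/-- Additive maps which agree on pure tensors agree. -/
theorem eq_of_tmul_semilinear {f g : C ⊗[ℂ] D →ₗ⋆[ℂ] M}
    (h : ∀ c d, f (c ⊗ₜ d) = g (c ⊗ₜ d)) (t : C ⊗[ℂ] D) : f t = g t := by
  induction t with
  | zero => simp
  | add s t hs ht => rw [map_add, map_add, hs, ht]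
  | tmul c d => exact h c d

/-- The functional `c ↦ conj φ(t(c))` for a conjugate linear map `t`. -/
def conjFun (t : C →ₗ⋆[ℂ] D) (φ : D →ₗ[ℂ] ℂ) : C →ₗ[ℂ] ℂ where
  toFun c := conj (φ (t c))
  map_add' a b := by simp
  map_smul' r a := by simp

@[simp] theorem conjFun_apply (t : C →ₗ⋆[ℂ] D) (φ : D →ₗ[ℂ] ℂ) (c : C) :
    conjFun t φ c = conj (φ (t c)) := rfl

theorem conjFun_conjFun {t : C →ₗ⋆[ℂ] C} (ht : ∀ c, t (t c) = c) (φ : C →ₗ[ℂ] ℂ) :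
    conjFun t (conjFun t φ) = φ := LinearMap.ext fun c => by simp [ht]

/-- An operator moves past an involution at the cost of conjugating its functional. -/
theorem lact_star {δ : M →ₗ[ℂ] C ⊗[ℂ] M} {δ' : N →ₗ[ℂ] D ⊗[ℂ] N} {t : C →ₗ⋆[ℂ] D}
    {s : M →ₗ⋆[ℂ] N} (h : ∀ x, δ' (s x) = TensorProduct.map t s (δ x)) (φ : D →ₗ[ℂ] ℂ) (x : M) :
    lact δ' φ (s x) = s (lact δ (conjFun t φ) x) := by
  rw [lact, lact, LinearMap.comp_apply, LinearMap.comp_apply, h]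
  exact eq_of_tmul_semilinear (f := (evalLeft φ).comp (TensorProduct.map t s))
    (g := s.comp (evalLeft (conjFun t φ))) (fun c y => by simp) _

theorem ract_star [Coalgebra ℂ C] [Coalgebra ℂ D] {t : C →ₗ⋆[ℂ] D}
    (h : ∀ x, Coalgebra.comul (R := ℂ) (t x) = TensorProduct.map t t (Coalgebra.comul x))
    (φ : D →ₗ[ℂ] ℂ) (x : C) : ract φ (t x) = t (ract (conjFun t φ) x) := by
  rw [ract, ract, LinearMap.comp_apply, LinearMap.comp_apply, h]
  exact eq_of_tmul_semilinear (f := (evalRight φ).comp (TensorProduct.map t t))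
    (g := t.comp (evalRight (conjFun t φ))) (fun c y => by simp) _

theorem conjFun_conv [Coalgebra ℂ C] [Coalgebra ℂ D] {t : C →ₗ⋆[ℂ] D}
    (h : ∀ x, Coalgebra.comul (R := ℂ) (t x) = TensorProduct.map t t (Coalgebra.comul x))
    (φ ψ : D →ₗ[ℂ] ℂ) : conjFun t (conv φ ψ) = conv (conjFun t φ) (conjFun t ψ) := by
  rw [conv_eq_clact, conv_eq_clact]
  refine LinearMap.ext fun x => ?_
  simp [lact_star h]

/-- The map `x ⊗ y ↦ s(y) ⊗ s(x)`. -/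
def dag (s : M →ₗ⋆[ℂ] M) : M ⊗[ℂ] M →ₗ⋆[ℂ] M ⊗[ℂ] M :=
  (TensorProduct.map s s).comp (TensorProduct.comm ℂ M M).toLinearMap

@[simp] theorem dag_tmul (s : M →ₗ⋆[ℂ] M) (x y : M) : dag s (x ⊗ₜ y) = s y ⊗ₜ s x := by
  simp [dag]

theorem dag_dag {s : M →ₗ⋆[ℂ] M} (hs : ∀ x, s (s x) = x) (z : M ⊗[ℂ] M) : dag s (dag s z) = z :=
  eq_of_tmul (f := (dag s).comp (dag s)) (g := LinearMap.id) (fun x y => by simp [hs]) z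

theorem tcoact_dag {δ : M →ₗ[ℂ] C ⊗[ℂ] M} {t : C →ₗ⋆[ℂ] C} {s : M →ₗ⋆[ℂ] M}
    (h : ∀ x, δ (s x) = TensorProduct.map t s (δ x)) (z : M ⊗[ℂ] M) :
    tcoact δ δ (dag s z) = TensorProduct.map (dag t) (dag s) (tcoact δ δ z) := by
  refine eq_of_tmul_semilinear (f := (tcoact δ δ).comp (dag s))
    (g := (TensorProduct.map (dag t) (dag s)).comp (tcoact δ δ)) (fun x y => ?_) z
  simp only [LinearMap.comp_apply, dag_tmul, tcoact_tmul, h]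
  generalize δ x = u
  generalize δ y = v
  induction u with
  | zero => simp
  | add u u' hu hu' => simp only [TensorProduct.add_tmul, TensorProduct.tmul_add, map_add, hu, hu']
  | tmul c x =>
    induction v with
    | zero => simp
    | add v v' hv hv' =>
      simp only [TensorProduct.add_tmul, TensorProduct.tmul_add, map_add, hv, hv']
    | tmul d y => simp

end Star

/-! ### Involutions of Hopf algebras and unitarity of the cocycle -/

section HopfStar

variable {A : Type*} [AddCommGroup A] [Module ℂ A] [Coalgebra ℂ A]

/-- A right inverse of the identity for the convolution product is the antipode. -/
theorem IsHopf.antipode_unique {m : A ⊗[ℂ] A →ₗ[ℂ] A} {e : A} {S Q : A →ₗ[ℂ] A}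
    (h : IsHopf m e S)
    (hQ : ∀ a, m (Q.lTensor A (Coalgebra.comul a)) = Coalgebra.counit (R := ℂ) a • e) :
    Q = S := by
  refine LinearMap.ext fun a => ?_
  have h1 := congrArg (fun t => m (TensorProduct.map S (m ∘ₗ Q.lTensor A) t))
    (Coalgebra.coassoc_apply (R := ℂ) a)
  refine Eq.trans ?_ (h1.trans ?_)
  · have h2 := congrArg Q (LinearMap.congr_fun (clact_counit (C := A)) a)
    refine h2.symm.trans ?_
    refine eq_of_tmul (f := Q ∘ₗ evalLeft Coalgebra.counit) (g := m ∘ₗ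
      TensorProduct.map S (m ∘ₗ Q.lTensor A) ∘ₗ (TensorProduct.assoc ℂ A A A).toLinearMap ∘ₗ
        (Coalgebra.comul (R := ℂ)).rTensor A) (fun x y => ?_) _
    have h3 := h.antipode_left x
    have h4 : ∀ t : A ⊗[ℂ] A, m (TensorProduct.map S (m ∘ₗ Q.lTensor A)
        (TensorProduct.assoc ℂ A A A (t ⊗ₜ y))) = m (m (S.rTensor A t) ⊗ₜ Q y) :=
      eq_of_tmul (f := m ∘ₗ TensorProduct.map S (m ∘ₗ Q.lTensor A) ∘ₗ
        (TensorProduct.assoc ℂ A A A).toLinearMap ∘ₗ (TensorProduct.mk ℂ _ A).flip y)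
        (g := m ∘ₗ (TensorProduct.mk ℂ A A).flip (Q y) ∘ₗ m ∘ₗ S.rTensor A)
        fun a b => by simp [h.mul_assoc]
    simp [h4, h3, ← TensorProduct.smul_tmul', h.one_mul]
  · have h2 := congrArg S (LinearMap.congr_fun (ract_counit (C := A)) a)
    refine Eq.trans ?_ h2
    exact eq_of_tmul (f := m ∘ₗ TensorProduct.map S (m ∘ₗ Q.lTensor A) ∘ₗ
      (Coalgebra.comul (R := ℂ)).lTensor A) (g := S ∘ₗ evalRight Coalgebra.counit)
      (fun x y => by simp [hQ, h.mul_one]) _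

theorem StarAlgData.IsStarAlgebra.star_one {V : Type*} [AddCommGroup V] [Module ℂ V]
    {m : StarAlgData V} (h : m.IsStarAlgebra) : m.star m.one = m.one := by
  have h1 := h.star_mul (m.star m.one) m.one
  rw [h.mul_one, h.star_star, h.mul_one] at h1
  exact h1.symm

namespace HopfStarData

variable {H : HopfStarData A}

theorem IsHopfStarAlgebra.antipode_antipodeInv (h : H.IsHopfStarAlgebra) (a : A) :
    H.antipode (H.antipodeInv a) = a :=
  LinearMap.congr_fun (Ring.mul_inverse_cancel (H.antipode : Module.End ℂ A)
    ((Module.End.isUnit_iff _).2 h.antipode_bijective)) a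

theorem IsHopfStarAlgebra.antipodeInv_antipode (h : H.IsHopfStarAlgebra) (a : A) :
    H.antipodeInv (H.antipode a) = a :=
  LinearMap.congr_fun (Ring.inverse_mul_cancel (H.antipode : Module.End ℂ A)
    ((Module.End.isUnit_iff _).2 h.antipode_bijective)) a

/-- The conjugate of ε(a∗) is again a counit in a, and a counit is unique. -/
theorem IsHopfStarAlgebra.counit_star (h : H.IsHopfStarAlgebra) (a : A) :
    Coalgebra.counit (R := ℂ) (H.star a) = conj (Coalgebra.counit (R := ℂ) a) := by
  have h1 : clact (conjFun H.star (Coalgebra.counit (R := ℂ) (A := A))) = LinearMap.id := by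
    refine LinearMap.ext fun a => ?_
    have h2 := lact_star h.comul_star (Coalgebra.counit (R := ℂ) (A := A)) a
    have h3 := LinearMap.congr_fun (clact_counit (C := A)) (H.star a)
    have h4 := congrArg H.star (h2.symm.trans h3)
    rwa [h.star_star, LinearMap.id_apply, h.star_star] at h4
  have h2 := conv_eq_clact (conjFun H.star (Coalgebra.counit (R := ℂ) (A := A)))
    Coalgebra.counit
  rw [h1, conv_counit, LinearMap.comp_id] at h2
  have h3 := LinearMap.congr_fun h2 a
  rw [← h3]
  simp

/-- The linear map ∗S∗ satisfies the antipode law for the opposite product, whose antipode is S⁻¹.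
-/
theorem IsHopfStarAlgebra.star_antipode (h : H.IsHopfStarAlgebra) (a : A) :
    H.star (H.antipode a) = H.antipodeInv (H.star a) := by
  let Q : A →ₗ[ℂ] A := H.star.comp (H.antipode.comp H.star)
  have hQ : Q = H.antipodeInv := by
    refine (h.isHopf.op h.antipode_antipodeInv h.antipodeInv_antipode).antipode_unique
      fun a => ?_
    have h1 := congrArg H.star (h.antipode_right (H.star a))
    rw [map_smulₛₗ, h.counit_star, Complex.conj_conj, h.star_one] at h1
    refine Eq.trans ?_ h1
    rw [h.comul_star]
    exact eq_of_tmul (f := (H.mulMap ∘ₗ (TensorProduct.comm ℂ A A).toLinearMap) ∘ₗ Q.lTensor A)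
      (g := (H.star.comp (H.mulMap ∘ₗ H.antipode.lTensor A)).comp
        (H.starTensor H.toStarAlgData)) (fun x y => by
          simp [StarAlgData.starTensor, AlgData.mulMap_tmul, h.star_mul, h.star_star, Q]) _
  rw [← hQ]
  simp [Q, h.star_star]

variable {γ : A ⊗[ℂ] A →ₗ[ℂ] ℂ}

theorem IsTwoCocycle.isCocyclePair (hγ : H.IsTwoCocycle γ) :
    IsCocyclePair H.mulMap H.one γ (convInv γ) where
  conv_inv := WithConv.toConv_injective (Ring.mul_inverse_cancel _ hγ.isUnit)
  inv_conv := WithConv.toConv_injective (Ring.inverse_mul_cancel _ hγ.isUnit)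
  one_left := hγ.map_one_left
  one_right := hγ.map_one_right
  cocycle := TensorProduct.ext_threefold fun a b c => by
    have h1 := hγ.cocycle a b c
    rw [conv_eq_clact, conv_eq_clact] at h1
    rw [conv_eq_clact, conv_eq_clact, clact, clact, comul_tensor, comul_tensor (D := A ⊗[ℂ] A),
      lact_tcoact_tfun, lact_tcoact_tfun]
    have hc := LinearMap.congr_fun (clact_counit (C := A))
    simp only [LinearMap.comp_apply, LinearEquiv.coe_coe, TensorProduct.assoc_tmul,
      TensorProduct.map_tmul, hc, LinearMap.id_apply, LinearMap.rTensor_tmul,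
      LinearMap.lTensor_tmul] at h1 ⊢
    exact h1

theorem V_eq : H.V γ = cU H.antipode γ ∘ₗ H.antipodeInv := rfl

theorem Vbar_eq : H.Vbar γ = cUbar H.antipode (convInv γ) ∘ₗ H.antipodeInv := rfl

theorem V_conv_Vbar (h : H.IsHopfStarAlgebra) (hγ : H.IsTwoCocycle γ) :
    conv (H.V γ) (H.Vbar γ) = Coalgebra.counit := by
  rw [V_eq, Vbar_eq, cU_comp_inverse h.isHopf h.antipode_antipodeInv h.antipodeInv_antipode,
    cUbar_comp_inverse h.isHopf h.antipode_antipodeInv h.antipodeInv_antipode]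
  exact hγ.isCocyclePair.op.cU_conv_cUbar
    (h.isHopf.op h.antipode_antipodeInv h.antipodeInv_antipode) h.antipodeInv_antipode
    h.antipode_antipodeInv

theorem Vbar_conv_V (h : H.IsHopfStarAlgebra) (hγ : H.IsTwoCocycle γ) :
    conv (H.Vbar γ) (H.V γ) = Coalgebra.counit := by
  rw [V_eq, Vbar_eq, cU_comp_inverse h.isHopf h.antipode_antipodeInv h.antipodeInv_antipode,
    cUbar_comp_inverse h.isHopf h.antipode_antipodeInv h.antipodeInv_antipode]
  exact hγ.isCocyclePair.op.cUbar_conv_cU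
    (h.isHopf.op h.antipode_antipodeInv h.antipodeInv_antipode)

theorem conjFun_dag (h : H.IsHopfStarAlgebra) (hγ : H.IsUnitaryTwoCocycle γ) :
    conjFun (dag H.star) γ = convInv γ ∘ₗ TensorProduct.map H.antipodeInv H.antipodeInv ∘ₗ
      (TensorProduct.comm ℂ A A).toLinearMap :=
  TensorProduct.ext' fun a b => by simp [hγ.unitary, h.star_antipode, h.star_star]

/-- In the form V(k) = γ(S⁻¹(k₍₂₎) ⊗ k₍₁₎), unitarity removes S⁻¹ from one argument and places it on
the other, which gives γ̄(k₍₂₎ ⊗ S⁻¹(k₍₁₎)) = V̄(k). -/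
theorem conjFun_V (h : H.IsHopfStarAlgebra) (hγ : H.IsUnitaryTwoCocycle γ) :
    conjFun H.star (H.V γ) = H.Vbar γ := by
  rw [V_eq, Vbar_eq, cU_comp_inverse h.isHopf h.antipode_antipodeInv h.antipodeInv_antipode,
    cUbar_comp_inverse h.isHopf h.antipode_antipodeInv h.antipodeInv_antipode]
  refine LinearMap.ext fun a => ?_
  simp only [conjFun_apply, cU, comulAnti, LinearMap.comp_apply]
  rw [h.comul_star]
  exact eq_of_tmul (f := conjFun (H.starTensor H.toStarAlgData)
      ((γ ∘ₗ (TensorProduct.comm ℂ A A).toLinearMap) ∘ₗ H.antipodeInv.lTensor A))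
    (g := (convInv γ ∘ₗ (TensorProduct.comm ℂ A A).toLinearMap) ∘ₗ H.antipodeInv.rTensor A)
    (fun x y => by
      simp [StarAlgData.starTensor, hγ.unitary, h.antipode_antipodeInv, h.star_star,
        h.star_antipode]) _

theorem conjFun_Vbar (h : H.IsHopfStarAlgebra) (hγ : H.IsUnitaryTwoCocycle γ) :
    conjFun H.star (H.Vbar γ) = H.V γ := by
  rw [← conjFun_V h hγ, conjFun_conjFun h.star_star]

/-- The compatibility of `V̄` with products. -/
theorem conj_conv_Vbar (h : H.IsHopfStarAlgebra) (hγ : H.IsUnitaryTwoCocycle γ) :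
    conv (conjFun (dag H.star) γ) (H.Vbar γ ∘ₗ H.mulMap) =
      conv (tfun (H.Vbar γ) (H.Vbar γ)) γ := by
  rw [conjFun_dag h hγ]
  exact hγ.isCocyclePair.inv_comp_map_conv h.isHopf h.antipode_antipodeInv
    h.antipodeInv_antipode

end HopfStarData

end HopfStar

/-! ### The twisted Hopf ∗-algebra -/

section TwistedHopf

variable {A : Type*} [AddCommGroup A] [Module ℂ A] [Coalgebra ℂ A]
  {m : A ⊗[ℂ] A →ₗ[ℂ] A} {e : A} {S T : A →ₗ[ℂ] A} {γ γ' : A ⊗[ℂ] A →ₗ[ℂ] ℂ}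

theorem sandwich_comp_sandwich {C : Type*} [AddCommGroup C] [Module ℂ C] [Coalgebra ℂ C]
    (φ φ' ψ ψ' : C →ₗ[ℂ] ℂ) :
    sandwich φ ψ ∘ₗ sandwich φ' ψ' = sandwich (conv φ' φ) (conv ψ ψ') := by
  rw [sandwich_eq, sandwich_eq, sandwich_eq, LinearMap.comp_assoc,
    ← LinearMap.comp_assoc (clact φ'), clact_comp_ract, LinearMap.comp_assoc, clact_clact,
    ← LinearMap.comp_assoc, ract_ract]

theorem sandwich_counit {C : Type*} [AddCommGroup C] [Module ℂ C] [Coalgebra ℂ C] :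
    sandwich (Coalgebra.counit (R := ℂ) (A := C)) Coalgebra.counit = LinearMap.id := by
  rw [sandwich_eq, clact_counit, ract_counit, LinearMap.comp_id]

theorem clact_tfun {C D : Type*} [AddCommGroup C] [Module ℂ C] [Coalgebra ℂ C]
    [AddCommGroup D] [Module ℂ D] [Coalgebra ℂ D] (φ : C →ₗ[ℂ] ℂ) (ψ : D →ₗ[ℂ] ℂ) :
    clact (tfun φ ψ) = TensorProduct.map (clact φ) (clact ψ) := by
  rw [clact, comul_tensor, lact_tcoact_tfun]

theorem sandwich_tfun {C D : Type*} [AddCommGroup C] [Module ℂ C] [Coalgebra ℂ C]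
    [AddCommGroup D] [Module ℂ D] [Coalgebra ℂ D] (φ φ' : C →ₗ[ℂ] ℂ) (ψ ψ' : D →ₗ[ℂ] ℂ) :
    sandwich (tfun φ ψ) (tfun φ' ψ') = TensorProduct.map (sandwich φ φ') (sandwich ψ ψ') := by
  rw [sandwich_eq, sandwich_eq, sandwich_eq, ract_tfun, clact_tfun, ← TensorProduct.map_comp]

theorem sandwich_rTensor (γ γ' : A ⊗[ℂ] A →ₗ[ℂ] ℂ) :
    (sandwich γ γ').rTensor A =
      sandwich (tfun γ Coalgebra.counit) (tfun γ' Coalgebra.counit) := by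
  rw [sandwich_tfun, sandwich_counit, LinearMap.rTensor_def]

theorem sandwich_lTensor (γ γ' : A ⊗[ℂ] A →ₗ[ℂ] ℂ) :
    (sandwich γ γ').lTensor A =
      sandwich (tfun Coalgebra.counit γ) (tfun Coalgebra.counit γ') := by
  rw [sandwich_tfun, sandwich_counit, LinearMap.lTensor_def]

theorem sandwich_comp_of_equivariant {C D : Type*} [AddCommGroup C] [Module ℂ C] [Coalgebra ℂ C]
    [AddCommGroup D] [Module ℂ D] [Coalgebra ℂ D] {g : C →ₗ[ℂ] D}
    (h : Coalgebra.comul ∘ₗ g = TensorProduct.map g g ∘ₗ Coalgebra.comul) (φ ψ : D →ₗ[ℂ] ℂ) :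
    sandwich φ ψ ∘ₗ g = g ∘ₗ sandwich (φ ∘ₗ g) (ψ ∘ₗ g) := by
  rw [sandwich_eq, sandwich_eq, LinearMap.comp_assoc, lact_comp_of_equivariant h,
    ← LinearMap.comp_assoc, ract_comp_of_equivariant h, LinearMap.comp_assoc]

/-- The twisted product. -/
def tmul₂ (m : A ⊗[ℂ] A →ₗ[ℂ] A) (γ γ' : A ⊗[ℂ] A →ₗ[ℂ] ℂ) : A ⊗[ℂ] A →ₗ[ℂ] A :=
  m ∘ₗ sandwich γ γ'

/-- All twists in a threefold product are collected into one sandwich on A ⊗ A ⊗ A. Associativity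
then compares it with `tmul₂_lTensor`, by the cocycle identity on the left and the inverse one on
the right. -/
theorem tmul₂_rTensor (h : IsHopf m e S) :
    tmul₂ m γ γ' ∘ₗ (tmul₂ m γ γ').rTensor A = (m ∘ₗ m.rTensor A) ∘ₗ
      sandwich (conv (tfun γ Coalgebra.counit) (γ ∘ₗ m.rTensor A))
        (conv (γ' ∘ₗ m.rTensor A) (tfun γ' Coalgebra.counit)) := by
  rw [tmul₂, LinearMap.rTensor_comp, LinearMap.comp_assoc,
    ← LinearMap.comp_assoc ((sandwich γ γ').rTensor A),
    sandwich_comp_of_equivariant h.comul_rTensor, sandwich_rTensor, LinearMap.comp_assoc,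
    sandwich_comp_sandwich, LinearMap.comp_assoc]

theorem tmul₂_lTensor (h : IsHopf m e S) :
    tmul₂ m γ γ' ∘ₗ (tmul₂ m γ γ').lTensor A = (m ∘ₗ m.lTensor A) ∘ₗ
      sandwich (conv (tfun Coalgebra.counit γ) (γ ∘ₗ m.lTensor A))
        (conv (γ' ∘ₗ m.lTensor A) (tfun Coalgebra.counit γ')) := by
  rw [tmul₂, LinearMap.lTensor_comp, LinearMap.comp_assoc,
    ← LinearMap.comp_assoc ((sandwich γ γ').lTensor A),
    sandwich_comp_of_equivariant h.comul_lTensor, sandwich_lTensor, LinearMap.comp_assoc,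
    sandwich_comp_sandwich, LinearMap.comp_assoc]

namespace IsCocyclePair

theorem tmul₂_assoc (hγ : IsCocyclePair m e γ γ') (h : IsHopf m e S) (a b c : A) :
    tmul₂ m γ γ' (tmul₂ m γ γ' (a ⊗ₜ b) ⊗ₜ c) = tmul₂ m γ γ' (a ⊗ₜ tmul₂ m γ γ' (b ⊗ₜ c)) := by
  have h1 := LinearMap.congr_fun (tmul₂_rTensor (γ := γ) (γ' := γ') h) ((a ⊗ₜ b) ⊗ₜ c)
  have h2 := LinearMap.congr_fun (tmul₂_lTensor (γ := γ) (γ' := γ') h) (a ⊗ₜ (b ⊗ₜ c))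
  rw [hγ.cocycle, hγ.inv_cocycle h] at h1
  have h3 := LinearMap.congr_fun (sandwich_comp_of_equivariant (comul_assoc (A := A))
    (conv (tfun Coalgebra.counit γ) (γ ∘ₗ m.lTensor A))
    (conv (γ' ∘ₗ m.lTensor A) (tfun Coalgebra.counit γ'))) ((a ⊗ₜ b) ⊗ₜ c)
  have h4 : m ∘ₗ m.rTensor A = (m ∘ₗ m.lTensor A) ∘ₗ
      (TensorProduct.assoc ℂ A A A).toLinearMap :=
    TensorProduct.ext_threefold fun a b c => by simp [h.mul_assoc]
  refine h1.trans (Eq.trans ?_ h2.symm)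
  rw [h4]
  exact congrArg (m ∘ₗ m.lTensor A) h3.symm

theorem tmul₂_one_left (hγ : IsCocyclePair m e γ γ') (h : IsHopf m e S) (a : A) :
    tmul₂ m γ γ' (e ⊗ₜ a) = a := by
  let g : A →ₗ[ℂ] A ⊗[ℂ] A := TensorProduct.mk ℂ A A e
  have hg : Coalgebra.comul ∘ₗ g = TensorProduct.map g g ∘ₗ Coalgebra.comul := by
    refine LinearMap.ext fun a => ?_
    simp only [LinearMap.comp_apply, comul_tensor, g, TensorProduct.mk_apply, tcoact_tmul,
      h.comul_one]
    exact eq_of_tmul (f := (TensorProduct.tensorTensorTensorComm ℂ A A A A).toLinearMap ∘ₗ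
      TensorProduct.mk ℂ _ _ (e ⊗ₜ e)) (g := TensorProduct.map g g) (fun a b => by simp [g]) _
  have h1 : γ ∘ₗ g = Coalgebra.counit := LinearMap.ext hγ.one_left
  have h2 : γ' ∘ₗ g = Coalgebra.counit := LinearMap.ext (hγ.inv_one_left h)
  have h3 := LinearMap.congr_fun (sandwich_comp_of_equivariant hg γ γ') a
  rw [h1, h2, sandwich_counit] at h3
  exact (congrArg m h3).trans (h.one_mul a)

theorem tmul₂_one_right (hγ : IsCocyclePair m e γ γ') (h : IsHopf m e S) (a : A) :
    tmul₂ m γ γ' (a ⊗ₜ e) = a := by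
  let g : A →ₗ[ℂ] A ⊗[ℂ] A := (TensorProduct.mk ℂ A A).flip e
  have hg : Coalgebra.comul ∘ₗ g = TensorProduct.map g g ∘ₗ Coalgebra.comul := by
    refine LinearMap.ext fun a => ?_
    simp only [LinearMap.comp_apply, comul_tensor, g, TensorProduct.mk_apply, tcoact_tmul,
      h.comul_one, LinearMap.flip_apply]
    exact eq_of_tmul (f := (TensorProduct.tensorTensorTensorComm ℂ A A A A).toLinearMap ∘ₗ
      (TensorProduct.mk ℂ _ _).flip (e ⊗ₜ e)) (g := TensorProduct.map g g)
      (fun a b => by simp [g]) _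
  have h1 : γ ∘ₗ g = Coalgebra.counit := LinearMap.ext hγ.one_right
  have h2 : γ' ∘ₗ g = Coalgebra.counit := LinearMap.ext (hγ.inv_one_right h)
  have h3 := LinearMap.congr_fun (sandwich_comp_of_equivariant hg γ γ') a
  rw [h1, h2, sandwich_counit] at h3
  exact (congrArg m h3).trans (h.mul_one a)

theorem counit_tmul₂ (hγ : IsCocyclePair m e γ γ') (h : IsHopf m e S) :
    Coalgebra.counit ∘ₗ tmul₂ m γ γ' = Coalgebra.counit (R := ℂ) := by
  rw [tmul₂, ← LinearMap.comp_assoc, h.counit_mul, sandwich_eq, ← LinearMap.comp_assoc,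
    ← conv_eq_ract, counit_conv, ← conv_eq_clact, hγ.conv_inv]

end IsCocyclePair

/-- `Δ ∘ (φ * - * ψ)`, split by a convolution unit and its inverse. -/
theorem comul_comp_sandwich {C : Type*} [AddCommGroup C] [Module ℂ C] [Coalgebra ℂ C]
    {φ ψ : C →ₗ[ℂ] ℂ} (h : conv ψ φ = Coalgebra.counit) :
    Coalgebra.comul ∘ₗ sandwich φ ψ =
      TensorProduct.map (sandwich φ ψ) (sandwich φ ψ) ∘ₗ Coalgebra.comul := by
  have h1 : TensorProduct.map (sandwich φ ψ) (sandwich φ ψ) =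
      (ract ψ).lTensor C ∘ₗ (clact φ).lTensor C ∘ₗ (clact φ).rTensor C ∘ₗ (ract ψ).rTensor C := by
    rw [← LinearMap.rTensor_comp, clact_comp_ract, ← LinearMap.comp_assoc, ← LinearMap.lTensor_comp,
      LinearMap.lTensor_comp_rTensor]; rfl
  have h2 : (clact φ).lTensor C ∘ₗ (clact φ).rTensor C =
      (clact φ).rTensor C ∘ₗ (clact φ).lTensor C := by
    rw [LinearMap.lTensor_comp_rTensor, LinearMap.rTensor_comp_lTensor]
  -- The inner factors ψ and φ of the two sandwiches sit on adjacent legs of the coproduct and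
  -- cancel.
  have h3 : (clact φ).lTensor C ∘ₗ (ract ψ).rTensor C ∘ₗ Coalgebra.comul = Coalgebra.comul := by
    rw [rTensor_ract_comul, ← LinearMap.comp_assoc, ← LinearMap.lTensor_comp, clact_clact, h,
      clact_counit, LinearMap.lTensor_id, LinearMap.id_comp]
  rw [h1, LinearMap.comp_assoc, LinearMap.comp_assoc, LinearMap.comp_assoc]
  rw [← LinearMap.comp_assoc ((ract ψ).rTensor C ∘ₗ Coalgebra.comul), h2, LinearMap.comp_assoc, h3,
    ← comul_comp_clact, ← LinearMap.comp_assoc, ← comul_comp_ract, LinearMap.comp_assoc,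
    sandwich_eq]

theorem IsHopf.comul_comp_tmul₂ (h : IsHopf m e S) (hγ : IsCocyclePair m e γ γ') :
    Coalgebra.comul ∘ₗ tmul₂ m γ γ' =
      TensorProduct.map (tmul₂ m γ γ') (tmul₂ m γ γ') ∘ₗ Coalgebra.comul := by
  rw [tmul₂, ← LinearMap.comp_assoc, h.comul_mul, LinearMap.comp_assoc,
    comul_comp_sandwich hγ.inv_conv, ← LinearMap.comp_assoc, ← TensorProduct.map_comp]

namespace IsCocyclePair

/-- The twisted antipode is a right convolution inverse of the identity. -/
theorem tmul₂_antipode_right (hγ : IsCocyclePair m e γ γ') (h : IsHopf m e S)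
    (hU : conv (cU S γ) (cUbar S γ') = Coalgebra.counit) (a : A) :
    tmul₂ m γ γ' ((S ∘ₗ sandwich (cU S γ) (cUbar S γ')).lTensor A (Coalgebra.comul a)) =
      Coalgebra.counit (R := ℂ) a • e := by
  -- This is a₍₁₎ ⊗ U(a₍₂₎) S(a₍₃₎) Ū(a₍₄₎): U is moved to the first factor and Ū to the argument.
  have h1 : (S ∘ₗ sandwich (cU S γ) (cUbar S γ')).lTensor A ∘ₗ Coalgebra.comul =
      ract (tfun (cU S γ) (Coalgebra.counit (R := ℂ) (A := A))) ∘ₗ comulAnti S ∘ₗ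
        ract (cUbar S γ') := by
    rw [sandwich_eq, ← clact_comp_ract, LinearMap.lTensor_comp, LinearMap.lTensor_comp,
      LinearMap.comp_assoc, LinearMap.comp_assoc, ← comul_comp_ract,
      ← LinearMap.comp_assoc (ract (cUbar S γ')), ← rTensor_ract_comul, ract_tfun, ract_counit,
      comulAnti, ← LinearMap.rTensor_def]
    simp only [← LinearMap.comp_assoc, LinearMap.lTensor_comp_rTensor,
      LinearMap.rTensor_comp_lTensor]
  -- The convolution inverse (Ū ⊗ ε) * γ restricts along `comulAnti S` to Ū * U = ε. By
  -- `ract_comulAnti` its right operator fixes the values of `comulAnti S`, so the functional itself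
  -- restricts to ε.
  have h2 : conv γ' (tfun (cU S γ) Coalgebra.counit) ∘ₗ comulAnti S = Coalgebra.counit := by
    have h3 : conv (tfun (cUbar S γ') Coalgebra.counit) γ ∘ₗ comulAnti S = Coalgebra.counit := by
      refine Eq.trans ?_ (hγ.cUbar_conv_cU h)
      rw [conv_eq_clact, clact_tfun, conv_eq_clact, clact_counit]
      refine LinearMap.ext fun a => ?_
      have h5 := LinearMap.congr_fun (comul_comp_clact (cUbar S γ')) a
      simp only [LinearMap.comp_apply, cU, comulAnti] at h5 ⊢
      rw [h5]
      exact eq_of_tmul (f := γ ∘ₗ TensorProduct.map (clact (cUbar S γ')) LinearMap.id ∘ₗ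
        S.lTensor A) (g := γ ∘ₗ S.lTensor A ∘ₗ (clact (cUbar S γ')).rTensor A)
        (fun x y => by simp) _
    have h4 := conv_conv_inverse hγ.inv_conv (conv_tfun_counit (D := A) hU)
    have h5 : ract (conv (tfun (cUbar S γ') Coalgebra.counit) γ) ∘ₗ comulAnti S = comulAnti S := by
      refine LinearMap.ext fun a => ?_
      rw [LinearMap.comp_apply, h.ract_comulAnti, h3, ract_counit, LinearMap.rTensor_id]; rfl
    have h6 := congrArg (· ∘ₗ comulAnti S) h4
    simp only [conv_eq_ract (conv γ' (tfun (cU S γ) Coalgebra.counit)), LinearMap.comp_assoc,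
      h5] at h6
    rw [h6]
    refine LinearMap.ext fun a => ?_
    refine (eq_of_tmul (f := Coalgebra.counit ∘ₗ S.lTensor A) (g := Coalgebra.counit ∘ₗ
      evalRight (Coalgebra.counit (R := ℂ) (A := A))) (fun x y => ?_) _).trans
          (congrArg _ (LinearMap.congr_fun (ract_counit (C := A)) a))
    have h7 := LinearMap.congr_fun h.counit_antipode y
    simp only [LinearMap.comp_apply] at h7
    simp [h7]
  have h3 := LinearMap.congr_fun h1 a
  simp only [LinearMap.comp_apply] at h3
  -- The right twist by γ' cancels against U. The product then collapses the inner pair, so the left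
  -- twist by γ contributes U, and U * Ū = ε remains.
  rw [h3, tmul₂, sandwich_eq, ← clact_comp_ract]
  simp only [LinearMap.comp_apply]
  have h4 := LinearMap.congr_fun (ract_ract γ' (tfun (cU S γ) (Coalgebra.counit (R := ℂ) (A := A))))
  simp only [LinearMap.comp_apply] at h4
  rw [h4, h.ract_comulAnti, h2, ract_counit, LinearMap.rTensor_id, LinearMap.id_apply,
    h.apply_clact_comulAnti γ h.mul_comulAnti]
  congr 1
  have h5 := LinearMap.congr_fun hU a
  rw [conv_eq_ract] at h5
  exact h5

/-- The twisted antipode is a left convolution inverse of the identity. -/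
theorem tmul₂_antipode_left (hγ : IsCocyclePair m e γ γ') (h : IsHopf m e S)
    (hU : conv (cU S γ) (cUbar S γ') = Coalgebra.counit) (a : A) :
    tmul₂ m γ γ' ((S ∘ₗ sandwich (cU S γ) (cUbar S γ')).rTensor A (Coalgebra.comul a)) =
      Coalgebra.counit (R := ℂ) a • e := by
  have h1 : (S ∘ₗ sandwich (cU S γ) (cUbar S γ')).rTensor A ∘ₗ Coalgebra.comul =
      clact (tfun (Coalgebra.counit (R := ℂ) (A := A)) (cUbar S γ')) ∘ₗ antiComul S ∘ₗ
        clact (cU S γ) := by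
    rw [sandwich_eq, LinearMap.rTensor_comp, LinearMap.rTensor_comp,
      LinearMap.comp_assoc, LinearMap.comp_assoc, ← comul_comp_clact,
      ← LinearMap.comp_assoc (clact (cU S γ)), rTensor_ract_comul, clact_tfun, clact_counit,
      antiComul, ← LinearMap.lTensor_def]
    simp only [← LinearMap.comp_assoc, LinearMap.lTensor_comp_rTensor,
      LinearMap.rTensor_comp_lTensor]
  -- The mirror image: now the left twist by γ cancels against Ū, and the right twist by γ' supplies
  -- Ū.
  have h2 : conv (tfun Coalgebra.counit (cUbar S γ')) γ ∘ₗ antiComul S = Coalgebra.counit := by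
    have h3 : conv γ' (tfun Coalgebra.counit (cU S γ)) ∘ₗ antiComul S = Coalgebra.counit := by
      refine Eq.trans ?_ (hγ.cUbar_conv_cU h)
      rw [conv_eq_ract, ract_tfun, conv_eq_ract, ract_counit, ← LinearMap.lTensor_def]
      refine LinearMap.ext fun a => ?_
      have h5 := LinearMap.congr_fun (comul_comp_ract (cU S γ)) a
      simp only [LinearMap.comp_apply, cUbar, antiComul] at h5 ⊢
      rw [h5]
      exact eq_of_tmul (f := γ' ∘ₗ (ract (cU S γ)).lTensor A ∘ₗ S.rTensor A)
        (g := γ' ∘ₗ S.rTensor A ∘ₗ (ract (cU S γ)).lTensor A) (fun x y => by simp) _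
    have h4 := conv_conv_inverse hγ.inv_conv (conv_counit_tfun (D := A) hU)
    have h5 : clact (conv γ' (tfun Coalgebra.counit (cU S γ))) ∘ₗ antiComul S = antiComul S := by
      refine LinearMap.ext fun a => ?_
      rw [LinearMap.comp_apply, h.clact_antiComul, h3, clact_counit, LinearMap.lTensor_id]; rfl
    have h6 := congrArg (· ∘ₗ antiComul S) h4
    simp only [conv_eq_clact (conv γ' (tfun Coalgebra.counit (cU S γ))), LinearMap.comp_assoc,
      h5] at h6
    rw [h6]
    refine LinearMap.ext fun a => ?_
    refine (eq_of_tmul (f := Coalgebra.counit ∘ₗ S.rTensor A) (g := Coalgebra.counit ∘ₗ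
      evalRight (Coalgebra.counit (R := ℂ) (A := A))) (fun x y => ?_) _).trans
          (congrArg _ (LinearMap.congr_fun (ract_counit (C := A)) a))
    have h7 := LinearMap.congr_fun h.counit_antipode x
    simp only [LinearMap.comp_apply] at h7
    simp [h7]
  have h3 := LinearMap.congr_fun h1 a
  simp only [LinearMap.comp_apply] at h3
  rw [h3, tmul₂, sandwich_eq]
  simp only [LinearMap.comp_apply]
  have h4 := LinearMap.congr_fun (clact_clact γ
    (tfun (Coalgebra.counit (R := ℂ) (A := A)) (cUbar S γ')))
  simp only [LinearMap.comp_apply] at h4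
  rw [h4, h.clact_antiComul, h2, clact_counit, LinearMap.lTensor_id, LinearMap.id_apply,
    h.apply_ract_antiComul γ' h.mul_antiComul]
  congr 1
  have h5 := LinearMap.congr_fun hU a
  rw [conv_eq_clact] at h5
  exact h5

end IsCocyclePair

namespace HopfStarData

variable {H : HopfStarData A}

theorem twist_mulMap (H : HopfStarData A) (γ : A ⊗[ℂ] A →ₗ[ℂ] ℂ) :
    (H.twist γ).mulMap = tmul₂ H.mulMap γ (convInv γ) :=
  TensorProduct.ext' fun _ _ => rfl

theorem twist_star (H : HopfStarData A) (γ : A ⊗[ℂ] A →ₗ[ℂ] ℂ) (a : A) :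
    (H.twist γ).star a = sandwich (H.Vbar γ) (H.V γ) (H.star a) := rfl

theorem sandwich_star {C : Type*} [AddCommGroup C] [Module ℂ C] [Coalgebra ℂ C] {t : C →ₗ⋆[ℂ] C}
    (h : ∀ x, Coalgebra.comul (R := ℂ) (t x) = TensorProduct.map t t (Coalgebra.comul x))
    (φ ψ : C →ₗ[ℂ] ℂ) (x : C) :
    sandwich φ ψ (t x) = t (sandwich (conjFun t φ) (conjFun t ψ) x) := by
  rw [sandwich_eq, sandwich_eq, LinearMap.comp_apply, lact_star h, ract_star h,
    LinearMap.comp_apply]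

theorem comul_dag (h : H.IsHopfStarAlgebra) (z : A ⊗[ℂ] A) :
    Coalgebra.comul (R := ℂ) (dag H.star z) =
      TensorProduct.map (dag H.star) (dag H.star) (Coalgebra.comul z) :=
  tcoact_dag h.comul_star z

theorem star_mulMap (h : H.IsHopfStarAlgebra) (z : A ⊗[ℂ] A) :
    H.star (H.mulMap z) = H.mulMap (dag H.star z) :=
  eq_of_tmul_semilinear (f := H.star.comp H.mulMap) (g := H.mulMap.comp (dag H.star))
    (fun a b => by simp [AlgData.mulMap_tmul, h.star_mul]) z

/-- Both sides are inverses of the functional in `conj_conv_Vbar`. -/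
theorem conj_conv_V (h : H.IsHopfStarAlgebra) {γ : A ⊗[ℂ] A →ₗ[ℂ] ℂ}
    (hγ : H.IsUnitaryTwoCocycle γ) :
    conv (H.V γ ∘ₗ H.mulMap) (conjFun (dag H.star) (convInv γ)) =
      conv (convInv γ) (tfun (H.V γ) (H.V γ)) := by
  refine conv_inverse_eq (φ := conv (conjFun (dag H.star) γ) (H.Vbar γ ∘ₗ H.mulMap)) ?_ ?_
  · refine conv_conv_inverse (conv_comp_inverse h.isHopf.comul_mul h.isHopf.counit_mul
      (V_conv_Vbar h hγ.toIsTwoCocycle)) ?_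
    rw [← conjFun_conv (comul_dag h), hγ.isCocyclePair.inv_conv]
    exact TensorProduct.ext' fun a b => by simp [h.counit_star, mul_comm]
  · rw [conj_conv_Vbar h hγ]
    refine conv_conv_inverse ?_ hγ.isCocyclePair.conv_inv
    rw [conv_tfun, Vbar_conv_V h hγ.toIsTwoCocycle, counit_tensor]

theorem IsHopfStarAlgebra.twist (h : H.IsHopfStarAlgebra) {γ : A ⊗[ℂ] A →ₗ[ℂ] ℂ}
    (hγ : H.IsUnitaryTwoCocycle γ) : (H.twist γ).IsHopfStarAlgebra where
  mul_assoc := hγ.isCocyclePair.tmul₂_assoc h.isHopf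
  one_mul := hγ.isCocyclePair.tmul₂_one_left h.isHopf
  mul_one := hγ.isCocyclePair.tmul₂_one_right h.isHopf
  star_star a := by
    have h1 := LinearMap.congr_fun (sandwich_comp_sandwich (H.V γ) (H.Vbar γ) (H.Vbar γ) (H.V γ))
      (H.star a)
    rw [Vbar_conv_V h hγ.toIsTwoCocycle, sandwich_counit] at h1
    rw [twist_star, twist_star, sandwich_star h.comul_star, conjFun_Vbar h hγ, conjFun_V h hγ]
    exact (congrArg H.star h1).trans (h.star_star a)
  star_mul a b := by
    have h1 : ∀ z, sandwich (H.Vbar γ) (H.V γ) (H.mulMap z) =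
        H.mulMap (sandwich (H.Vbar γ ∘ₗ H.mulMap) (H.V γ ∘ₗ H.mulMap) z) :=
      LinearMap.congr_fun (sandwich_comp_of_equivariant h.isHopf.comul_mul _ _)
    have h2 : dag H.star (sandwich γ (convInv γ) (a ⊗ₜ b)) =
        sandwich (conjFun (dag H.star) γ) (conjFun (dag H.star) (convInv γ))
          (dag H.star (a ⊗ₜ b)) := by
      rw [sandwich_star (comul_dag h), conjFun_conjFun (dag_dag h.star_star),
        conjFun_conjFun (dag_dag h.star_star)]
    -- The involution has turned the twist of the product into conjugated functionals. Combined with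
    -- V̄ and V of the product, these become the twists of the two factors followed by that of their
    -- product.
    have h3 := LinearMap.congr_fun (sandwich_comp_sandwich (H.Vbar γ ∘ₗ H.mulMap)
      (conjFun (dag H.star) γ) (H.V γ ∘ₗ H.mulMap) (conjFun (dag H.star) (convInv γ)))
      (dag H.star (a ⊗ₜ b))
    rw [conj_conv_Vbar h hγ, conj_conv_V h hγ, ← sandwich_comp_sandwich, sandwich_tfun] at h3
    have h4 : (H.twist γ).mul a b = H.mulMap (sandwich γ (convInv γ) (a ⊗ₜ b)) := rfl
    rw [twist_star, h4, star_mulMap h, h1, h2]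
    exact congrArg H.mulMap h3
  comul_one := h.comul_one
  comul_mul a b := by
    have h1 := LinearMap.congr_fun (h.isHopf.comul_comp_tmul₂ hγ.isCocyclePair) (a ⊗ₜ b)
    rw [AlgData.tensor_mul_eq, twist_mulMap]
    exact h1
  counit_one := h.counit_one
  counit_mul a b := by
    have h1 := LinearMap.congr_fun (hγ.isCocyclePair.counit_tmul₂ h.isHopf) (a ⊗ₜ b)
    rw [counit_tensor, tfun_tmul] at h1
    exact h1
  antipode_left a := by
    rw [twist_mulMap]
    exact hγ.isCocyclePair.tmul₂_antipode_left h.isHopf (hγ.isCocyclePair.cU_conv_cUbar h.isHopf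
      h.antipode_antipodeInv h.antipodeInv_antipode) a
  antipode_right a := by
    rw [twist_mulMap]
    exact hγ.isCocyclePair.tmul₂_antipode_right h.isHopf (hγ.isCocyclePair.cU_conv_cUbar h.isHopf
      h.antipode_antipodeInv h.antipodeInv_antipode) a
  antipode_bijective := by
    have h1 := hγ.isCocyclePair.cU_conv_cUbar h.isHopf h.antipode_antipodeInv
      h.antipodeInv_antipode
    have h2 := hγ.isCocyclePair.cUbar_conv_cU h.isHopf
    refine h.antipode_bijective.comp (f := sandwich (H.U γ) (H.Ubar γ)) ?_
    refine Function.bijective_iff_has_inverse.2 ⟨sandwich (H.Ubar γ) (H.U γ), fun a => ?_,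
      fun a => ?_⟩
    · have h3 := LinearMap.congr_fun
        (sandwich_comp_sandwich (H.Ubar γ) (H.U γ) (H.U γ) (H.Ubar γ)) a
      rw [show conv (H.U γ) (H.Ubar γ) = Coalgebra.counit from h1, sandwich_counit] at h3
      exact h3
    · have h3 := LinearMap.congr_fun
        (sandwich_comp_sandwich (H.U γ) (H.Ubar γ) (H.Ubar γ) (H.U γ)) a
      rw [show conv (H.Ubar γ) (H.U γ) = Coalgebra.counit from h2, sandwich_counit] at h3
      exact h3
  comul_star a := by
    have h1 := LinearMap.congr_fun (comul_comp_sandwich (V_conv_Vbar h hγ.toIsTwoCocycle))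
      (H.star a)
    simp only [LinearMap.comp_apply] at h1
    rw [twist_star, h1, h.comul_star]
    exact eq_of_tmul_semilinear (f := (TensorProduct.map (sandwich (H.Vbar γ) (H.V γ))
      (sandwich (H.Vbar γ) (H.V γ))).comp (H.starTensor H.toStarAlgData))
      (g := (H.twist γ).starTensor (H.twist γ).toStarAlgData)
      (fun x y => by simp [StarAlgData.starTensor, twist_star]) _

end HopfStarData

end TwistedHopf

/-! ### Twisted products and involutions on comodules -/

section TwistedComodule

variable {A M : Type*} [AddCommGroup A] [Module ℂ A] [Coalgebra ℂ A]
  [AddCommGroup M] [Module ℂ M] {δ : M →ₗ[ℂ] A ⊗[ℂ] M} {μ : M ⊗[ℂ] M →ₗ[ℂ] M}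
  {m : A ⊗[ℂ] A →ₗ[ℂ] A} {e : A} {S : A →ₗ[ℂ] A} {γ γ' : A ⊗[ℂ] A →ₗ[ℂ] ℂ}

/-- The coaction absorbs one half of a two-sided twist of `A`. -/
theorem IsCoaction.map_sandwich_lact {C : Type*} [AddCommGroup C] [Module ℂ C] [Coalgebra ℂ C]
    {δ : M →ₗ[ℂ] C ⊗[ℂ] M} (hδ : IsCoaction δ) {φ ψ : C →ₗ[ℂ] ℂ}
    (h : conv ψ φ = Coalgebra.counit) :
    TensorProduct.map (sandwich φ ψ) (lact δ φ) ∘ₗ δ = δ ∘ₗ lact δ φ := by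
  -- φ acting on the comodule leg is read from the right end of the coalgebra leg, where it cancels
  -- ψ.
  have h1 : sandwich φ ψ ∘ₗ ract φ = clact φ := by
    rw [sandwich_eq, ← clact_comp_ract, LinearMap.comp_assoc, ract_ract, h, ract_counit,
      LinearMap.comp_id]
  rw [← LinearMap.rTensor_comp_lTensor, LinearMap.comp_assoc, ← hδ.rTensor_ract,
    ← LinearMap.comp_assoc, ← LinearMap.rTensor_comp, h1, hδ.comp_lact]

/-- A twisted product is equivariant for the twisted product of `A`. -/
theorem IsCocyclePair.coaction_twist (hγ : IsCocyclePair m e γ γ') (hδ : IsCoaction δ)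
    (hμ : δ ∘ₗ μ = TensorProduct.map m μ ∘ₗ tcoact δ δ) :
    δ ∘ₗ μ ∘ₗ lact (tcoact δ δ) γ =
      TensorProduct.map (tmul₂ m γ γ') (μ ∘ₗ lact (tcoact δ δ) γ) ∘ₗ tcoact δ δ := by
  rw [← LinearMap.comp_assoc, hμ, LinearMap.comp_assoc,
    ← (hδ.tcoact hδ).map_sandwich_lact hγ.inv_conv, ← LinearMap.comp_assoc,
    ← TensorProduct.map_comp, tmul₂]

theorem IsCoaction.rTensor_lact {C N : Type*} [AddCommGroup C] [Module ℂ C] [AddCommGroup N]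
    [Module ℂ N] {δ' : N →ₗ[ℂ] C ⊗[ℂ] N} (hδ : IsCoaction δ) (φ : C →ₗ[ℂ] ℂ) :
    (lact δ' φ).rTensor M = lact (CocycleTwist.tcoact δ' δ) (tfun φ Coalgebra.counit) := by
  rw [lact_tcoact_tfun, hδ.lact_counit, LinearMap.rTensor_def]

theorem IsCoaction.lTensor_lact {C N : Type*} [AddCommGroup C] [Module ℂ C] [AddCommGroup N]
    [Module ℂ N] {δ' : N →ₗ[ℂ] C ⊗[ℂ] N} (hδ : IsCoaction δ) (φ : C →ₗ[ℂ] ℂ) :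
    (lact δ' φ).lTensor M = lact (CocycleTwist.tcoact δ δ') (tfun Coalgebra.counit φ) := by
  rw [lact_tcoact_tfun, hδ.lact_counit, LinearMap.lTensor_def]

/-- A twisted product is associative. -/
theorem IsCocyclePair.twist_assoc (hγ : IsCocyclePair m e γ γ') (hδ : IsCoaction δ)
    (hμ : δ ∘ₗ μ = TensorProduct.map m μ ∘ₗ tcoact δ δ)
    (h : ∀ a b c, μ (μ (a ⊗ₜ b) ⊗ₜ c) = μ (a ⊗ₜ μ (b ⊗ₜ c))) (a b c : M) :
    (μ ∘ₗ lact (tcoact δ δ) γ) ((μ ∘ₗ lact (tcoact δ δ) γ) (a ⊗ₜ b) ⊗ₜ c) =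
      (μ ∘ₗ lact (tcoact δ δ) γ) (a ⊗ₜ (μ ∘ₗ lact (tcoact δ δ) γ) (b ⊗ₜ c)) := by
  -- Each bracketing is the untwisted threefold product after the action of a single functional; the
  -- cocycle identity equates the two functionals.
  have h1 : (μ ∘ₗ lact (tcoact δ δ) γ) ∘ₗ (μ ∘ₗ lact (tcoact δ δ) γ).rTensor M =
      (μ ∘ₗ μ.rTensor M) ∘ₗ lact (tcoact (tcoact δ δ) δ)
        (conv (tfun γ Coalgebra.counit) (γ ∘ₗ m.rTensor A)) := by
    rw [← ((hδ.tcoact hδ).tcoact hδ).lact_lact, LinearMap.rTensor_comp, LinearMap.comp_assoc,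
      ← LinearMap.comp_assoc ((lact (tcoact δ δ) γ).rTensor M),
      lact_comp_of_equivariant (tcoact_comp_rTensor δ hμ), hδ.rTensor_lact, LinearMap.comp_assoc,
      LinearMap.comp_assoc]
  have h2 : (μ ∘ₗ lact (tcoact δ δ) γ) ∘ₗ (μ ∘ₗ lact (tcoact δ δ) γ).lTensor M =
      (μ ∘ₗ μ.lTensor M) ∘ₗ lact (tcoact δ (tcoact δ δ))
        (conv (tfun Coalgebra.counit γ) (γ ∘ₗ m.lTensor A)) := by
    rw [← (hδ.tcoact (hδ.tcoact hδ)).lact_lact, LinearMap.lTensor_comp, LinearMap.comp_assoc,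
      ← LinearMap.comp_assoc ((lact (tcoact δ δ) γ).lTensor M),
      lact_comp_of_equivariant (tcoact_comp_lTensor δ hμ), hδ.lTensor_lact, LinearMap.comp_assoc,
      LinearMap.comp_assoc]
  rw [hγ.cocycle] at h1
  have h3 := LinearMap.congr_fun (lact_comp_of_equivariant (tcoact_comp_assoc δ δ δ)
    (conv (tfun Coalgebra.counit γ) (γ ∘ₗ m.lTensor A))) ((a ⊗ₜ b) ⊗ₜ c)
  have h4 : μ ∘ₗ μ.rTensor M = (μ ∘ₗ μ.lTensor M) ∘ₗ
      (TensorProduct.assoc ℂ M M M).toLinearMap :=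
    TensorProduct.ext_threefold fun a b c => by simp [h]
  refine (LinearMap.congr_fun h1 ((a ⊗ₜ b) ⊗ₜ c)).trans
    (Eq.trans ?_ (LinearMap.congr_fun h2 (a ⊗ₜ (b ⊗ₜ c))).symm)
  rw [h4]
  exact congrArg (μ ∘ₗ μ.lTensor M) h3.symm

theorem lact_tcoact_coinvariant_left {u : M} (hδ : IsCoaction δ)
    (hu : δ u = e ⊗ₜ u) (hγ : ∀ a, γ (e ⊗ₜ a) = Coalgebra.counit a) (x : M) :
    lact (tcoact δ δ) γ (u ⊗ₜ x) = u ⊗ₜ x := by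
  have h1 : lact (tcoact δ δ) γ (u ⊗ₜ x) = u ⊗ₜ lact δ Coalgebra.counit x := by
    rw [lact, LinearMap.comp_apply, tcoact_tmul, hu]
    exact eq_of_tmul (f := evalLeft γ ∘ₗ
      (TensorProduct.tensorTensorTensorComm ℂ A M A M).toLinearMap ∘ₗ
      TensorProduct.mk ℂ _ _ (e ⊗ₜ u)) (g := TensorProduct.mk ℂ M M u ∘ₗ
        evalLeft (Coalgebra.counit (R := ℂ) (A := A))) (fun a y => by simp [hγ]) _
  rw [h1, hδ.lact_counit, LinearMap.id_apply]

theorem lact_tcoact_coinvariant_right {u : M} (hδ : IsCoaction δ)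
    (hu : δ u = e ⊗ₜ u) (hγ : ∀ a, γ (a ⊗ₜ e) = Coalgebra.counit a) (x : M) :
    lact (tcoact δ δ) γ (x ⊗ₜ u) = x ⊗ₜ u := by
  have h1 : lact (tcoact δ δ) γ (x ⊗ₜ u) = lact δ Coalgebra.counit x ⊗ₜ u := by
    rw [lact, LinearMap.comp_apply, tcoact_tmul, hu]
    exact eq_of_tmul (f := evalLeft γ ∘ₗ
      (TensorProduct.tensorTensorTensorComm ℂ A M A M).toLinearMap ∘ₗ
      (TensorProduct.mk ℂ _ _).flip (e ⊗ₜ u)) (g := (TensorProduct.mk ℂ M M).flip u ∘ₗ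
        evalLeft (Coalgebra.counit (R := ℂ) (A := A)))
        (fun a y => by simp [hγ, TensorProduct.smul_tmul']) _
  rw [h1, hδ.lact_counit, LinearMap.id_apply]

/-- A twisted involution is involutive. -/
theorem lact_star_lact_star {C : Type*} [AddCommGroup C] [Module ℂ C] [Coalgebra ℂ C]
    {δ : M →ₗ[ℂ] C ⊗[ℂ] M} {t : C →ₗ⋆[ℂ] C} {s : M →ₗ⋆[ℂ] M} (hδ : IsCoaction δ)
    (hs : ∀ x, δ (s x) = TensorProduct.map t s (δ x)) (hss : ∀ x, s (s x) = x)
    {φ : C →ₗ[ℂ] ℂ} (h : conv φ (conjFun t φ) = Coalgebra.counit) (x : M) :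
    lact δ φ (s (lact δ φ (s x))) = x := by
  have h1 := LinearMap.congr_fun (hδ.lact_lact (conjFun t φ) φ) (s x)
  rw [h, hδ.lact_counit] at h1
  rw [lact_star hs]
  exact (congrArg s h1).trans (hss x)

/-- Compatibility of a twisted product and a twisted involution, from the compatibility `hz` of the
given ones. -/
theorem lact_star_twist {t : A →ₗ⋆[ℂ] A} {s : M →ₗ⋆[ℂ] M} (hδ : IsCoaction δ)
    (hμ : δ ∘ₗ μ = TensorProduct.map m μ ∘ₗ tcoact δ δ)
    (hs : ∀ x, δ (s x) = TensorProduct.map t s (δ x)) (htt : ∀ a, t (t a) = a) {φ : A →ₗ[ℂ] ℂ}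
    (hφ : conv (conjFun (dag t) γ) (φ ∘ₗ m) = conv (tfun φ φ) γ) {c : ℂ} {x y : M}
    (hz : s (μ (lact (tcoact δ δ) γ (x ⊗ₜ y))) =
      c • μ (dag s (lact (tcoact δ δ) γ (x ⊗ₜ y)))) :
    lact δ φ (s (μ (lact (tcoact δ δ) γ (x ⊗ₜ y)))) =
      c • μ (lact (tcoact δ δ) γ (lact δ φ (s y) ⊗ₜ lact δ φ (s x))) := by
  have h1 := LinearMap.congr_fun (lact_comp_of_equivariant hμ φ)
  -- The flipped involution conjugates γ. Equivariance of μ then brings in φ ∘ m, and `hφ` trades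
  -- the pair for φ ⊗ φ followed by γ.
  have h2 : dag s (lact (tcoact δ δ) γ (x ⊗ₜ y)) =
      lact (tcoact δ δ) (conjFun (dag t) γ) (s y ⊗ₜ s x) := by
    have h3 := lact_star (tcoact_dag hs) (conjFun (dag t) γ) (x ⊗ₜ[ℂ] y)
    rw [conjFun_conjFun (dag_dag htt), dag_tmul] at h3
    exact h3.symm
  have h4 := LinearMap.congr_fun ((hδ.tcoact hδ).lact_lact (φ ∘ₗ m) (conjFun (dag t) γ))
    (s y ⊗ₜ s x)
  rw [hφ, ← (hδ.tcoact hδ).lact_lact, lact_tcoact_tfun] at h4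
  rw [hz, map_smul, h2]
  exact congrArg (c • ·) ((h1 _).trans (congrArg μ h4))

end TwistedComodule

/-! ### Stability of subcomodules under twisting -/

section Subcomodules

variable {A M N P : Type*} [AddCommGroup A] [Module ℂ A]
  [AddCommGroup M] [Module ℂ M] [AddCommGroup N] [Module ℂ N] [AddCommGroup P] [Module ℂ P]

theorem tmul_mem_range_lTensor_subtype {Q : Submodule ℂ M} (a : A) {x : M} (hx : x ∈ Q) :
    a ⊗ₜ[ℂ] x ∈ LinearMap.range (Q.subtype.lTensor A) :=
  ⟨a ⊗ₜ ⟨x, hx⟩, rfl⟩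

theorem range_lTensor_subtype_mono {Q R : Submodule ℂ M} (h : Q ≤ R) :
    LinearMap.range (Q.subtype.lTensor A) ≤ LinearMap.range (R.subtype.lTensor A) := by
  rintro _ ⟨t, rfl⟩
  exact ⟨(Submodule.inclusion h).lTensor A t, by
    rw [← LinearMap.lTensor_comp_apply, Submodule.subtype_comp_inclusion]⟩

variable {δ : M →ₗ[ℂ] A ⊗[ℂ] M} {δ' : N →ₗ[ℂ] A ⊗[ℂ] N}

theorem IsSubcomodule.lact_mem {Q : Submodule ℂ M} (hQ : IsSubcomodule δ Q) (φ : A →ₗ[ℂ] ℂ)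
    {x : M} (hx : x ∈ Q) : lact δ φ x ∈ Q := by
  obtain ⟨t, ht⟩ := hQ x hx
  rw [lact, LinearMap.comp_apply, ← ht]
  have h : evalLeft φ (Q.subtype.lTensor A t) = Q.subtype (evalLeft φ t) :=
    eq_of_tmul (f := evalLeft φ ∘ₗ Q.subtype.lTensor A) (g := Q.subtype ∘ₗ evalLeft φ)
      (fun a y => by simp) t
  rw [h]
  exact Subtype.coe_prop _

/-- Twisting does not leave Q ⊗ R; hence degrees, and signs depending on them, are unaffected. -/
theorem IsSubcomodule.lact_tcoact_mem {Q : Submodule ℂ M} {R : Submodule ℂ N}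
    (hQ : IsSubcomodule δ Q) (hR : IsSubcomodule δ' R) (γ : A ⊗[ℂ] A →ₗ[ℂ] ℂ) {x : M} {y : N}
    (hx : x ∈ Q) (hy : y ∈ R) :
    lact (tcoact δ δ') γ (x ⊗ₜ y) ∈ LinearMap.range (TensorProduct.map Q.subtype R.subtype) := by
  obtain ⟨s, hs⟩ := hQ x hx
  obtain ⟨t, ht⟩ := hR y hy
  rw [lact, LinearMap.comp_apply, tcoact_tmul, ← hs, ← ht]
  refine ⟨evalLeft γ (TensorProduct.tensorTensorTensorComm ℂ A Q A R (s ⊗ₜ t)), ?_⟩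
  refine LinearMap.congr_fun (f := TensorProduct.map Q.subtype R.subtype ∘ₗ evalLeft γ ∘ₗ
    (TensorProduct.tensorTensorTensorComm ℂ A Q A R).toLinearMap) (g := evalLeft γ ∘ₗ
    (TensorProduct.tensorTensorTensorComm ℂ A M A N).toLinearMap ∘ₗ
    TensorProduct.map (Q.subtype.lTensor A) (R.subtype.lTensor A)) ?_ (s ⊗ₜ t)
  exact TensorProduct.ext_fourfold' fun a b c d => by simp

/-- Additive identities which hold on `Q ⊗ R` hold on twists of its elements. -/
theorem IsSubcomodule.lact_tcoact_induction {Q : Submodule ℂ M} {R : Submodule ℂ N}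
    (hQ : IsSubcomodule δ Q) (hR : IsSubcomodule δ' R) (γ : A ⊗[ℂ] A →ₗ[ℂ] ℂ)
    {p : M ⊗[ℂ] N → Prop} (zero : p 0) (add : ∀ s t, p s → p t → p (s + t))
    (tmul : ∀ x ∈ Q, ∀ y ∈ R, p (x ⊗ₜ y)) {x : M} {y : N} (hx : x ∈ Q) (hy : y ∈ R) :
    p (lact (tcoact δ δ') γ (x ⊗ₜ y)) := by
  obtain ⟨t, ht⟩ := hQ.lact_tcoact_mem hR γ hx hy
  rw [← ht]
  clear ht
  induction t with
  | zero => simpa using zero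
  | add s t hs ht => rw [map_add]; exact add _ _ hs ht
  | tmul x y => exact tmul x x.2 y y.2

theorem isSubcomodule_sSup {s : Set (Submodule ℂ M)} (hs : ∀ Q ∈ s, IsSubcomodule δ Q) :
    IsSubcomodule δ (sSup s) := by
  have h : sSup s ≤ (LinearMap.range ((sSup s).subtype.lTensor A)).comap δ :=
    sSup_le fun Q hQ x hx => range_lTensor_subtype_mono (le_sSup hQ) (hs Q hQ x hx)
  exact h

theorem isSubcomodule_top : IsSubcomodule δ ⊤ := fun x _ => by
  rw [LinearMap.range_eq_top.2 (LinearMap.lTensor_surjective A fun y => ⟨⟨y, trivial⟩, rfl⟩)]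
  trivial

theorem isSubcomodule_range {f : N →ₗ[ℂ] M} (h : ∀ x, δ (f x) = f.lTensor A (δ' x)) :
    IsSubcomodule δ (LinearMap.range f) := by
  rintro _ ⟨x, rfl⟩
  refine ⟨f.rangeRestrict.lTensor A (δ' x), ?_⟩
  rw [← LinearMap.lTensor_comp_apply, h]
  rfl

/-- The product of two subcomodules is a subcomodule. -/
theorem isSubcomodule_range_mul {m : A ⊗[ℂ] A →ₗ[ℂ] A} {μ : M ⊗[ℂ] N →ₗ[ℂ] P}
    {δ'' : P →ₗ[ℂ] A ⊗[ℂ] P} (hμ : δ'' ∘ₗ μ = TensorProduct.map m μ ∘ₗ tcoact δ δ')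
    {Q : Submodule ℂ M} {R : Submodule ℂ N} (hQ : IsSubcomodule δ Q) (hR : IsSubcomodule δ' R) :
    IsSubcomodule δ'' (LinearMap.range (μ ∘ₗ TensorProduct.map Q.subtype R.subtype)) := by
  rintro _ ⟨z, rfl⟩
  have h := LinearMap.congr_fun hμ (TensorProduct.map Q.subtype R.subtype z)
  simp only [LinearMap.comp_apply] at h ⊢
  rw [h]
  clear h
  induction z with
  | zero => simp
  | add z z' hz hz' => simp only [map_add]; exact Submodule.add_mem _ hz hz'
  | tmul x y =>
    obtain ⟨s, hs⟩ := hQ x x.2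
    obtain ⟨t, ht⟩ := hR y y.2
    rw [TensorProduct.map_tmul, Submodule.subtype_apply, Submodule.subtype_apply, tcoact_tmul,
      ← hs, ← ht]
    clear hs ht
    induction s with
    | zero => simp
    | add s s' hs hs' =>
      simp only [TensorProduct.add_tmul, map_add]; exact Submodule.add_mem _ hs hs'
    | tmul a p =>
      induction t with
      | zero => simp
      | add t t' ht ht' =>
        simp only [TensorProduct.tmul_add, map_add]; exact Submodule.add_mem _ ht ht'
      | tmul b q =>
        simp only [LinearMap.lTensor_tmul, TensorProduct.tensorTensorTensorComm_tmul,
          TensorProduct.map_tmul]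
        exact tmul_mem_range_lTensor_subtype _ ⟨p ⊗ₜ q, rfl⟩

end Subcomodules

/-! ### Twisted comodule ∗-algebras -/

section TwistedStarAlgebras

variable {A M : Type*} [AddCommGroup A] [Module ℂ A] [Coalgebra ℂ A]
  [AddCommGroup M] [Module ℂ M] {H : HopfStarData A} {m : StarAlgData M}
  {δ : M →ₗ[ℂ] A ⊗[ℂ] M} {γ : A ⊗[ℂ] A →ₗ[ℂ] ℂ}

theorem IsComoduleAlgebra.equivariant (hC : IsComoduleAlgebra H.toAlgData m.toAlgData δ) :
    δ ∘ₗ m.mulMap = TensorProduct.map H.mulMap m.mulMap ∘ₗ tcoact δ δ :=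
  TensorProduct.ext' fun x y => by
    rw [LinearMap.comp_apply, AlgData.mulMap_tmul, hC.coaction_mul, AlgData.tensor_mul_eq]; rfl

namespace StarAlgData

theorem twist_mulMap (m : StarAlgData M) (H : HopfStarData A) (γ : A ⊗[ℂ] A →ₗ[ℂ] ℂ)
    (δ : M →ₗ[ℂ] A ⊗[ℂ] M) :
    (m.twist H γ δ).mulMap = m.mulMap ∘ₗ lact (tcoact δ δ) γ :=
  TensorProduct.ext' fun _ _ => rfl

theorem twist_mul (m : StarAlgData M) (H : HopfStarData A) (γ : A ⊗[ℂ] A →ₗ[ℂ] ℂ)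
    (δ : M →ₗ[ℂ] A ⊗[ℂ] M) (x y : M) :
    (m.twist H γ δ).mul x y = m.mulMap (lact (tcoact δ δ) γ (x ⊗ₜ y)) := rfl

theorem twist_star (hs : ∀ x, δ (m.star x) = H.starTensor m (δ x)) (x : M) :
    (m.twist H γ δ).star x = lact δ (H.Vbar γ) (m.star x) :=
  congrArg (evalLeft (H.Vbar γ)) (hs x).symm

theorem twist_isAlgebra (hA : m.IsAlgebra) (hC : IsComoduleAlgebra H.toAlgData m.toAlgData δ)
    (hγ : H.IsUnitaryTwoCocycle γ) : (m.twist H γ δ).IsAlgebra where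
  mul_assoc := hγ.isCocyclePair.twist_assoc hC.toIsCoaction hC.equivariant
    fun a b c => by simpa [AlgData.mulMap_tmul] using hA.mul_assoc a b c
  one_mul a := by
    rw [twist_mul, show (m.twist H γ δ).one = m.one from rfl,
      lact_tcoact_coinvariant_left hC.toIsCoaction hC.coaction_one hγ.map_one_left,
      AlgData.mulMap_tmul, hA.one_mul]
  mul_one a := by
    rw [twist_mul, show (m.twist H γ δ).one = m.one from rfl,
      lact_tcoact_coinvariant_right hC.toIsCoaction hC.coaction_one hγ.map_one_right,
      AlgData.mulMap_tmul, hA.mul_one]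

theorem twist_isComoduleAlgebra (hC : IsComoduleAlgebra H.toAlgData m.toAlgData δ)
    (hγ : H.IsUnitaryTwoCocycle γ) :
    IsComoduleAlgebra (H.twist γ).toAlgData (m.twist H γ δ).toAlgData δ where
  toIsCoaction := hC.toIsCoaction
  coaction_one := hC.coaction_one
  coaction_mul a b := by
    rw [AlgData.tensor_mul_eq, HopfStarData.twist_mulMap, twist_mulMap]
    exact LinearMap.congr_fun (hγ.isCocyclePair.coaction_twist hC.toIsCoaction hC.equivariant)
      (a ⊗ₜ b)

theorem twist_star_star (hδ : IsCoaction δ) (hs : ∀ x, δ (m.star x) = H.starTensor m (δ x))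
    (hss : ∀ x, m.star (m.star x) = x) (h : H.IsHopfStarAlgebra)
    (hγ : H.IsUnitaryTwoCocycle γ) (x : M) :
    (m.twist H γ δ).star ((m.twist H γ δ).star x) = x := by
  rw [twist_star hs, twist_star hs]
  refine lact_star_lact_star hδ hs hss ?_ x
  rw [HopfStarData.conjFun_Vbar h hγ, HopfStarData.Vbar_conv_V h hγ.toIsTwoCocycle]

theorem twist_coaction_star (hδ : IsCoaction δ) (hs : ∀ x, δ (m.star x) = H.starTensor m (δ x))
    (h : H.IsHopfStarAlgebra) (hγ : H.IsUnitaryTwoCocycle γ) (x : M) :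
    δ ((m.twist H γ δ).star x) =
      (H.twist γ).starTensor (m.twist H γ δ) (δ x) := by
  have h1 := LinearMap.congr_fun
    (hδ.map_sandwich_lact (HopfStarData.V_conv_Vbar h hγ.toIsTwoCocycle)) (m.star x)
  simp only [LinearMap.comp_apply] at h1
  rw [twist_star hs, ← h1, hs]
  exact eq_of_tmul_semilinear (f := (TensorProduct.map (sandwich (H.Vbar γ) (H.V γ))
    (lact δ (H.Vbar γ))).comp (H.starTensor m))
    (g := (H.twist γ).starTensor (m.twist H γ δ))
    (fun a y => by simp [StarAlgData.starTensor, HopfStarData.twist_star, twist_star hs]) _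

/-- The product law of a twisted involution on the product of two subcomodules, for a graded or
ungraded `∗`-algebra. -/
theorem twist_star_mul (hC : IsComoduleAlgebra H.toAlgData m.toAlgData δ)
    (hs : ∀ x, δ (m.star x) = H.starTensor m (δ x)) (h : H.IsHopfStarAlgebra)
    (hγ : H.IsUnitaryTwoCocycle γ) {Q R : Submodule ℂ M} (hQ : IsSubcomodule δ Q)
    (hR : IsSubcomodule δ R) {c : ℂ}
    (hc : ∀ x ∈ Q, ∀ y ∈ R, m.star (m.mul x y) = c • m.mul (m.star y) (m.star x))
    {x y : M} (hx : x ∈ Q) (hy : y ∈ R) :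
    (m.twist H γ δ).star ((m.twist H γ δ).mul x y) =
      c • (m.twist H γ δ).mul ((m.twist H γ δ).star y) ((m.twist H γ δ).star x) := by
  simp only [twist_star hs, twist_mul]
  refine lact_star_twist hC.toIsCoaction hC.equivariant hs h.star_star
    (HopfStarData.conj_conv_Vbar h hγ) ?_
  refine hQ.lact_tcoact_induction hR γ (p := fun z => m.star (m.mulMap z) =
    c • m.mulMap (dag m.star z)) (by simp) (fun s t hs ht => ?_) (fun x hx y hy => ?_) hx hy
  · simp only [map_add, smul_add, hs, ht]
  · simpa [AlgData.mulMap_tmul] using hc x hx y hy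

/-- The twisted product maps the product of two subcomodules into any subspace containing their
products. -/
theorem twist_mul_mem {Q R T : Submodule ℂ M} (hQ : IsSubcomodule δ Q)
    (hR : IsSubcomodule δ R) (hT : ∀ x ∈ Q, ∀ y ∈ R, m.mul x y ∈ T) {x y : M} (hx : x ∈ Q)
    (hy : y ∈ R) : (m.twist H γ δ).mul x y ∈ T := by
  rw [twist_mul]
  exact hQ.lact_tcoact_induction hR γ (p := fun z => m.mulMap z ∈ T) (by simp)
    (fun s t hs ht => by simp only [map_add]; exact T.add_mem hs ht)
    (fun x hx y hy => by simpa [AlgData.mulMap_tmul] using hT x hx y hy) hx hy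

end StarAlgData

end TwistedStarAlgebras

/-! ### Twisted calculi and complex structures -/

section TwistedCalculi

variable {A B Ω : Type*} [AddCommGroup A] [Module ℂ A] [Coalgebra ℂ A]
  [AddCommGroup B] [Module ℂ B] [AddCommGroup Ω] [Module ℂ Ω] {H : HopfStarData A}
  {γ : A ⊗[ℂ] A →ₗ[ℂ] ℂ}

/-- A subspace closed under a twisted product contains a subspace which is closed under the given
product and contains all its subcomodules. -/
theorem exists_subalgebra_le {m : StarAlgData Ω} {δ : Ω →ₗ[ℂ] A ⊗[ℂ] Ω}
    (hC : IsComoduleAlgebra H.toAlgData m.toAlgData δ) {γ' : A ⊗[ℂ] A →ₗ[ℂ] ℂ}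
    (hγ : conv γ' γ = Coalgebra.counit) {W : Submodule ℂ Ω}
    (hW : ∀ x ∈ W, ∀ y ∈ W, (m.twist H γ δ).mul x y ∈ W) :
    ∃ W' ≤ W, (∀ x ∈ W', ∀ y ∈ W', m.mul x y ∈ W') ∧
      ∀ Q ≤ W, IsSubcomodule δ Q → Q ≤ W' := by
  -- The largest subcomodule inside `W`. Unlike `W` it is stable under the operators that undo the
  -- twist.
  let W' : Submodule ℂ Ω := sSup {Q | IsSubcomodule δ Q ∧ Q ≤ W}
  have hW' : W' ≤ W := sSup_le fun Q hQ => hQ.2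
  have hsub : IsSubcomodule δ W' := isSubcomodule_sSup fun Q hQ => hQ.1
  have hle : ∀ Q ≤ W, IsSubcomodule δ Q → Q ≤ W' := fun Q h1 h2 => le_sSup ⟨h2, h1⟩
  refine ⟨W', hW', fun x hx y hy => ?_, hle⟩
  have h1 : LinearMap.range (m.mulMap ∘ₗ TensorProduct.map W'.subtype W'.subtype) ≤ W' := by
    refine hle _ ?_ (isSubcomodule_range_mul hC.equivariant hsub hsub)
    rw [LinearMap.range_le_iff_comap, eq_top_iff]
    intro z _
    induction z with
    | zero => exact Submodule.zero_mem _
    | add z z' hz hz' => exact Submodule.add_mem _ (hz trivial) (hz' trivial)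
    | tmul x y =>
      -- An untwisted product is a sum of twisted products of elements of `W'`, obtained by
      -- untwisting with γ' first, so it lies in `W`. The span of such products is a subcomodule and
      -- hence lies in `W'`.
      have h2 : lact (tcoact δ δ) γ (lact (tcoact δ δ) γ' (x.1 ⊗ₜ y.1)) = x.1 ⊗ₜ y.1 := by
        have h3 := LinearMap.congr_fun
          ((hC.toIsCoaction.tcoact hC.toIsCoaction).lact_lact γ γ') (x.1 ⊗ₜ y.1)
        rwa [hγ, (hC.toIsCoaction.tcoact hC.toIsCoaction).lact_counit] at h3
      have h4 : ∀ z ∈ LinearMap.range (TensorProduct.map W'.subtype W'.subtype),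
          m.mulMap (lact (tcoact δ δ) γ z) ∈ W := by
        rintro _ ⟨z, rfl⟩
        induction z with
        | zero => simp
        | add z z' hz hz' => simp only [map_add]; exact W.add_mem hz hz'
        | tmul x y => exact hW x (hW' x.2) y (hW' y.2)
      have h5 := h4 _ (hsub.lact_tcoact_mem hsub γ' x.2 y.2)
      rw [h2] at h5
      exact h5
  exact h1 ⟨⟨x, hx⟩ ⊗ₜ ⟨y, hy⟩, by simp [AlgData.mulMap_tmul]⟩

namespace CalculusData

variable {X : CalculusData A B Ω}

theorem IsComoduleStarBase.twist (hX : X.IsComoduleStarBase H) (h : H.IsHopfStarAlgebra)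
    (hγ : H.IsUnitaryTwoCocycle γ) : (X.twist H γ).IsComoduleStarBase (H.twist γ) where
  toIsAlgebra := StarAlgData.twist_isAlgebra hX.toIsAlgebra hX.toIsComoduleAlgebra hγ
  toIsComoduleAlgebra := StarAlgData.twist_isComoduleAlgebra hX.toIsComoduleAlgebra hγ
  star_star := StarAlgData.twist_star_star hX.toIsCoaction hX.coaction_star hX.star_star h hγ
  star_mul a b := by
    have h1 := StarAlgData.twist_star_mul hX.toIsComoduleAlgebra hX.coaction_star h hγ
      isSubcomodule_top isSubcomodule_top (c := 1)
      (fun x _ y _ => by rw [one_smul, hX.star_mul]) (x := a) (y := b) trivial trivial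
    rwa [one_smul] at h1
  coaction_star := StarAlgData.twist_coaction_star hX.toIsCoaction hX.coaction_star h hγ

namespace IsCovariantStarCalculus

theorem d_comp_lact (hX : X.IsCovariantStarCalculus H)
    (φ : A →ₗ[ℂ] ℂ) : lact X.coaction φ ∘ₗ X.d = X.d ∘ₗ lact X.coaction φ :=
  lact_comp_of_equivariant (g := LinearMap.id) (LinearMap.ext hX.coaction_d) φ

theorem incl_comp_lact (hX : X.IsCovariantStarCalculus H)
    (φ : A →ₗ[ℂ] ℂ) :
    lact X.coaction φ ∘ₗ X.incl = X.incl ∘ₗ lact X.baseCoaction φ :=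
  lact_comp_of_equivariant (g := LinearMap.id) (LinearMap.ext hX.coaction_incl) φ

theorem twist_star (hX : X.IsCovariantStarCalculus H)
    (ω : Ω) :
    (X.twist H γ).forms.star ω = lact X.coaction (H.Vbar γ) (X.forms.star ω) :=
  StarAlgData.twist_star hX.coaction_star ω

theorem twist_isCalculus (hX : X.IsCovariantStarCalculus H)
    (hγ : H.IsUnitaryTwoCocycle γ) : (X.twist H γ).IsCalculus where
  toIsAlgebra := StarAlgData.twist_isAlgebra hX.toIsAlgebra hX.isComoduleAlgebra hγ
  internal := hX.internal
  one_mem := hX.one_mem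
  mul_mem k l ω hω η hη := StarAlgData.twist_mul_mem (hX.grade_subcomodule k)
    (hX.grade_subcomodule l) (hX.mul_mem k l) hω hη
  incl_injective := hX.incl_injective
  range_incl := hX.range_incl
  incl_one := hX.incl_one
  incl_mul a b := by
    have h1 : tcoact X.coaction X.coaction ∘ₗ TensorProduct.map X.incl X.incl =
        TensorProduct.map LinearMap.id (TensorProduct.map X.incl X.incl) ∘ₗ
          tcoact X.baseCoaction X.baseCoaction := by
      rw [← TensorProduct.map_id]
      exact tcoact_comp_map (LinearMap.ext hX.coaction_incl) (LinearMap.ext hX.coaction_incl)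
    have h2 : X.incl ∘ₗ X.base.mulMap = X.forms.mulMap ∘ₗ TensorProduct.map X.incl X.incl :=
      TensorProduct.ext' fun a b => by simp [AlgData.mulMap_tmul, hX.incl_mul]
    exact (LinearMap.congr_fun h2 _).trans (congrArg X.forms.mulMap
      (LinearMap.congr_fun (lact_comp_of_equivariant h1 γ) (a ⊗ₜ b)).symm)
  d_mem := hX.d_mem
  d_d := hX.d_d
  leibniz k ω hω η := by
    -- Colinearity of d lets d ⊗ 1 and 1 ⊗ d commute with the twist; the first factor stays in
    -- degree k, so the sign is constant.
    have h1 := LinearMap.congr_fun (lact_comp_of_equivariant (tcoact_comp_rTensor X.coaction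
      (g := LinearMap.id) (LinearMap.ext hX.coaction_d)) γ) (ω ⊗ₜ η)
    have h2 := LinearMap.congr_fun (lact_comp_of_equivariant (tcoact_comp_lTensor X.coaction
      (g := LinearMap.id) (LinearMap.ext hX.coaction_d)) γ) (ω ⊗ₜ η)
    simp only [LinearMap.comp_apply, LinearMap.rTensor_tmul, LinearMap.lTensor_tmul,
      LinearMap.rTensor_id, LinearMap.lTensor_id, LinearMap.comp_id] at h1 h2
    have h3 : ∀ x y, (X.twist H γ).forms.mul x y =
        X.forms.mulMap (lact (tcoact X.coaction X.coaction) γ (x ⊗ₜ y)) := fun _ _ => rfl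
    rw [h3, h3, h3]
    change X.d (X.forms.mulMap (lact _ γ (ω ⊗ₜ η))) = X.forms.mulMap (lact _ γ (X.d ω ⊗ₜ η)) +
      (-1 : ℂ) ^ k • X.forms.mulMap (lact _ γ (ω ⊗ₜ X.d η))
    rw [h1, h2]
    refine (hX.grade_subcomodule k).lact_tcoact_induction isSubcomodule_top γ
      (p := fun z => X.d (X.forms.mulMap z) = X.forms.mulMap (X.d.rTensor Ω z) +
        (-1 : ℂ) ^ k • X.forms.mulMap (X.d.lTensor Ω z)) (by simp) (fun s t hs ht => ?_)
        (fun x hx y _ => ?_) hω (y := η) trivial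
    · simp only [map_add, smul_add, hs, ht]
      abel
    · simpa [AlgData.mulMap_tmul] using hX.leibniz k x hx y
  generated W h1 h2 h3 h4 := by
    -- `W` need not be a subcomodule, but B and dB are; they lie in `W'`, to which generation of the
    -- untwisted calculus applies.
    obtain ⟨W', hle, hmul, hW'⟩ :=
      exists_subalgebra_le hX.isComoduleAlgebra hγ.isCocyclePair.inv_conv h2
    have h5 : LinearMap.range X.incl ≤ W' := by
      refine hW' _ ?_ (isSubcomodule_range hX.coaction_incl)
      rintro _ ⟨b, rfl⟩
      exact h3 b
    have h6 : LinearMap.range (X.d ∘ₗ X.incl) ≤ W' := by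
      refine hW' _ ?_ (isSubcomodule_range (δ' := X.baseCoaction) fun b => ?_)
      · rintro _ ⟨b, rfl⟩
        exact h4 b
      · rw [LinearMap.lTensor_comp_apply, ← hX.coaction_incl, ← hX.coaction_d]; rfl
    have h7 : W' = ⊤ := hX.generated W' (h5 ⟨X.base.one, hX.incl_one⟩) hmul
      (fun b => h5 ⟨b, rfl⟩) (fun b => h6 ⟨b, rfl⟩)
    exact eq_top_iff.2 (h7 ▸ hle)

theorem twist (hX : X.IsCovariantStarCalculus H)
    (h : H.IsHopfStarAlgebra) (hγ : H.IsUnitaryTwoCocycle γ) :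
    (X.twist H γ).IsCovariantStarCalculus (H.twist γ) where
  toIsCalculus := hX.twist_isCalculus hγ
  base_isComoduleStar := hX.base_isComoduleStar.twist h hγ
  isComoduleAlgebra := StarAlgData.twist_isComoduleAlgebra hX.isComoduleAlgebra hγ
  coaction_incl := hX.coaction_incl
  grade_subcomodule := hX.grade_subcomodule
  coaction_d := hX.coaction_d
  star_star := StarAlgData.twist_star_star hX.isComoduleAlgebra.toIsCoaction hX.coaction_star
    hX.star_star h hγ
  star_incl b := by
    have h1 := StarAlgData.twist_star (γ := γ) hX.base_isComoduleStar.coaction_star b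
    rw [hX.twist_star]
    refine Eq.trans ?_ (congrArg X.incl h1.symm)
    change lact X.coaction (H.Vbar γ) (X.forms.star (X.incl b)) = _
    rw [hX.star_incl]
    exact LinearMap.congr_fun (hX.incl_comp_lact (H.Vbar γ)) (X.base.star b)
  star_mem k ω hω := by
    rw [hX.twist_star]
    exact (hX.grade_subcomodule k).lact_mem _ (hX.star_mem k ω hω)
  star_d ω := by
    rw [hX.twist_star, hX.twist_star]
    change lact X.coaction (H.Vbar γ) (X.forms.star (X.d ω)) = _
    rw [hX.star_d]
    exact LinearMap.congr_fun (hX.d_comp_lact (H.Vbar γ)) (X.forms.star ω)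
  star_mul k l ω hω η hη := StarAlgData.twist_star_mul hX.isComoduleAlgebra hX.coaction_star h hγ
    (hX.grade_subcomodule k) (hX.grade_subcomodule l) (hX.star_mul k l) hω hη
  coaction_star := StarAlgData.twist_coaction_star hX.isComoduleAlgebra.toIsCoaction
    hX.coaction_star h hγ

theorem twist_leftAction (hX : X.IsCovariantStarCalculus H)
    (γ : A ⊗[ℂ] A →ₗ[ℂ] ℂ) :
    (X.twist H γ).leftAction = twistMap γ X.baseCoaction X.coaction X.leftAction := by
  have h1 := lact_comp_of_equivariant (tcoact_comp_rTensor X.coaction (g := LinearMap.id)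
    (LinearMap.ext hX.coaction_incl)) γ
  rw [LinearMap.rTensor_id, LinearMap.comp_id] at h1
  refine Eq.trans ?_ (congrArg (X.forms.mulMap ∘ₗ ·) h1)
  exact TensorProduct.ext' fun _ _ => rfl

theorem twist_rightAction (hX : X.IsCovariantStarCalculus H)
    (γ : A ⊗[ℂ] A →ₗ[ℂ] ℂ) :
    (X.twist H γ).rightAction = twistMap γ X.coaction X.baseCoaction X.rightAction := by
  have h1 := lact_comp_of_equivariant (tcoact_comp_lTensor X.coaction (g := LinearMap.id)
    (LinearMap.ext hX.coaction_incl)) γ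
  rw [LinearMap.lTensor_id, LinearMap.comp_id] at h1
  refine Eq.trans ?_ (congrArg (X.forms.mulMap ∘ₗ ·) h1)
  exact TensorProduct.ext' fun _ _ => rfl

end IsCovariantStarCalculus

end CalculusData

theorem ComplexData.IsCovariantComplexStructure.twist {X : ComplexData A B Ω}
    (hX : X.IsCovariantComplexStructure H) (h : H.IsHopfStarAlgebra)
    (hγ : H.IsUnitaryTwoCocycle γ) :
    (X.twist H γ).IsCovariantComplexStructure (H.twist γ) where
  toIsCovariantStarCalculus := hX.toIsCovariantStarCalculus.twist h hγ
  bigrade_internal := hX.bigrade_internal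
  bigrade_one_mem := hX.bigrade_one_mem
  bigrade_mul_mem p q ω hω η hη := StarAlgData.twist_mul_mem (hX.bigrade_subcomodule p.1 p.2)
    (hX.bigrade_subcomodule q.1 q.2) (hX.bigrade_mul_mem p q) hω hη
  grade_eq := hX.grade_eq
  bigrade_zero := hX.bigrade_zero
  star_bigrade := by
    have h1 : ∀ p q, ∀ ω ∈ X.bigrade (p, q), (X.twist H γ).forms.star ω ∈ X.bigrade (q, p) :=
      fun p q ω hω => by
        refine (hX.toIsCovariantStarCalculus.twist_star ω).symm ▸
          (hX.bigrade_subcomodule q p).lact_mem _ ?_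
        rw [← SetLike.mem_coe, ← hX.star_bigrade p q]
        exact ⟨ω, hω, rfl⟩
    refine fun p q => Set.Subset.antisymm ?_ fun ω hω => ?_
    · rintro _ ⟨ω, hω, rfl⟩
      exact h1 p q ω hω
    -- Since the twisted involution squares to the identity, the preimage of ω is its own twisted
    -- adjoint.
    · exact ⟨_, h1 q p ω hω, (hX.toIsCovariantStarCalculus.twist h hγ).star_star ω⟩
  d_bigrade := hX.d_bigrade
  del_eq := hX.del_eq
  delbar_eq := hX.delbar_eq
  bigrade_subcomodule := hX.bigrade_subcomodule

end TwistedCalculi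

end CocycleTwist

end

theorem mainTheorem7 {A B Ω : Type*}
    [AddCommGroup A] [Module ℂ A] [Coalgebra ℂ A]
    [AddCommGroup B] [Module ℂ B] [AddCommGroup Ω] [Module ℂ Ω]
    (H : HopfStarData A) (hH : H.IsHopfStarAlgebra)
    (X : ComplexData A B Ω) (hX : X.IsCovariantComplexStructure H)
    (γ : A ⊗[ℂ] A →ₗ[ℂ] ℂ) (hγ : H.IsUnitaryTwoCocycle γ) :
    (H.twist γ).IsHopfStarAlgebra ∧
    (X.twist H γ).IsCovariantComplexStructure (H.twist γ) ∧
    (X.twist H γ).leftAction = twistMap γ X.baseCoaction X.coaction X.leftAction ∧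
    (X.twist H γ).rightAction = twistMap γ X.coaction X.baseCoaction X.rightAction := by
  exact ⟨hH.twist hγ, hX.twist hH hγ, hX.toIsCovariantStarCalculus.twist_leftAction γ,
    hX.toIsCovariantStarCalculus.twist_rightAction γ⟩
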